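/- Let $n,r,p$ be integers with $r\ge 0$ and $p\ge 2$. Let $A=QQ^*\in\mathbb{C}^{n\times n}$ be Hermitian positive definite with $Q\in\mathbb{C}^{n\times n}$, let $B\in\mathbb{C}^{n\times n}$ be Hermitian positive semidefinite with $r+p\le\operatorname{rank}(B)$, and put $S=A+B$ and $G=Q^{-1}BQ^{-*}$. Write $\lambda_1(G)\ge\dots\ge\lambda_n(G)$ for the eigenvalues of $G$, $\|\cdot\|_F$ for the Frobenius norm, and $$\mathcal{D}_{\mathrm{LD}}(X,Y)=\operatorname{tr}(XY^{-1})-\log\det(XY^{-1})-n$$ for the log-determinant divergence of positive definite matrices. Let $\widehat S$ be a minimiser of $\mathcal{D}_{\mathrm{LD}}(\mathcal P,S)$ over all $\mathcal P=Q(I+X)Q^*$ with $X$ Hermitian positive semidefinite and $\operatorname{rank}(X)\le r$. Let $\Omega\in\mathbb{R}^{n\times(r+p)}$ be a random matrix with independent standard normal entries, let $\Theta\in\mathbb{C}^{n\times(r+p)}$ be a matrix whose columns almost surely form an orthonormal basis of the range of $G\Omega$, and set $$G\langle\Omega\rangle=\Theta\Theta^*G\,\Theta\Theta^*,\qquad \widehat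 S_{\mathrm{rand}}=Q(I+G\langle\Omega\rangle)Q^*.$$ Then $\mathcal{D}_{\mathrm{LD}}(\widehat S_{\mathrm{rand}},S)$ is integrable and $$\mathbb{E}\big[\mathcal{D}_{\mathrm{LD}}(\widehat S_{\mathrm{rand}},S)\big]-\mathcal{D}_{\mathrm{LD}}(\widehat S,S)\le 2\epsilon c_r,$$ where $$\epsilon=\sqrt{\Big(1+\frac{r}{p-1}\Big)\sum_{j=r+1}^n\lambda_j(G)^2},\qquad c_r=\|(I+G)^{-1}\|_F+r\,(1+\lambda_{\operatorname{rank}(B)}(G))^{-1}.$$ Furthermore, $\mathcal{D}_{\mathrm{LD}}(\widehat S,S)>0$ and $$\frac{\mathbb{E}\big[\mathcal{D}_{\mathrm{LD}}(\widehat S_{\mathrm{rand}},S)\big]-\mathcal{D}_{\mathrm{LD}}(\widehat S,S)}{\mathcal{D}_{\mathrm{LD}}(\widehat S,S)}\le 2c_r\sqrt{\frac{1+\frac{r}{p-1}}{n-r}}\;\frac{\lambda_{r+1}(G)}{\frac{1}{1+\lambda_{\operatorname{rank}(B)}(G)}-\log\Big(\frac{1}{1+\lambda_{\operatorname{rank}(B)}(G)}\Big)-1}.$$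 -/

import Mathlib

open MeasureTheory ProbabilityTheory Matrix
open scoped ComplexOrder

/-- The log-determinant (Burg) divergence `tr(X Y⁻¹) - log det(X Y⁻¹) - n` of positive definite
Hermitian matrices. The trace and the determinant are real there, so real parts lose nothing. -/
noncomputable def logDetDiv {n : ℕ} (X Y : Matrix (Fin n) (Fin n) ℂ) : ℝ :=
  (X * Y⁻¹).trace.re - Real.log (X * Y⁻¹).det.re - n

/-- The matrix `G = Q⁻¹ B Q⁻*`. -/
noncomputable def scaledMatrix {n : ℕ} (Q B : Matrix (Fin n) (Fin n) ℂ) :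
    Matrix (Fin n) (Fin n) ℂ :=
  Q⁻¹ * B * (Q⁻¹)ᴴ

/-- The matrix `Q (I + X) Q*`. -/
noncomputable def precond {n : ℕ} (Q X : Matrix (Fin n) (Fin n) ℂ) : Matrix (Fin n) (Fin n) ℂ :=
  Q * (1 + X) * Qᴴ

/-- `P` is a minimiser of the divergence to `S` among the matrices `Q (I + X) Q*` with
`X` Hermitian positive semidefinite of rank at most `r`. -/
def IsOptimalPrecond {n : ℕ} (Q S : Matrix (Fin n) (Fin n) ℂ) (r : ℕ)
    (P : Matrix (Fin n) (Fin n) ℂ) : Prop :=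
  (∃ X : Matrix (Fin n) (Fin n) ℂ, X.PosSemidef ∧ X.rank ≤ r ∧ P = precond Q X) ∧
    ∀ X : Matrix (Fin n) (Fin n) ℂ, X.PosSemidef → X.rank ≤ r →
      logDetDiv P S ≤ logDetDiv (precond Q X) S

open Classical in
/-- The `j`-th largest eigenvalue, `1 ≤ j ≤ n`, counted with multiplicity, of a Hermitian
matrix (and `0` for other indices or matrices). -/
noncomputable def eig {n : ℕ} (M : Matrix (Fin n) (Fin n) ℂ) (j : ℕ) : ℝ :=
  if h : M.IsHermitian ∧ 1 ≤ j ∧ j ≤ n then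
    h.1.eigenvalues₀ ⟨j - 1, by rw [Fintype.card_fin]; omega⟩
  else 0

section Frobenius

open scoped Matrix.Norms.Frobenius

/-- The Frobenius norm. -/
noncomputable def frobNorm {n : ℕ} (M : Matrix (Fin n) (Fin n) ℂ) : ℝ := ‖M‖

end Frobenius

/-- A random real matrix whose entries are independent standard normal variables. -/
def IsGaussianTestMatrix {𝓦 : Type*} [MeasurableSpace 𝓦] (μ : Measure 𝓦) {n m : ℕ}
    (Ω : 𝓦 → Matrix (Fin n) (Fin m) ℝ) : Prop :=
  (∀ i j, HasLaw (fun ω => Ω ω i j) (gaussianReal 0 1) μ) ∧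
    iIndepFun (fun (ij : Fin n × Fin m) (ω : 𝓦) => Ω ω ij.1 ij.2) μ

/-- The columns of `Θ` form an orthonormal basis of the range of `Y`. -/
def IsOrthonormalRangeBasis {n m : ℕ} (Y Θ : Matrix (Fin n) (Fin m) ℂ) : Prop :=
  Θᴴ * Θ = 1 ∧ LinearMap.range Θ.mulVecLin = LinearMap.range Y.mulVecLin

/-- The randomised SVD approximation `Θ Θ* G Θ Θ*`. -/
noncomputable def randSVD {n m : ℕ} (G : Matrix (Fin n) (Fin n) ℂ)
    (Θ : Matrix (Fin n) (Fin m) ℂ) : Matrix (Fin n) (Fin n) ℂ :=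
  Θ * Θᴴ * G * (Θ * Θᴴ)

/-- `ε = √((1 + r / (p - 1)) ∑_{j = r + 1}^{n} λ_j(G)²)`. -/
noncomputable def epsBound {n : ℕ} (G : Matrix (Fin n) (Fin n) ℂ) (r p : ℕ) : ℝ :=
  Real.sqrt ((1 + (r : ℝ) / ((p : ℝ) - 1)) * ∑ j ∈ Finset.Icc (r + 1) n, eig G j ^ 2)

/-- `c_r = ‖(I + G)⁻¹‖_F + r (1 + λ_k(G))⁻¹`, used with `k = rank B`. -/
noncomputable def cBound {n : ℕ} (G : Matrix (Fin n) (Fin n) ℂ) (r k : ℕ) : ℝ :=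
  frobNorm (1 + G)⁻¹ + r * (1 + eig G k)⁻¹

/-! Congruence by Q turns every divergence into that of 1 + X from 1 + G, so only G matters. Write k
for its rank and g(x) = log(1 + x) - x/(1 + x) for the divergence of 1 from 1 + x.

Lower bound: by concavity of the logarithm, an X of rank at most r can remove at most r of the gaps
g(λ_j), so the divergence of the minimiser is at least the sum of g(λ_j) over j > r
(`gapTail_le_logDetDiv`).

Upper bound: let P be the orthogonal projection onto the range of GΩ. Fischer's inequality and
Cauchy-Schwarz give, for each realisation of full column rank, a divergence of at most that same
tail plus √(3H/2) ‖(1 - P)G‖_F (`logDetDiv_one_add_pinching_le`). Here H is `resolventSize`, which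
is at most ‖(1 + G)⁻¹‖_F² and at most k - r.

Expectation: the mean of ‖(1 - P)G‖_F² is at most 8/3 (1 + r/(p - 1)) times the tail of λ_j²
(`integral_rangeErr_le`). Since Ω is real and G complex, orthonormal rows W spanning the dominant
eigenspace need not make the rows of WΩ independent. A Takagi factorisation of W Wᵀ rotates W inside
its span until its rows live in mutually orthogonal real subspaces (`exists_isRealFrame`), and the
rows of WΩ become independent. They are not isotropic, so estimates for weighted chi-square
variables replace the inverse Wishart moments. The factor 8/3 is the price, and 3/2 · 8/3 = 2²
produces the constant 2 of the theorem.

Relative bound: H (n - r) ≤ ‖(1 + G)⁻¹‖_F² (k - r), and the tail of gaps is at least (k - r) g(λ_k);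
the factors k - r cancel (`two_mul_sqrt_div_le`). -/

/-! ### One-dimensional Gaussian integrals under exponential tilting. -/

/-- Tilting only shrinks the variance to 1/(1 + 2c), so tilted moments reduce to plain ones. -/
lemma gaussianPDFReal_mul_exp_neg {c : ℝ} (hc : 0 ≤ c) (x : ℝ) :
    gaussianPDFReal 0 1 x * Real.exp (-(c * x ^ 2)) =
      √((1 + 2 * c)⁻¹) * gaussianPDFReal 0 (Real.toNNReal (1 + 2 * c)⁻¹) x := by
  have h : 0 < 1 + 2 * c := by linarith
  simp only [gaussianPDFReal, Real.coe_toNNReal _ (inv_pos.2 h).le, NNReal.coe_one, sub_zero]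
  rw [mul_assoc, ← Real.exp_add, ← mul_assoc]
  congr 1
  · have hs : √(1 + 2 * c) ≠ 0 := (Real.sqrt_pos.2 h).ne'
    have hp : √(2 * Real.pi) ≠ 0 := (Real.sqrt_pos.2 (by positivity)).ne'
    rw [mul_one, Real.sqrt_mul (by positivity) (1 + 2 * c)⁻¹, Real.sqrt_inv]
    field_simp
  · congr 1
    field_simp
    ring

lemma integral_mul_exp_neg_gaussianReal {c : ℝ} (hc : 0 ≤ c) (g : ℝ → ℝ) :
    ∫ x, g x * Real.exp (-(c * x ^ 2)) ∂gaussianReal 0 1 =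
      √((1 + 2 * c)⁻¹) * ∫ x, g x ∂gaussianReal 0 (Real.toNNReal (1 + 2 * c)⁻¹) := by
  have h : 0 < 1 + 2 * c := by linarith
  have hv : Real.toNNReal (1 + 2 * c)⁻¹ ≠ 0 := by
    simpa [Real.toNNReal_eq_zero] using h
  rw [integral_gaussianReal_eq_integral_smul one_ne_zero,
    integral_gaussianReal_eq_integral_smul hv, ← integral_const_mul]
  congr 1 with x
  simp only [smul_eq_mul]
  rw [mul_left_comm, gaussianPDFReal_mul_exp_neg hc]
  ring

lemma integral_exp_neg_gaussianReal {c : ℝ} (hc : 0 ≤ c) :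
    ∫ x, Real.exp (-(c * x ^ 2)) ∂gaussianReal 0 1 = √((1 + 2 * c)⁻¹) := by
  simpa using integral_mul_exp_neg_gaussianReal hc (fun _ => 1)

lemma integral_sq_gaussianReal (v : NNReal) : ∫ x, x ^ 2 ∂gaussianReal 0 v = v := by
  have h := variance_id_gaussianReal (μ := 0) (v := v)
  rw [variance_eq_integral aemeasurable_id] at h
  simpa using h

lemma integral_sq_mul_exp_neg_gaussianReal {c : ℝ} (hc : 0 ≤ c) :
    ∫ x, x ^ 2 * Real.exp (-(c * x ^ 2)) ∂gaussianReal 0 1 =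
      √((1 + 2 * c)⁻¹) * (1 + 2 * c)⁻¹ := by
  rw [integral_mul_exp_neg_gaussianReal hc, integral_sq_gaussianReal,
    Real.coe_toNNReal _ (by positivity)]

lemma integrable_exp_neg_gaussianReal {c : ℝ} (hc : 0 ≤ c) :
    Integrable (fun x => Real.exp (-(c * x ^ 2))) (gaussianReal 0 1) := by
  refine Integrable.of_bound (by fun_prop) 1 (.of_forall fun x => ?_)
  rw [Real.norm_eq_abs, Real.abs_exp, Real.exp_le_one_iff]
  nlinarith [mul_nonneg hc (sq_nonneg x)]

lemma integrable_sq_mul_exp_neg_gaussianReal {c : ℝ} (hc : 0 ≤ c) :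
    Integrable (fun x => x ^ 2 * Real.exp (-(c * x ^ 2))) (gaussianReal 0 1) := by
  refine Integrable.mono' (g := fun x => x ^ 2) ?_ (by fun_prop) (.of_forall fun x => ?_)
  · exact IsGaussian.memLp_two_id.integrable_sq
  · rw [Real.norm_eq_abs, abs_mul, Real.abs_exp, abs_of_nonneg (sq_nonneg x)]
    refine mul_le_of_le_one_right (sq_nonneg x) (Real.exp_le_one_iff.2 ?_)
    nlinarith [mul_nonneg hc (sq_nonneg x)]

/-! ### Laplace transforms of weighted sums of Gaussian squares. -/

section Weighted

variable {ι : Type*} [Fintype ι]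

/-- The standard Gaussian measure on `ι → ℝ`. -/
noncomputable abbrev piGaussian (ι : Type*) [Fintype ι] : Measure (ι → ℝ) :=
  Measure.pi fun _ => gaussianReal 0 1

lemma lintegral_sq_mul_exp_neg_weighted [DecidableEq ι] {e : ι → ℝ} (he : ∀ i, 0 ≤ e i) {t : ℝ}
    (ht : 0 ≤ t) (i : ι) :
    ∫⁻ x, ENNReal.ofReal (x i ^ 2 * Real.exp (-(t * ∑ l, e l * x l ^ 2))) ∂piGaussian ι =
      ENNReal.ofReal ((1 + 2 * (t * e i))⁻¹ * ∏ l, √((1 + 2 * (t * e l))⁻¹)) := by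
  -- Only the i-th factor carries the square, so the integrand is a product over the coordinates.
  let f : ι → ℝ → ℝ := fun l x =>
    (if l = i then x ^ 2 else 1) * Real.exp (-(t * e l * x ^ 2))
  have hc : ∀ l, 0 ≤ t * e l := fun l => mul_nonneg ht (he l)
  have hf : ∀ x : ι → ℝ, x i ^ 2 * Real.exp (-(t * ∑ l, e l * x l ^ 2)) = ∏ l, f l (x l) := by
    intro x
    simp only [f, Finset.prod_mul_distrib, Finset.prod_ite_eq', Finset.mem_univ, if_true,
      ← Real.exp_sum, Finset.sum_neg_distrib, Finset.mul_sum, mul_assoc]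
  have hint : ∀ l, Integrable (f l) (gaussianReal 0 1) := by
    intro l
    by_cases h : l = i
    · simpa [f, h] using integrable_sq_mul_exp_neg_gaussianReal (hc i)
    · simpa [f, h] using integrable_exp_neg_gaussianReal (hc l)
  simp only [hf]
  rw [← ofReal_integral_eq_lintegral_ofReal (Integrable.fintype_prod hint),
    integral_fintype_prod_eq_prod]
  · congr 1
    have : ∀ l, ∫ x, f l x ∂gaussianReal 0 1 =
        (if l = i then (1 + 2 * (t * e i))⁻¹ else 1) * √((1 + 2 * (t * e l))⁻¹) := by
      intro l
      by_cases h : l = i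
      · subst h
        simpa [f, mul_comm] using integral_sq_mul_exp_neg_gaussianReal (hc l)
      · simpa [f, h] using integral_exp_neg_gaussianReal (hc l)
    simp only [this, Finset.prod_mul_distrib, Finset.prod_ite_eq', Finset.mem_univ, if_true]
  · refine .of_forall fun x => Finset.prod_nonneg fun l _ => ?_
    simp only [f]
    split_ifs <;> positivity

/-- Bernoulli's inequality (1 + 2t)^e ≤ 1 + 2te for 0 ≤ e ≤ 1: weights of total mass at least ν do
no worse than a chi-square variable with ν degrees of freedom. -/
lemma prod_sqrt_inv_le {e : ι → ℝ} (he : ∀ i, 0 ≤ e i) (he1 : ∀ i, e i ≤ 1) {ν : ℝ}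
    (hν : ν ≤ ∑ i, e i) {t : ℝ} (ht : 0 ≤ t) :
    ∏ l, √((1 + 2 * (t * e l))⁻¹) ≤ (1 + 2 * t) ^ (-(ν / 2)) := by
  have h1 : ∀ l, √((1 + 2 * (t * e l))⁻¹) ≤ (1 + 2 * t) ^ (-(e l / 2)) := by
    intro l
    have hb : (1 + 2 * t) ^ e l ≤ 1 + e l * (2 * t) :=
      rpow_one_add_le_one_add_mul_self (by linarith) (he l) (he1 l)
    have h0 : (0 : ℝ) < 1 + 2 * t := by linarith
    rw [Real.sqrt_le_left (by positivity), ← Real.rpow_natCast, ← Real.rpow_mul h0.le,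
      Nat.cast_two, show -(e l / 2) * 2 = -e l by ring, Real.rpow_neg h0.le]
    exact inv_anti₀ (by positivity) (hb.trans_eq (by ring))
  calc ∏ l, √((1 + 2 * (t * e l))⁻¹) ≤ ∏ l, (1 + 2 * t) ^ (-(e l / 2)) :=
        Finset.prod_le_prod (fun l _ => Real.sqrt_nonneg _) fun l _ => h1 l
    _ = (1 + 2 * t) ^ (∑ l, -(e l / 2)) := (Real.rpow_sum_of_pos (by linarith) _ _).symm
    _ ≤ _ := by
        refine Real.rpow_le_rpow_of_exponent_le (by linarith) ?_
        rw [Finset.sum_neg_distrib, ← Finset.sum_div]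
        linarith

end Weighted

/-! ### Integrals over the Laplace parameter. -/

lemma hasDerivAt_one_add_rpow {α : ℝ} (hα : 1 < α) {t : ℝ} (ht : 0 ≤ t) :
    HasDerivAt (fun t : ℝ => -(1 + 2 * t) ^ (1 - α) / (2 * (α - 1)))
      ((1 + 2 * t) ^ (-α)) t := by
  have h : HasDerivAt (fun t : ℝ => (1 + 2 * t) ^ (1 - α))
      ((0 + 2 * 1) * (1 - α) * (1 + 2 * t) ^ (1 - α - 1)) t :=
    (((hasDerivAt_id t).const_mul 2).const_add 1 |>.congr_deriv (by ring)).rpow_const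
      (Or.inl (by simp; linarith))
  refine (h.neg.div_const (2 * (α - 1))).congr_deriv ?_
  have : α - 1 ≠ 0 := by linarith
  rw [show 1 - α - 1 = -α by ring]
  field_simp
  ring

lemma tendsto_one_add_rpow {α : ℝ} (hα : 1 < α) :
    Filter.Tendsto (fun t : ℝ => -(1 + 2 * t) ^ (1 - α) / (2 * (α - 1))) Filter.atTop (nhds 0) := by
  have h : Filter.Tendsto (fun t : ℝ => 1 + 2 * t) Filter.atTop Filter.atTop :=
    Filter.tendsto_atTop_add_const_left _ _ (Filter.tendsto_id.const_mul_atTop (by norm_num))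
  have h2 := (tendsto_rpow_neg_atTop (y := α - 1) (by linarith)).comp h
  have h3 := (h2.neg).div_const (2 * (α - 1))
  simpa [Function.comp_def] using h3

lemma integrableOn_one_add_rpow {α : ℝ} (hα : 1 < α) :
    IntegrableOn (fun t : ℝ => (1 + 2 * t) ^ (-α)) (Set.Ioi 0) :=
  integrableOn_Ioi_deriv_of_nonneg' (fun t ht => hasDerivAt_one_add_rpow hα ht)
    (fun t ht => Real.rpow_nonneg (by linarith [Set.mem_Ioi.1 ht]) _) (tendsto_one_add_rpow hα)

lemma integral_Ioi_one_add_rpow {α : ℝ} (hα : 1 < α) :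
    ∫ t in Set.Ioi (0 : ℝ), (1 + 2 * t) ^ (-α) = 1 / (2 * (α - 1)) := by
  rw [integral_Ioi_of_hasDerivAt_of_nonneg' (fun t ht => hasDerivAt_one_add_rpow hα ht)
    (fun t ht => Real.rpow_nonneg (by linarith [Set.mem_Ioi.1 ht]) _) (tendsto_one_add_rpow hα)]
  simp only [mul_zero, add_zero, Real.one_rpow]
  ring

lemma lintegral_Ioi_one_add_rpow {ν : ℝ} (hν : 2 < ν) :
    ∫⁻ t in Set.Ioi (0 : ℝ), ENNReal.ofReal ((1 + 2 * t) ^ (-(ν / 2))) =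
      ENNReal.ofReal (1 / (ν - 2)) := by
  rw [← ofReal_integral_eq_lintegral_ofReal (integrableOn_one_add_rpow (by linarith)),
    integral_Ioi_one_add_rpow (by linarith)]
  · congr 2; ring
  · filter_upwards [ae_restrict_mem measurableSet_Ioi] with t ht
    exact Real.rpow_nonneg (by linarith [Set.mem_Ioi.1 ht]) _

/-- The identity t/(1 + 2t) = (1 - 1/(1 + 2t))/2 reduces this to two pure powers. -/
lemma lintegral_Ioi_mul_one_add_rpow {ν : ℝ} (hν : 2 < ν) :
    ∫⁻ t in Set.Ioi (0 : ℝ), ENNReal.ofReal (t * ((1 + 2 * t)⁻¹ * (1 + 2 * t) ^ (-(ν / 2)))) =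
      ENNReal.ofReal (1 / (ν * (ν - 2))) := by
  have hcongr : ∀ t ∈ Set.Ioi (0 : ℝ), ENNReal.ofReal
      (t * ((1 + 2 * t)⁻¹ * (1 + 2 * t) ^ (-(ν / 2)))) = ENNReal.ofReal
      (((1 + 2 * t) ^ (-(ν / 2)) - (1 + 2 * t) ^ (-(ν / 2 + 1))) / 2) := by
    intro t ht
    have h0 : (0 : ℝ) < 1 + 2 * t := by linarith [Set.mem_Ioi.1 ht]
    rw [show -(ν / 2 + 1) = -(ν / 2) - 1 by ring, Real.rpow_sub_one h0.ne']
    congr 1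
    generalize (1 + 2 * t) ^ (-(ν / 2)) = y
    obtain ⟨w, hw⟩ : ∃ w, w = 1 + 2 * t := ⟨_, rfl⟩
    obtain rfl : t = (w - 1) / 2 := by linarith
    rw [← hw] at h0 ⊢
    have := h0.ne'
    field_simp
  have hint : IntegrableOn (fun t : ℝ =>
      ((1 + 2 * t) ^ (-(ν / 2)) - (1 + 2 * t) ^ (-(ν / 2 + 1))) / 2) (Set.Ioi 0) :=
    ((integrableOn_one_add_rpow (by linarith)).sub
      (integrableOn_one_add_rpow (by linarith))).div_const 2
  rw [setLIntegral_congr_fun measurableSet_Ioi hcongr,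
    ← ofReal_integral_eq_lintegral_ofReal hint]
  · rw [integral_div, integral_sub (integrableOn_one_add_rpow (by linarith))
      (integrableOn_one_add_rpow (by linarith)), integral_Ioi_one_add_rpow (by linarith),
      integral_Ioi_one_add_rpow (by linarith)]
    congr 1
    have h1 : ν - 2 ≠ 0 := by linarith
    have h2 : ν ≠ 0 := by linarith
    rw [show 2 * (ν / 2 - 1) = ν - 2 by ring, show 2 * (ν / 2 + 1 - 1) = ν by ring]
    field_simp
    ring
  · filter_upwards [ae_restrict_mem measurableSet_Ioi] with t ht
    have h0 : (1 : ℝ) ≤ 1 + 2 * t := by linarith [Set.mem_Ioi.1 ht]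
    have := Real.rpow_le_rpow_of_exponent_le h0 (show -(ν / 2 + 1) ≤ -(ν / 2) by linarith)
    simp only [Pi.zero_apply]
    linarith

/-- Exponentials of a diagonal quadratic form factor over the coordinates, while its inverse powers
do not; this formula and the next trade one for the other. -/
lemma ofReal_inv_eq_lintegral {q : ℝ} (hq : 0 < q) :
    ENNReal.ofReal q⁻¹ = ∫⁻ t in Set.Ioi (0 : ℝ), ENNReal.ofReal (Real.exp (-(t * q))) := by
  have h := integral_exp_mul_Ioi (a := -q) (by linarith) 0
  have hi := integrableOn_exp_mul_Ioi (a := -q) (by linarith) 0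
  simp only [mul_comm (-q), mul_neg] at h hi
  rw [← ofReal_integral_eq_lintegral_ofReal hi (.of_forall fun _ => by positivity), h]
  simp

lemma ofReal_inv_sq_eq_lintegral {q : ℝ} (hq : 0 < q) :
    ENNReal.ofReal (q ^ 2)⁻¹ =
      ∫⁻ t in Set.Ioi (0 : ℝ), ENNReal.ofReal (t * Real.exp (-(t * q))) := by
  have h := Real.integral_rpow_mul_exp_neg_mul_Ioi (a := 2) (r := q) (by norm_num) hq
  have he : ∀ t : ℝ, t ^ ((2 : ℝ) - 1) * Real.exp (-(q * t)) = t * Real.exp (-(t * q)) := by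
    intro t; rw [show (2 : ℝ) - 1 = 1 by norm_num, Real.rpow_one, mul_comm q]
  simp only [he] at h
  have hval : (1 / q) ^ (2 : ℝ) * Real.Gamma 2 = (q ^ 2)⁻¹ := by
    rw [Real.Gamma_two, mul_one, Real.rpow_two]; simp
  rw [hval] at h
  have hi : IntegrableOn (fun t : ℝ => t * Real.exp (-(t * q))) (Set.Ioi 0) := by
    -- A nonzero value of the integral certifies integrability, because the integral of a
    -- non-integrable function is 0 by convention.
    by_contra hc
    rw [IntegrableOn] at hc
    rw [integral_undef hc] at h
    exact (inv_pos.2 (pow_pos hq 2)).ne h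
  rw [← ofReal_integral_eq_lintegral_ofReal hi, h]
  filter_upwards [ae_restrict_mem measurableSet_Ioi] with t ht
  exact mul_nonneg (le_of_lt ht) (Real.exp_nonneg _)

/-! ### Inverse moments of weighted sums of Gaussian squares. -/

section Weighted

variable {ι : Type*} [Fintype ι] [DecidableEq ι]

/-- Write the reciprocal as a Laplace integral and exchange integrals by Tonelli. The bound is the
mean of an inverse chi-square variable with ν degrees of freedom. -/
lemma lintegral_sq_div_weighted_le {e : ι → ℝ} (he : ∀ i, 0 ≤ e i) (he1 : ∀ i, e i ≤ 1) {ν : ℝ}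
    (hν2 : 2 < ν) (hν : ν ≤ ∑ i, e i) (i : ι) :
    ∫⁻ x, ENNReal.ofReal (x i ^ 2 / ∑ l, e l * x l ^ 2) ∂piGaussian ι ≤
      ENNReal.ofReal (1 / (ν - 2)) := by
  have hle : ∀ x : ι → ℝ, ENNReal.ofReal (x i ^ 2 / ∑ l, e l * x l ^ 2) ≤
      ∫⁻ t in Set.Ioi (0 : ℝ),
        ENNReal.ofReal (x i ^ 2 * Real.exp (-(t * ∑ l, e l * x l ^ 2))) := by
    intro x
    have h0 : 0 ≤ ∑ l, e l * x l ^ 2 := Finset.sum_nonneg fun l _ => mul_nonneg (he l) (sq_nonneg _)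
    rcases h0.eq_or_lt with h | h
    -- A vanishing denominator makes the quotient 0.
    · simp [← h]
    · simp_rw [ENNReal.ofReal_mul (sq_nonneg (x i))]
      rw [lintegral_const_mul _ (by fun_prop), ← ofReal_inv_eq_lintegral h,
        ← ENNReal.ofReal_mul (sq_nonneg _), div_eq_mul_inv]
  calc _ ≤ _ := lintegral_mono hle
    _ = ∫⁻ t in Set.Ioi (0 : ℝ), ∫⁻ x,
        ENNReal.ofReal (x i ^ 2 * Real.exp (-(t * ∑ l, e l * x l ^ 2))) ∂piGaussian ι :=
      lintegral_lintegral_swap (by fun_prop)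
    _ ≤ ∫⁻ t in Set.Ioi (0 : ℝ), ENNReal.ofReal ((1 + 2 * t) ^ (-(ν / 2))) := by
      refine setLIntegral_mono' measurableSet_Ioi fun t ht => ?_
      have ht0 : 0 ≤ t := le_of_lt ht
      rw [lintegral_sq_mul_exp_neg_weighted he ht0]
      refine ENNReal.ofReal_le_ofReal ?_
      have hi : (1 + 2 * (t * e i))⁻¹ ≤ 1 :=
        inv_le_one_of_one_le₀ (by nlinarith [mul_nonneg ht0 (he i)])
      calc _ ≤ 1 * ∏ l, √((1 + 2 * (t * e l))⁻¹) :=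
            mul_le_mul_of_nonneg_right hi (Finset.prod_nonneg fun _ _ => Real.sqrt_nonneg _)
        _ ≤ _ := by rw [one_mul]; exact prod_sqrt_inv_le he he1 hν ht0
    _ = _ := lintegral_Ioi_one_add_rpow hν2

/-- The weight in the numerator is essential: e/(1 + 2te) ≤ 1/(1 + 2t) supplies the extra decay that
compensates the factor t of the Laplace formula for 1/q². -/
lemma lintegral_mul_sq_div_weighted_sq_le {e : ι → ℝ} (he : ∀ i, 0 ≤ e i) (he1 : ∀ i, e i ≤ 1)
    {ν : ℝ} (hν2 : 2 < ν) (hν : ν ≤ ∑ i, e i) (i : ι) :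
    ∫⁻ x, ENNReal.ofReal (e i * x i ^ 2 / (∑ l, e l * x l ^ 2) ^ 2) ∂piGaussian ι ≤
      ENNReal.ofReal (1 / (ν * (ν - 2))) := by
  have hle : ∀ x : ι → ℝ, ENNReal.ofReal (e i * x i ^ 2 / (∑ l, e l * x l ^ 2) ^ 2) ≤
      ∫⁻ t in Set.Ioi (0 : ℝ), ENNReal.ofReal (e i) * ENNReal.ofReal t *
        ENNReal.ofReal (x i ^ 2 * Real.exp (-(t * ∑ l, e l * x l ^ 2))) := by
    intro x
    have h0 : 0 ≤ ∑ l, e l * x l ^ 2 := Finset.sum_nonneg fun l _ => mul_nonneg (he l) (sq_nonneg _)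
    rcases h0.eq_or_lt with h | h
    · simp [← h]
    · have hc : ∀ t ∈ Set.Ioi (0 : ℝ), ENNReal.ofReal (e i) * ENNReal.ofReal t *
          ENNReal.ofReal (x i ^ 2 * Real.exp (-(t * ∑ l, e l * x l ^ 2))) =
          ENNReal.ofReal (e i * x i ^ 2) *
            ENNReal.ofReal (t * Real.exp (-(t * ∑ l, e l * x l ^ 2))) := by
        intro t ht
        have ht0 : 0 ≤ t := le_of_lt ht
        rw [← ENNReal.ofReal_mul (he i), ← ENNReal.ofReal_mul (mul_nonneg (he i) ht0),
          ← ENNReal.ofReal_mul (mul_nonneg (he i) (sq_nonneg _))]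
        congr 1; ring
      rw [setLIntegral_congr_fun measurableSet_Ioi hc,
        lintegral_const_mul _ (by fun_prop), ← ofReal_inv_sq_eq_lintegral h,
        ← ENNReal.ofReal_mul (mul_nonneg (he i) (sq_nonneg _)), div_eq_mul_inv]
  calc _ ≤ _ := lintegral_mono hle
    _ = ∫⁻ t in Set.Ioi (0 : ℝ), ∫⁻ x, ENNReal.ofReal (e i) * ENNReal.ofReal t *
        ENNReal.ofReal (x i ^ 2 * Real.exp (-(t * ∑ l, e l * x l ^ 2))) ∂piGaussian ι :=
      lintegral_lintegral_swap (by fun_prop)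
    _ ≤ ∫⁻ t in Set.Ioi (0 : ℝ),
        ENNReal.ofReal (t * ((1 + 2 * t)⁻¹ * (1 + 2 * t) ^ (-(ν / 2)))) := by
      refine setLIntegral_mono' measurableSet_Ioi fun t ht => ?_
      have ht0 : 0 ≤ t := le_of_lt ht
      rw [lintegral_const_mul _ (by fun_prop), lintegral_sq_mul_exp_neg_weighted he ht0,
        ← ENNReal.ofReal_mul (he i), ← ENNReal.ofReal_mul (mul_nonneg (he i) ht0)]
      refine ENNReal.ofReal_le_ofReal ?_
      have hi : e i * (1 + 2 * (t * e i))⁻¹ ≤ (1 + 2 * t)⁻¹ := by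
        have h1 : 0 < 1 + 2 * (t * e i) := by nlinarith [mul_nonneg ht0 (he i)]
        have h2 : 0 < 1 + 2 * t := by linarith
        rw [← div_eq_mul_inv, ← one_div, div_le_div_iff₀ h1 h2]
        nlinarith [he1 i]
      calc e i * t * ((1 + 2 * (t * e i))⁻¹ * ∏ l, √((1 + 2 * (t * e l))⁻¹))
          = t * ((e i * (1 + 2 * (t * e i))⁻¹) * ∏ l, √((1 + 2 * (t * e l))⁻¹)) := by ring
        _ ≤ _ := by
          refine mul_le_mul_of_nonneg_left (mul_le_mul hi (prod_sqrt_inv_le he he1 hν ht0)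
            (Finset.prod_nonneg fun _ _ => Real.sqrt_nonneg _) ?_) ht0
          exact inv_nonneg.2 (by linarith)
    _ = _ := lintegral_Ioi_mul_one_add_rpow hν2

end Weighted

/-! ### Symmetrisation. -/

/-- Averaging over τ removes the odd part of f; the additive form avoids subtraction of extended
nonnegative numbers. -/
lemma lintegral_eq_of_add_comp_eq {α : Type*} [MeasurableSpace α] {μ : Measure α} {τ : α → α}
    (hτ : MeasurePreserving τ μ μ) {f g : α → ENNReal} (hf : Measurable f) (hg : Measurable g)
    (h : ∀ x, f x + f (τ x) = g x + g x) : ∫⁻ x, f x ∂μ = ∫⁻ x, g x ∂μ := by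
  have h1 : ∫⁻ x, f (τ x) ∂μ = ∫⁻ x, f x ∂μ := hτ.lintegral_comp hf
  have h2 : ∫⁻ x, f x ∂μ + ∫⁻ x, f x ∂μ = ∫⁻ x, g x ∂μ + ∫⁻ x, g x ∂μ := by
    nth_rewrite 2 [← h1]
    rw [← lintegral_add_left hf, ← lintegral_add_left hg]
    exact lintegral_congr h
  rw [← two_mul, ← two_mul] at h2
  exact (ENNReal.mul_right_inj (by norm_num) (by norm_num)).1 h2

lemma lintegral_sq_piGaussian {ι : Type*} [Fintype ι] (i : ι) :
    ∫⁻ x, ENNReal.ofReal (x i ^ 2) ∂piGaussian ι = 1 := by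
  have h := (measurePreserving_eval (fun _ : ι => gaussianReal 0 1) i).lintegral_comp
    (f := fun x : ℝ => ENNReal.ofReal (x ^ 2)) (by fun_prop)
  simp only [Function.eval] at h
  have hi : Integrable (fun x : ℝ => x ^ 2) (gaussianReal 0 1) :=
    IsGaussian.memLp_two_id.integrable_sq
  rw [h, ← ofReal_integral_eq_lintegral_ofReal hi (.of_forall fun x => sq_nonneg _)]
  simp [integral_sq_gaussianReal]

section PiFlip

variable {ι : Type*} [Fintype ι] [DecidableEq ι]

/-- The change of sign of the `i`-th coordinate. -/
def flipCoord (i : ι) (x : ι → ℝ) : ι → ℝ := fun l => if l = i then -x l else x l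

lemma measurePreserving_flipCoord (i : ι) :
    MeasurePreserving (flipCoord i) (piGaussian ι) (piGaussian ι) := by
  have h : ∀ l : ι, MeasurePreserving (fun x : ℝ => if l = i then -x else x)
      (gaussianReal 0 1) (gaussianReal 0 1) := by
    intro l
    by_cases hl : l = i
    · simp only [hl, if_true]
      refine ⟨by fun_prop, ?_⟩
      simpa using gaussianReal_map_neg (μ := 0) (v := 1)
    · simp only [hl, if_false]
      exact MeasurePreserving.id _
  exact measurePreserving_pi _ _ h

/-- The weight φ is even in each coordinate, so flipping one sign at a time cancels the cross terms
through the parallelogram law. -/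
lemma lintegral_norm_sq_sum_mul {H : Type*} [NormedAddCommGroup H] [InnerProductSpace ℝ H]
    [MeasurableSpace H] [BorelSpace H] [SecondCountableTopology H] (a : ι → H)
    {φ : (ι → ℝ) → ENNReal} (hφ : Measurable φ) (hflip : ∀ i x, φ (flipCoord i x) = φ x)
    (s : Finset ι) :
    ∫⁻ x, ENNReal.ofReal (‖∑ i ∈ s, x i • a i‖ ^ 2) * φ x ∂piGaussian ι =
      ∑ i ∈ s, ENNReal.ofReal (‖a i‖ ^ 2) *
        ∫⁻ x, ENNReal.ofReal (x i ^ 2) * φ x ∂piGaussian ι := by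
  induction s using Finset.induction_on with
  | empty => simp
  | insert j s hj ih =>
    rw [Finset.sum_insert hj, ← ih, ← lintegral_const_mul _ (by fun_prop),
      ← lintegral_add_left (by fun_prop)]
    refine lintegral_eq_of_add_comp_eq (measurePreserving_flipCoord j) (by fun_prop) (by fun_prop)
      fun x => ?_
    have h1 : ∑ i ∈ insert j s, flipCoord j x i • a i = -(x j • a j) + ∑ i ∈ s, x i • a i := by
      rw [Finset.sum_insert hj]
      congr 1
      · simp [flipCoord]
      · refine Finset.sum_congr rfl fun i hi => ?_
        have : i ≠ j := fun h => hj (h ▸ hi)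
        simp [flipCoord, this]
    rw [h1, Finset.sum_insert hj, hflip, ← mul_assoc,
      ← ENNReal.ofReal_mul (sq_nonneg _), ← add_mul, ← add_mul,
      ← ENNReal.ofReal_add (by positivity) (by positivity),
      ← ENNReal.ofReal_add (by positivity) (by positivity), ← add_mul,
      ← ENNReal.ofReal_add (by positivity) (by positivity)]
    congr 2
    have hp := parallelogram_law_with_norm ℝ (∑ i ∈ s, x i • a i) (x j • a j)
    have hn : ‖x j • a j‖ ^ 2 = ‖a j‖ ^ 2 * x j ^ 2 := by
      rw [norm_smul, mul_pow, Real.norm_eq_abs, sq_abs, mul_comm]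
    rw [← hn, neg_add_eq_sub, add_comm (x j • a j)]
    nlinarith [hp]

end PiFlip

/-! ### Linear images of standard Gaussian vectors. -/

/-- These are right singular vectors, that is, eigenvectors of T* T. -/
lemma exists_orthonormalBasis_map_orthogonal {E F : Type*} [NormedAddCommGroup E]
    [InnerProductSpace ℝ E] [FiniteDimensional ℝ E] [NormedAddCommGroup F] [InnerProductSpace ℝ F]
    [FiniteDimensional ℝ F] (T : E →ₗ[ℝ] F) :
    ∃ b : OrthonormalBasis (Fin (Module.finrank ℝ E)) ℝ E,
      ∀ i j, i ≠ j → inner ℝ (T (b i)) (T (b j)) = 0 := by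
  have hs : (T.adjoint ∘ₗ T : E →ₗ[ℝ] E).IsSymmetric := T.isSymmetric_adjoint_comp_self
  refine ⟨hs.eigenvectorBasis rfl, fun i j hij => ?_⟩
  rw [← LinearMap.adjoint_inner_right]
  have := hs.apply_eigenvectorBasis rfl j
  change T.adjoint (T (hs.eigenvectorBasis rfl j)) = _ at this
  rw [this, inner_smul_right, (hs.eigenvectorBasis rfl).orthonormal.2 hij, mul_zero]

lemma norm_sq_map_sum {ι E F : Type*} [NormedAddCommGroup E] [InnerProductSpace ℝ E]
    [NormedAddCommGroup F] [InnerProductSpace ℝ F] [Fintype ι] {b : OrthonormalBasis ι ℝ E} {T : E →ₗ[ℝ] F}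
    (hb : ∀ i j, i ≠ j → inner ℝ (T (b i)) (T (b j)) = 0) (x : ι → ℝ) :
    ‖T (∑ i, x i • b i)‖ ^ 2 = ∑ i, ‖T (b i)‖ ^ 2 * x i ^ 2 := by
  classical
  rw [map_sum, ← real_inner_self_eq_norm_sq, sum_inner]
  refine Finset.sum_congr rfl fun i _ => ?_
  rw [inner_sum, Finset.sum_eq_single i]
  · simp only [map_smul, inner_smul_left, inner_smul_right, real_inner_self_eq_norm_sq]
    simp only [conj_trivial]
    ring
  · intro j _ hji
    simp [inner_smul_left, inner_smul_right, hb i j hji.symm]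
  · simp

section StdGaussian

variable {E F H : Type*} [NormedAddCommGroup E] [InnerProductSpace ℝ E] [FiniteDimensional ℝ E]
  [MeasurableSpace E] [BorelSpace E]
  [NormedAddCommGroup F] [InnerProductSpace ℝ F] [FiniteDimensional ℝ F]
  [NormedAddCommGroup H] [InnerProductSpace ℝ H] [FiniteDimensional ℝ H]

lemma lintegral_stdGaussian_eq {ι : Type*} [Fintype ι] (b : OrthonormalBasis ι ℝ E)
    {f : E → ENNReal} (hf : Measurable f) :
    ∫⁻ x, f x ∂stdGaussian E = ∫⁻ x, f (∑ i, x i • b i) ∂piGaussian ι := by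
  rw [stdGaussian_eq_map_pi_orthonormalBasis b, lintegral_map hf (by fun_prop)]

/-- When C C* + S S* = 1, the characteristic function of C x + S y with independent x and y is the
standard one; `h` is this identity read on vectors. -/
lemma lintegral_stdGaussian_add {C S C' S' : E →ₗ[ℝ] E}
    (hC : ∀ x y, inner ℝ (C x) y = inner ℝ x (C' y))
    (hS : ∀ x y, inner ℝ (S x) y = inner ℝ x (S' y))
    (h : ∀ t, ‖C' t‖ ^ 2 + ‖S' t‖ ^ 2 = ‖t‖ ^ 2) {f : E → ENNReal} (hf : Measurable f) :
    ∫⁻ x, f x ∂stdGaussian E = ∫⁻ x, ∫⁻ y, f (C x + S y) ∂stdGaussian E ∂stdGaussian E := by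
  have hCc : Continuous C := C.continuous_of_finiteDimensional
  have hSc : Continuous S := S.continuous_of_finiteDimensional
  have hm : Measurable fun z : E × E => C z.1 + S z.2 := by fun_prop
  have key : ((stdGaussian E).prod (stdGaussian E)).map (fun z : E × E => C z.1 + S z.2) =
      stdGaussian E := by
    have := Measure.isProbabilityMeasure_map (μ := (stdGaussian E).prod (stdGaussian E))
      hm.aemeasurable
    apply Measure.ext_of_charFun
    ext t
    rw [charFun_stdGaussian, charFun_apply, integral_map hm.aemeasurable (by fun_prop)]
    have h1 : ∀ z : E × E, Complex.exp (((inner ℝ (C z.1 + S z.2) t : ℝ) : ℂ) * Complex.I) =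
        Complex.exp (((inner ℝ z.1 (C' t) : ℝ) : ℂ) * Complex.I) *
          Complex.exp (((inner ℝ z.2 (S' t) : ℝ) : ℂ) * Complex.I) := by
      intro z
      rw [inner_add_left, hC, hS, ← Complex.exp_add]
      push_cast
      ring_nf
    simp_rw [h1]
    rw [integral_prod_mul (fun x : E => Complex.exp (((inner ℝ x (C' t) : ℝ) : ℂ) * Complex.I))
      (fun x : E => Complex.exp (((inner ℝ x (S' t) : ℝ) : ℂ) * Complex.I)),
      ← charFun_apply, ← charFun_apply, charFun_stdGaussian, charFun_stdGaussian,
      ← Complex.exp_add]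
    congr 1
    rw [← add_div, ← neg_add]
    congr 2
    exact_mod_cast h t
  calc ∫⁻ x, f x ∂stdGaussian E = _ := by
        conv_lhs => rw [← key]
        exact lintegral_map hf hm
    _ = ∫⁻ x, ∫⁻ y, f (C x + S y) ∂stdGaussian E ∂stdGaussian E :=
      lintegral_prod (fun z : E × E => f (C z.1 + S z.2)) (by fun_prop)

lemma measurePreserving_stdGaussian {C C' : E →ₗ[ℝ] E}
    (hC : ∀ x y, inner ℝ (C x) y = inner ℝ x (C' y)) (h : ∀ t, ‖C' t‖ = ‖t‖) :
    MeasurePreserving C (stdGaussian E) (stdGaussian E) := by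
  have hCm : Measurable C := C.continuous_of_finiteDimensional.measurable
  refine ⟨hCm, Measure.ext fun s hs => ?_⟩
  rw [← lintegral_indicator_one hs, ← lintegral_indicator_one hs,
    lintegral_map (measurable_one.indicator hs) hCm,
    lintegral_stdGaussian_add (S := 0) (S' := 0) hC (by simp) (by simp [h])
      (measurable_one.indicator hs)]
  simp

lemma lintegral_norm_sq_stdGaussian {ι : Type*} [Fintype ι] (b : OrthonormalBasis ι ℝ E)
    (T : E →ₗ[ℝ] F) :
    ∫⁻ x, ENNReal.ofReal (‖T x‖ ^ 2) ∂stdGaussian E = ∑ i, ENNReal.ofReal (‖T (b i)‖ ^ 2) := by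
  classical
  let _ : MeasurableSpace F := borel F
  have : BorelSpace F := ⟨rfl⟩
  have hT : Continuous T := T.continuous_of_finiteDimensional
  rw [lintegral_stdGaussian_eq b (by fun_prop)]
  have := lintegral_norm_sq_sum_mul (fun i => T (b i)) (φ := fun _ => 1) (by fun_prop)
    (by simp) Finset.univ
  simp only [mul_one, lintegral_sq_piGaussian] at this
  simpa [map_sum] using this

variable {T : E →ₗ[ℝ] F} {ν : ℝ}

/-- In a singular basis of T the denominator is a weighted sum of squares, with weights in [0, 1] of
total E‖T x‖² ≥ ν, and sign flips remove the cross terms of the numerator. -/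
lemma lintegral_norm_sq_div_le (hT : ∀ x, ‖T x‖ ≤ ‖x‖) (hν2 : 2 < ν)
    (hν : ENNReal.ofReal ν ≤ ∫⁻ x, ENNReal.ofReal (‖T x‖ ^ 2) ∂stdGaussian E)
    (A : E →ₗ[ℝ] H) :
    ∫⁻ x, ENNReal.ofReal (‖A x‖ ^ 2 / ‖T x‖ ^ 2) ∂stdGaussian E ≤
      ENNReal.ofReal (1 / (ν - 2)) * ∫⁻ x, ENNReal.ofReal (‖A x‖ ^ 2) ∂stdGaussian E := by
  let _ : MeasurableSpace H := borel H
  have : BorelSpace H := ⟨rfl⟩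
  obtain ⟨b, hb⟩ := exists_orthonormalBasis_map_orthogonal T
  have hTc : Continuous T := T.continuous_of_finiteDimensional
  have hAc : Continuous A := A.continuous_of_finiteDimensional
  have he1 : ∀ i, ‖T (b i)‖ ^ 2 ≤ 1 := fun i => by
    have := hT (b i)
    rw [b.orthonormal.1 i] at this
    exact pow_le_one₀ (norm_nonneg _) this
  rw [lintegral_norm_sq_stdGaussian b, ← ENNReal.ofReal_sum_of_nonneg fun i _ => sq_nonneg _,
    ENNReal.ofReal_le_ofReal_iff (Finset.sum_nonneg fun i _ => sq_nonneg _)] at hν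
  have hm : Measurable fun x => ENNReal.ofReal (‖A x‖ ^ 2 / ‖T x‖ ^ 2) :=
    ((hAc.norm.pow 2).measurable.div (hTc.norm.pow 2).measurable).ennreal_ofReal
  rw [lintegral_norm_sq_stdGaussian b A, lintegral_stdGaussian_eq b hm]
  simp only [norm_sq_map_sum hb]
  have hdiv : ∀ (y : ℝ) (x : Fin (Module.finrank ℝ E) → ℝ), 0 ≤ y →
      ENNReal.ofReal (y / ∑ i, ‖T (b i)‖ ^ 2 * x i ^ 2) = ENNReal.ofReal y *
        ENNReal.ofReal (∑ i, ‖T (b i)‖ ^ 2 * x i ^ 2)⁻¹ := fun y x hy => by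
    rw [div_eq_mul_inv, ENNReal.ofReal_mul hy]
  simp only [hdiv _ _ (sq_nonneg _), map_sum, map_smul]
  rw [lintegral_norm_sq_sum_mul (fun i => A (b i)) (by fun_prop)
    (fun i x => by
      congr 2
      refine Finset.sum_congr rfl fun l _ => ?_
      by_cases h : l = i <;> simp [flipCoord, h]) Finset.univ, Finset.mul_sum]
  refine Finset.sum_le_sum fun i _ => ?_
  rw [mul_comm]
  refine mul_le_mul_left ?_ _
  simp only [← hdiv _ _ (sq_nonneg _)]
  exact lintegral_sq_div_weighted_le (fun _ => sq_nonneg _) he1 hν2 hν i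

/-- The squared singular value in each numerator feeds the second inverse moment. What remains is A
on the left singular vectors, an orthonormal family to which `hA` applies. -/
lemma lintegral_norm_sq_comp_div_le (hT : ∀ x, ‖T x‖ ≤ ‖x‖) (hν2 : 2 < ν)
    (hν : ENNReal.ofReal ν ≤ ∫⁻ x, ENNReal.ofReal (‖T x‖ ^ 2) ∂stdGaussian E)
    (A : F →ₗ[ℝ] H) {h : ℝ}
    (hA : ∀ (κ : Type) [Fintype κ] (f : κ → F), Orthonormal ℝ f → ∑ i, ‖A (f i)‖ ^ 2 ≤ h) :
    ∫⁻ x, ENNReal.ofReal (‖A (T x)‖ ^ 2 / (‖T x‖ ^ 2) ^ 2) ∂stdGaussian E ≤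
      ENNReal.ofReal (h / (ν * (ν - 2))) := by
  classical
  let _ : MeasurableSpace H := borel H
  have : BorelSpace H := ⟨rfl⟩
  obtain ⟨b, hb⟩ := exists_orthonormalBasis_map_orthogonal T
  have hTc : Continuous T := T.continuous_of_finiteDimensional
  have hAc : Continuous A := A.continuous_of_finiteDimensional
  have he1 : ∀ i, ‖T (b i)‖ ^ 2 ≤ 1 := fun i => by
    have := hT (b i)
    rw [b.orthonormal.1 i] at this
    exact pow_le_one₀ (norm_nonneg _) this
  rw [lintegral_norm_sq_stdGaussian b, ← ENNReal.ofReal_sum_of_nonneg fun i _ => sq_nonneg _,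
    ENNReal.ofReal_le_ofReal_iff (Finset.sum_nonneg fun i _ => sq_nonneg _)] at hν
  have hm : Measurable fun x => ENNReal.ofReal (‖A (T x)‖ ^ 2 / (‖T x‖ ^ 2) ^ 2) :=
    (((hAc.comp hTc).norm.pow 2).measurable.div
      ((hTc.norm.pow 2).pow 2).measurable).ennreal_ofReal
  rw [lintegral_stdGaussian_eq b hm]
  simp only [norm_sq_map_sum hb]
  have hdiv : ∀ (y : ℝ) (x : Fin (Module.finrank ℝ E) → ℝ), 0 ≤ y →
      ENNReal.ofReal (y / (∑ i, ‖T (b i)‖ ^ 2 * x i ^ 2) ^ 2) = ENNReal.ofReal y *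
        ENNReal.ofReal ((∑ i, ‖T (b i)‖ ^ 2 * x i ^ 2) ^ 2)⁻¹ := fun y x hy => by
    rw [div_eq_mul_inv, ENNReal.ofReal_mul hy]
  simp only [hdiv _ _ (sq_nonneg _), map_sum, map_smul]
  rw [lintegral_norm_sq_sum_mul (fun i => A (T (b i))) (by fun_prop)
    (fun i x => by
      congr 3
      refine Finset.sum_congr rfl fun l _ => ?_
      by_cases h : l = i <;> simp [flipCoord, h]) Finset.univ]
  have hterm : ∀ i, ENNReal.ofReal (‖A (T (b i))‖ ^ 2) *
      ∫⁻ x, ENNReal.ofReal (x i ^ 2) *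
        ENNReal.ofReal ((∑ i, ‖T (b i)‖ ^ 2 * x i ^ 2) ^ 2)⁻¹ ∂piGaussian _ ≤
      ENNReal.ofReal (‖A (‖T (b i)‖⁻¹ • T (b i))‖ ^ 2) * ENNReal.ofReal (1 / (ν * (ν - 2))) := by
    intro i
    by_cases h0 : T (b i) = 0
    · simp [h0]
    have hpos : 0 < ‖T (b i)‖ := norm_pos_iff.2 h0
    have hsplit : ‖A (T (b i))‖ ^ 2 =
        ‖A (‖T (b i)‖⁻¹ • T (b i))‖ ^ 2 * ‖T (b i)‖ ^ 2 := by
      rw [map_smul, norm_smul, norm_inv, norm_norm]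
      field_simp
    rw [hsplit, ENNReal.ofReal_mul (sq_nonneg _), mul_assoc]
    refine mul_le_mul_right ?_ _
    rw [← lintegral_const_mul _ (by fun_prop)]
    refine le_trans (le_of_eq (lintegral_congr fun x => ?_))
      (lintegral_mul_sq_div_weighted_sq_le (fun _ => sq_nonneg _) he1 hν2 hν i)
    rw [← mul_assoc, ← ENNReal.ofReal_mul (sq_nonneg _),
      ← hdiv _ _ (mul_nonneg (sq_nonneg _) (sq_nonneg _))]
  refine (Finset.sum_le_sum fun i _ => hterm i).trans ?_
  rw [← Finset.sum_mul, ← ENNReal.ofReal_sum_of_nonneg fun i _ => sq_nonneg _,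
    ← ENNReal.ofReal_mul (Finset.sum_nonneg fun i _ => sq_nonneg _)]
  refine ENNReal.ofReal_le_ofReal ?_
  rw [mul_one_div]
  refine div_le_div_of_nonneg_right ?_ (mul_nonneg (by linarith) (by linarith))
  -- Normalisation is possible only for nonzero singular values; the others contribute nothing.
  have horth : Orthonormal ℝ fun i : {i // T (b i) ≠ 0} => ‖T (b i)‖⁻¹ • T (b i) := by
    refine ⟨fun i => ?_, fun i j hij => ?_⟩
    · rw [norm_smul, norm_inv, norm_norm, inv_mul_cancel₀ (norm_ne_zero_iff.2 i.2)]
    · simp [inner_smul_left, inner_smul_right, hb i j (fun h => hij (Subtype.ext h))]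
  refine le_trans (le_of_eq ?_) (hA _ _ horth)
  rw [← Finset.sum_subtype {i | T (b i) ≠ 0} (p := fun i => T (b i) ≠ 0) (by simp)
    (fun i => ‖A (‖T (b i)‖⁻¹ • T (b i))‖ ^ 2)]
  refine (Finset.sum_filter_of_ne (p := fun i => T (b i) ≠ 0) fun i _ hi h0 => hi ?_).symm
  simp [h0]

/-- The coordinate along a singular vector with nonzero image has an atomless law. -/
lemma ae_map_ne_zero (T : E →ₗ[ℝ] F) (hT : T ≠ 0) : ∀ᵐ x ∂stdGaussian E, T x ≠ 0 := by
  obtain ⟨b, hb⟩ := exists_orthonormalBasis_map_orthogonal T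
  obtain ⟨i, hi⟩ : ∃ i, T (b i) ≠ 0 := by
    by_contra! h
    exact hT (b.toBasis.ext fun i => by simpa using h i)
  have hTc : Continuous T := T.continuous_of_finiteDimensional
  rw [stdGaussian_eq_map_pi_orthonormalBasis b, ae_map_iff (Measurable.aemeasurable (by fun_prop))
    (isOpen_ne_fun hTc continuous_const).measurableSet]
  have hx : ∀ᵐ x ∂gaussianReal 0 1, x ≠ (0 : ℝ) := by
    have := nullSingletonClass_gaussianReal (μ := 0) (v := 1) one_ne_zero
    exact ae_iff.2 (by simp)
  filter_upwards [(measurePreserving_eval (fun _ : Fin (Module.finrank ℝ E) =>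
    gaussianReal 0 1) i).quasiMeasurePreserving.ae hx] with x hx h0
  refine hx (pow_eq_zero_iff two_ne_zero |>.1 ?_)
  have h1 := norm_sq_map_sum hb x
  rw [h0, norm_zero, zero_pow two_ne_zero, eq_comm, Finset.sum_eq_zero_iff_of_nonneg
    fun _ _ => by positivity] at h1
  exact (mul_eq_zero.1 (h1 i (Finset.mem_univ _))).resolve_left
    (pow_ne_zero 2 (norm_ne_zero_iff.2 hi))

end StdGaussian

/-! ### The squared Frobenius norm. -/

section FrobSq

variable {ι κ l : Type*} [Fintype ι] [Fintype κ] [Fintype l]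

/-- The squared Frobenius norm of a complex matrix. -/
noncomputable def frobSq (M : Matrix ι κ ℂ) : ℝ := ∑ i, ∑ j, ‖M i j‖ ^ 2

lemma frobSq_nonneg (M : Matrix ι κ ℂ) : 0 ≤ frobSq M :=
  Finset.sum_nonneg fun _ _ => Finset.sum_nonneg fun _ _ => sq_nonneg _

lemma frobSq_eq_trace (M : Matrix ι κ ℂ) : ((frobSq M : ℝ) : ℂ) = (M * Mᴴ).trace := by
  simp [frobSq, trace, mul_apply, Complex.mul_conj, Complex.normSq_eq_norm_sq]

lemma frobSq_conjTranspose (M : Matrix ι κ ℂ) : frobSq Mᴴ = frobSq M := by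
  simp only [frobSq, conjTranspose_apply, norm_star]
  exact Finset.sum_comm

lemma frobSq_neg (M : Matrix ι κ ℂ) : frobSq (-M) = frobSq M := by simp [frobSq]

lemma frobSq_eq_zero {M : Matrix ι κ ℂ} : frobSq M = 0 ↔ M = 0 := by
  refine ⟨fun h => ?_, fun h => by simp [frobSq, h]⟩
  ext i j
  have h1 := (Finset.sum_eq_zero_iff_of_nonneg fun _ _ =>
    Finset.sum_nonneg fun _ _ => sq_nonneg _).1 h i (Finset.mem_univ _)
  have h2 := (Finset.sum_eq_zero_iff_of_nonneg fun _ _ => sq_nonneg _).1 h1 j (Finset.mem_univ _)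
  simpa using h2

lemma frobSq_add_add_frobSq_neg_add (M N : Matrix ι κ ℂ) :
    frobSq (M + N) + frobSq (-M + N) = 2 * (frobSq M + frobSq N) := by
  simp only [frobSq, ← Finset.sum_add_distrib, Finset.mul_sum]
  refine Finset.sum_congr rfl fun i _ => Finset.sum_congr rfl fun j _ => ?_
  have := parallelogram_law_with_norm ℝ (N i j) (M i j)
  simp only [Matrix.add_apply, Matrix.neg_apply]
  rw [add_comm (M i j), neg_add_eq_sub]
  nlinarith [this]

/-- Pythagoras for matrices with orthogonal row spaces. -/
lemma frobSq_add_of_mul_conjTranspose_eq_zero {M N : Matrix ι κ ℂ} (h : M * Nᴴ = 0) :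
    frobSq (M + N) = frobSq M + frobSq N := by
  have h' : N * Mᴴ = 0 := by
    rw [← conjTranspose_conjTranspose (N * Mᴴ), conjTranspose_mul, conjTranspose_conjTranspose, h,
      conjTranspose_zero]
  have : ((frobSq (M + N) : ℝ) : ℂ) = ((frobSq M + frobSq N : ℝ) : ℂ) := by
    push_cast
    rw [frobSq_eq_trace, frobSq_eq_trace, frobSq_eq_trace, conjTranspose_add, Matrix.add_mul,
      Matrix.mul_add, Matrix.mul_add, h, h', add_zero, zero_add, trace_add]
  exact_mod_cast this

lemma frobSq_mul_le (M : Matrix ι κ ℂ) (N : Matrix κ l ℂ) :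
    frobSq (M * N) ≤ frobSq M * frobSq N := by
  rw [← frobSq_conjTranspose N, frobSq, frobSq, frobSq, Finset.sum_mul_sum]
  refine Finset.sum_le_sum fun i _ => Finset.sum_le_sum fun j _ => ?_
  calc ‖(M * N) i j‖ ^ 2 ≤ (∑ k, ‖M i k‖ * ‖Nᴴ j k‖) ^ 2 := by
        refine pow_le_pow_left₀ (norm_nonneg _) ?_ 2
        rw [mul_apply]
        refine (norm_sum_le _ _).trans (le_of_eq ?_)
        simp
    _ ≤ _ := Finset.sum_mul_sq_le_sq_mul_sq _ _ _

lemma abs_re_trace_mul_le (M : Matrix ι κ ℂ) (N : Matrix κ ι ℂ) :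
    |(M * N).trace.re| ≤ √(frobSq M) * √(frobSq N) := by
  rw [← Real.sqrt_mul (frobSq_nonneg _), ← frobSq_conjTranspose N]
  refine Real.abs_le_sqrt ?_
  calc ((M * N).trace.re) ^ 2 ≤ ‖(M * N).trace‖ ^ 2 := by
        rw [← sq_abs]
        exact pow_le_pow_left₀ (abs_nonneg _) (Complex.abs_re_le_norm _) 2
    _ ≤ (∑ p : ι × κ, ‖M p.1 p.2‖ * ‖Nᴴ p.1 p.2‖) ^ 2 := by
        refine pow_le_pow_left₀ (norm_nonneg _) ?_ 2
        rw [trace, Fintype.sum_prod_type]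
        refine (norm_sum_le _ _).trans (Finset.sum_le_sum fun i _ => ?_)
        rw [diag_apply, mul_apply]
        refine (norm_sum_le _ _).trans (le_of_eq ?_)
        simp
    _ ≤ _ := by
        refine (Finset.sum_mul_sq_le_sq_mul_sq _ _ _).trans (le_of_eq ?_)
        rw [Fintype.sum_prod_type, Fintype.sum_prod_type]
        rfl

lemma frobSq_mul_add_frobSq_mul_one_sub [DecidableEq κ] (M : Matrix ι κ ℂ) {P : Matrix κ κ ℂ}
    (hP : Pᴴ = P) (hPP : P * P = P) :
    frobSq (M * P) + frobSq (M * (1 - P)) = frobSq M := by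
  rw [← frobSq_add_of_mul_conjTranspose_eq_zero, ← Matrix.mul_add, add_sub_cancel, Matrix.mul_one]
  rw [conjTranspose_mul, conjTranspose_sub, conjTranspose_one, hP, Matrix.mul_assoc,
    ← Matrix.mul_assoc P, Matrix.mul_sub, hPP, Matrix.mul_one, sub_self, Matrix.zero_mul,
    Matrix.mul_zero]

lemma frobSq_mul_proj_le [DecidableEq κ] (M : Matrix ι κ ℂ) {P : Matrix κ κ ℂ}
    (hP : Pᴴ = P) (hPP : P * P = P) : frobSq (M * P) ≤ frobSq M := by
  have := frobSq_mul_add_frobSq_mul_one_sub M hP hPP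
  linarith [frobSq_nonneg (M * (1 - P))]

lemma frobSq_proj_mul_le [DecidableEq ι] (M : Matrix ι κ ℂ) {P : Matrix ι ι ℂ}
    (hP : Pᴴ = P) (hPP : P * P = P) : frobSq (P * M) ≤ frobSq M := by
  rw [← frobSq_conjTranspose, conjTranspose_mul, hP, ← frobSq_conjTranspose M]
  exact frobSq_mul_proj_le _ hP hPP

lemma frobSq_of_proj {P : Matrix κ κ ℂ} (hP : Pᴴ = P) (hPP : P * P = P) :
    ((frobSq P : ℝ) : ℂ) = P.trace := by
  rw [frobSq_eq_trace, hP, hPP]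

lemma frobSq_mul_isometry [DecidableEq κ] (M : Matrix ι κ ℂ) {U : Matrix l κ ℂ}
    (hU : Uᴴ * U = 1) : frobSq (M * Uᴴ) = frobSq M := by
  have : ((frobSq (M * Uᴴ) : ℝ) : ℂ) = ((frobSq M : ℝ) : ℂ) := by
    rw [frobSq_eq_trace, frobSq_eq_trace, conjTranspose_mul, conjTranspose_conjTranspose,
      Matrix.mul_assoc, ← Matrix.mul_assoc Uᴴ, hU, Matrix.one_mul]
  exact_mod_cast this

lemma frobSq_isometry_mul [DecidableEq ι] (M : Matrix ι κ ℂ) {U : Matrix l ι ℂ}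
    (hU : Uᴴ * U = 1) : frobSq (U * M) = frobSq M := by
  rw [← frobSq_conjTranspose, conjTranspose_mul, frobSq_mul_isometry _ hU, frobSq_conjTranspose]

end FrobSq

/-! ### Projections onto the complement of a row space. -/

section AnnProj

variable {κ κ' m : Type*} [Fintype κ] [DecidableEq κ] [Fintype κ'] [DecidableEq κ']
  [Fintype m] [DecidableEq m]

/-- The orthogonal projection onto the complement of the span of the (conjugated) rows of `Z`,
when these are linearly independent. -/
noncomputable def annProj (Z : Matrix κ m ℂ) : Matrix m m ℂ := 1 - Zᴴ * (Z * Zᴴ)⁻¹ * Z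

lemma annProj_conjTranspose (Z : Matrix κ m ℂ) : (annProj Z)ᴴ = annProj Z := by
  simp [annProj, conjTranspose_sub, conjTranspose_mul, conjTranspose_nonsing_inv, Matrix.mul_assoc]

lemma mul_annProj {Z : Matrix κ m ℂ} (hZ : IsUnit (Z * Zᴴ).det) : Z * annProj Z = 0 := by
  rw [annProj, Matrix.mul_sub, Matrix.mul_one, ← Matrix.mul_assoc, ← Matrix.mul_assoc,
    Matrix.mul_nonsing_inv _ hZ, Matrix.one_mul, sub_self]

lemma annProj_mul_conjTranspose {Z : Matrix κ m ℂ} (hZ : IsUnit (Z * Zᴴ).det) :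
    annProj Z * Zᴴ = 0 := by
  rw [← annProj_conjTranspose, ← conjTranspose_mul, mul_annProj hZ, conjTranspose_zero]

lemma annProj_mul_self {Z : Matrix κ m ℂ} (hZ : IsUnit (Z * Zᴴ).det) :
    annProj Z * annProj Z = annProj Z := by
  conv_lhs => enter [2]; rw [annProj]
  rw [Matrix.mul_sub, Matrix.mul_one, Matrix.mul_assoc Zᴴ, ← Matrix.mul_assoc,
    annProj_mul_conjTranspose hZ, Matrix.zero_mul, sub_zero]

lemma trace_annProj {Z : Matrix κ m ℂ} (hZ : IsUnit (Z * Zᴴ).det) :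
    (annProj Z).trace = (Fintype.card m : ℂ) - Fintype.card κ := by
  rw [annProj, trace_sub, trace_one, Matrix.mul_assoc, trace_mul_comm, Matrix.mul_assoc,
    Matrix.nonsing_inv_mul _ hZ, trace_one]

lemma frobSq_annProj {Z : Matrix κ m ℂ} (hZ : IsUnit (Z * Zᴴ).det) :
    frobSq (annProj Z) = (Fintype.card m : ℝ) - Fintype.card κ := by
  have := frobSq_of_proj (annProj_conjTranspose Z) (annProj_mul_self hZ)
  rw [trace_annProj hZ] at this
  exact_mod_cast this

/-- Keeping fewer rows enlarges the complement; the range of `annProj Z` is still annihilated by the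
selected rows. -/
lemma annProj_submatrix_mul {Z : Matrix κ m ℂ} (hZ : IsUnit (Z * Zᴴ).det) (f : κ' → κ) :
    annProj (Z.submatrix f id) * annProj Z = annProj Z := by
  have h : Z.submatrix f id * annProj Z = 0 := by
    have : (Z * annProj Z).submatrix f id = 0 := by rw [mul_annProj hZ]; rfl
    rw [← this]
    rfl
  conv_lhs => enter [1]; rw [annProj]
  rw [Matrix.sub_mul, Matrix.one_mul, Matrix.mul_assoc _ (Z.submatrix f id), h, Matrix.mul_zero,
    sub_zero]

/-- An invertible recombination of the rows preserves their span. It is applied to sign changes of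
single rows. -/
lemma annProj_involution_mul (Z : Matrix κ m ℂ) {D : Matrix κ κ ℂ} (hD : Dᴴ = D)
    (hDD : D * D = 1) : annProj (D * Z) = annProj Z := by
  have hinv : D⁻¹ = D := inv_eq_left_inv hDD
  rw [annProj, annProj, conjTranspose_mul, hD]
  congr 1
  rw [show D * Z * (Zᴴ * D) = D * ((Z * Zᴴ) * D) by simp only [Matrix.mul_assoc],
    Matrix.mul_inv_rev, Matrix.mul_inv_rev, hinv]
  calc Zᴴ * D * (D * (Z * Zᴴ)⁻¹ * D) * (D * Z)
      = Zᴴ * (D * D) * (Z * Zᴴ)⁻¹ * (D * D) * Z := by simp only [Matrix.mul_assoc]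
    _ = _ := by rw [hDD, Matrix.mul_one, Matrix.mul_one]

end AnnProj

/-! ### Entrywise measurability. -/

section MeasurableEntries

variable {α : Type*} [MeasurableSpace α] {ι κ l : Type*}

/-- A matrix-valued function all of whose entries are measurable. -/
def MeasurableEntries (f : α → Matrix ι κ ℂ) : Prop := ∀ i j, Measurable fun x => f x i j

lemma MeasurableEntries.const (M : Matrix ι κ ℂ) : MeasurableEntries fun _ : α => M :=
  fun _ _ => measurable_const

lemma MeasurableEntries.mul [Fintype κ] {f : α → Matrix ι κ ℂ} {g : α → Matrix κ l ℂ}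
    (hf : MeasurableEntries f) (hg : MeasurableEntries g) :
    MeasurableEntries fun x => f x * g x := by
  intro i j
  simp only [mul_apply]
  exact Finset.measurable_sum _ fun k _ => (hf i k).mul (hg k j)

lemma MeasurableEntries.add {f g : α → Matrix ι κ ℂ}
    (hf : MeasurableEntries f) (hg : MeasurableEntries g) :
    MeasurableEntries fun x => f x + g x :=
  fun i j => (hf i j).add (hg i j)

lemma MeasurableEntries.sub {f g : α → Matrix ι κ ℂ}
    (hf : MeasurableEntries f) (hg : MeasurableEntries g) :
    MeasurableEntries fun x => f x - g x :=
  fun i j => (hf i j).sub (hg i j)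

lemma MeasurableEntries.conjTranspose {f : α → Matrix ι κ ℂ} (hf : MeasurableEntries f) :
    MeasurableEntries fun x => (f x)ᴴ := by
  intro i j
  simp only [conjTranspose_apply]
  exact (Complex.continuous_conj.measurable).comp (hf j i)

lemma MeasurableEntries.det [Fintype ι] [DecidableEq ι] {f : α → Matrix ι ι ℂ}
    (hf : MeasurableEntries f) : Measurable fun x => (f x).det := by
  simp only [det_apply]
  exact Finset.measurable_sum _ fun σ _ =>
    (Finset.measurable_prod _ fun i _ => hf (σ i) i).const_smul (Equiv.Perm.sign σ)

lemma MeasurableEntries.trace [Fintype ι] {f : α → Matrix ι ι ℂ}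
    (hf : MeasurableEntries f) : Measurable fun x => (f x).trace :=
  Finset.measurable_sum _ fun i _ => hf i i

/-- Cramer's rule writes each entry through determinants; the convention 0⁻¹ = 0 covers singular
matrices. -/
lemma MeasurableEntries.inv [Fintype ι] [DecidableEq ι] {f : α → Matrix ι ι ℂ}
    (hf : MeasurableEntries f) : MeasurableEntries fun x => (f x)⁻¹ := by
  intro i j
  simp only [Matrix.inv_def, Matrix.smul_apply, smul_eq_mul, Ring.inverse_eq_inv', adjugate_apply]
  refine hf.det.inv.mul (MeasurableEntries.det fun a b => ?_)
  by_cases h : a = j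
  · subst h
    simp only [updateRow_self]
    exact measurable_const
  · simp only [updateRow_ne h]
    exact hf a b

lemma MeasurableEntries.frobSq [Fintype ι] [Fintype κ] {f : α → Matrix ι κ ℂ}
    (hf : MeasurableEntries f) : Measurable fun x => frobSq (f x) :=
  Finset.measurable_sum _ fun i _ => Finset.measurable_sum _ fun j _ => (hf i j).norm.pow_const 2

lemma MeasurableEntries.annProj [Fintype ι] [DecidableEq ι] [Fintype κ] [DecidableEq κ]
    {f : α → Matrix ι κ ℂ} (hf : MeasurableEntries f) :
    MeasurableEntries fun x => annProj (f x) :=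
  (MeasurableEntries.const 1).sub ((hf.conjTranspose.mul (hf.mul hf.conjTranspose).inv).mul hf)

end MeasurableEntries

/-! ### Real matrices inside the complex ones. -/

section ToComplex

variable {ι κ l : Type*}

/-- A real matrix regarded as a complex one. -/
abbrev toC (M : Matrix ι κ ℝ) : Matrix ι κ ℂ := M.map Complex.ofReal

lemma toC_mul [Fintype κ] (M : Matrix ι κ ℝ) (N : Matrix κ l ℝ) :
    toC (M * N) = toC M * toC N := by
  ext i j
  simp [mul_apply]

lemma toC_sub (M N : Matrix ι κ ℝ) : toC (M - N) = toC M - toC N := by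
  ext i j
  simp

lemma toC_one [DecidableEq ι] : toC (1 : Matrix ι ι ℝ) = 1 := by
  ext i j
  by_cases h : i = j
  · subst h; simp
  · simp [Matrix.one_apply_ne h]

lemma toC_conjTranspose (M : Matrix ι κ ℝ) : (toC M)ᴴ = toC Mᵀ := by
  ext i j
  simp

end ToComplex

/-! ### Complex matrices as Euclidean vectors. -/

section ToVec

variable {ι κ l : Type*} [Fintype ι]

/-- The entries of a complex matrix as a vector of a Euclidean space. -/
noncomputable def toVec {ι κ : Type*} : Matrix ι κ ℂ →ₗ[ℝ] EuclideanSpace ℂ (ι × κ) where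
  toFun M := WithLp.toLp 2 fun p => M p.1 p.2
  map_add' _ _ := rfl
  map_smul' _ _ := rfl

lemma norm_sq_toVec [Fintype κ] (M : Matrix ι κ ℂ) : ‖toVec M‖ ^ 2 = frobSq M := by
  rw [EuclideanSpace.norm_sq_eq, Fintype.sum_prod_type]
  rfl

/-- Multiplication from the left by a complex matrix, as a real linear map between vectors. -/
noncomputable def mulVecLeft (L : Matrix l ι ℂ) :
    EuclideanSpace ℂ (ι × κ) →ₗ[ℝ] EuclideanSpace ℂ (l × κ) where
  toFun w := toVec (L * Matrix.of fun i k => w (i, k))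
  map_add' w w' := by
    rw [← map_add, ← Matrix.mul_add]
    rfl
  map_smul' c w := by
    rw [RingHom.id_apply, ← map_smul, ← Matrix.mul_smul]
    rfl

/-- The family is orthonormal only over the reals. Bessel's inequality for w controls the real parts
and for iw the imaginary parts, hence the factor 2. -/
lemma sum_norm_sq_inner_le {J : Type*} [Fintype J] {m : Type*} [Fintype m]
    {f : m → EuclideanSpace ℂ J} (hf : Orthonormal ℝ f) (w : EuclideanSpace ℂ J) :
    ∑ i, ‖inner ℂ w (f i)‖ ^ 2 ≤ 2 * ‖w‖ ^ 2 := by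
  have h1 := hf.sum_inner_products_le w (s := Finset.univ)
  have h2 := hf.sum_inner_products_le (Complex.I • w) (s := Finset.univ)
  have hn : ‖Complex.I • w‖ = ‖w‖ := by rw [norm_smul, Complex.norm_I, one_mul]
  rw [hn] at h2
  have hre : ∀ u v : EuclideanSpace ℂ J, inner ℝ u v = (inner ℂ u v).re := by
    intro u v
    simp [PiLp.inner_apply, Complex.inner]
  have h3 : ∀ i, ‖inner ℂ w (f i)‖ ^ 2 =
      ‖inner ℝ (f i) w‖ ^ 2 + ‖inner ℝ (f i) (Complex.I • w)‖ ^ 2 := by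
    intro i
    rw [real_inner_comm, real_inner_comm (Complex.I • w), hre, hre, inner_smul_left,
      ← Complex.normSq_eq_norm_sq,
      Complex.normSq_apply, Real.norm_eq_abs, Real.norm_eq_abs, sq_abs, sq_abs]
    simp
    ring
  simp only [h3, Finset.sum_add_distrib]
  linarith

lemma sum_norm_sq_mulVecLeft_le [Fintype l] (L : Matrix l ι ℂ) {m : Type*} [Fintype m]
    {f : m → EuclideanSpace ℂ (ι × Fin 1)} (hf : Orthonormal ℝ f) :
    ∑ i, ‖mulVecLeft L (f i)‖ ^ 2 ≤ 2 * frobSq L := by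
  have h : ∀ i, ‖mulVecLeft L (f i)‖ ^ 2 = ∑ a, ‖inner ℂ
      (WithLp.toLp 2 fun p : ι × Fin 1 => star (L a p.1) : EuclideanSpace ℂ (ι × Fin 1))
        (f i)‖ ^ 2 := by
    intro i
    rw [mulVecLeft, LinearMap.coe_mk, AddHom.coe_mk, norm_sq_toVec, frobSq]
    refine Finset.sum_congr rfl fun a _ => ?_
    rw [Fin.sum_univ_one, PiLp.inner_apply, Fintype.sum_prod_type]
    simp [mul_apply, mul_comm]
  simp only [h]
  rw [Finset.sum_comm, frobSq, Finset.mul_sum]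
  refine Finset.sum_le_sum fun a _ => (sum_norm_sq_inner_le hf _).trans (le_of_eq ?_)
  rw [EuclideanSpace.norm_sq_eq, Fintype.sum_prod_type]
  simp

end ToVec

/-! ### Real Gaussian matrices and independent splittings. -/

section GaussianMatrix

variable {n m : ℕ}

/-- The Euclidean space of real `n × m` matrices. -/
abbrev MatSpace (n m : ℕ) := EuclideanSpace ℝ (Fin n × Fin m)

/-- The complex matrix with the given real entries. -/
noncomputable def entryMat : MatSpace n m →ₗ[ℝ] Matrix (Fin n) (Fin m) ℂ where
  toFun x := Matrix.of fun i j => (x (i, j) : ℂ)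
  map_add' x y := by ext i j; simp
  map_smul' c x := by ext i j; simp

lemma entryMat_apply (x : MatSpace n m) (i : Fin n) (j : Fin m) :
    entryMat x i j = (x (i, j) : ℂ) := rfl

lemma frobSq_entryMat (x : MatSpace n m) : frobSq (entryMat x) = ‖x‖ ^ 2 := by
  rw [EuclideanSpace.norm_sq_eq, Fintype.sum_prod_type]
  simp [frobSq, entryMat_apply]

lemma measurableEntries_entryMat : MeasurableEntries (entryMat : MatSpace n m → _) := by
  intro i j
  simp only [entryMat_apply]
  exact Complex.measurable_ofReal.comp (by fun_prop)

/-- Left multiplication by a real matrix. -/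
noncomputable def leftMul (R : Matrix (Fin n) (Fin n) ℝ) : MatSpace n m →ₗ[ℝ] MatSpace n m where
  toFun x := WithLp.toLp 2 fun p => ∑ a, R p.1 a * x (a, p.2)
  map_add' x y := by
    ext p
    simp [mul_add, Finset.sum_add_distrib]
  map_smul' c x := by
    ext p
    simp [Finset.mul_sum, mul_left_comm]

lemma leftMul_apply (R : Matrix (Fin n) (Fin n) ℝ) (x : MatSpace n m) (p : Fin n × Fin m) :
    leftMul R x p = ∑ a, R p.1 a * x (a, p.2) := rfl

lemma entryMat_leftMul (R : Matrix (Fin n) (Fin n) ℝ) (x : MatSpace n m) :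
    entryMat (leftMul R x) = toC R * entryMat x := by
  ext i j
  simp [entryMat_apply, leftMul_apply, mul_apply]

lemma entryMat_injective : Function.Injective (entryMat : MatSpace n m → _) := by
  intro x y h
  ext p
  have := congrFun (congrFun h p.1) p.2
  simpa [entryMat_apply] using this

lemma leftMul_leftMul (R R' : Matrix (Fin n) (Fin n) ℝ) (x : MatSpace n m) :
    leftMul R (leftMul R' x) = leftMul (R * R') x := by
  apply entryMat_injective
  rw [entryMat_leftMul, entryMat_leftMul, entryMat_leftMul, toC_mul, Matrix.mul_assoc]

lemma leftMul_one (x : MatSpace n m) : leftMul 1 x = x := by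
  apply entryMat_injective
  rw [entryMat_leftMul, toC_one, Matrix.one_mul]

lemma inner_leftMul (R : Matrix (Fin n) (Fin n) ℝ) (x y : MatSpace n m) :
    inner ℝ (leftMul R x) y = inner ℝ x (leftMul Rᵀ y) := by
  simp only [PiLp.inner_apply, leftMul_apply, Fintype.sum_prod_type, RCLike.inner_apply,
    conj_trivial, Finset.mul_sum, Finset.sum_mul, transpose_apply]
  calc _ = ∑ i, ∑ a, ∑ j, y (i, j) * (R i a * x (a, j)) :=
        Finset.sum_congr rfl fun i _ => Finset.sum_comm
    _ = ∑ a, ∑ i, ∑ j, y (i, j) * (R i a * x (a, j)) := Finset.sum_comm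
    _ = ∑ a, ∑ j, ∑ i, y (i, j) * (R i a * x (a, j)) :=
        Finset.sum_congr rfl fun i _ => Finset.sum_comm
    _ = _ := by
        refine Finset.sum_congr rfl fun a _ => Finset.sum_congr rfl fun j _ =>
          Finset.sum_congr rfl fun i _ => ?_
        ring

/-- `R` is an orthogonal projection of `ℝⁿ`. -/
def IsRealProj (R : Matrix (Fin n) (Fin n) ℝ) : Prop := Rᵀ = R ∧ R * R = R

lemma IsRealProj.one_sub {R : Matrix (Fin n) (Fin n) ℝ} (h : IsRealProj R) :
    IsRealProj (1 - R) := by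
  refine ⟨by rw [transpose_sub, transpose_one, h.1], ?_⟩
  rw [Matrix.mul_sub, Matrix.sub_mul, Matrix.sub_mul, Matrix.mul_one, Matrix.mul_one, h.2]
  simp

lemma norm_sq_leftMul {R : Matrix (Fin n) (Fin n) ℝ} (h : IsRealProj R) (x : MatSpace n m) :
    ‖leftMul R x‖ ^ 2 = inner ℝ x (leftMul R x) := by
  rw [← real_inner_self_eq_norm_sq, inner_leftMul, h.1, leftMul_leftMul, h.2]

lemma leftMul_add (R R' : Matrix (Fin n) (Fin n) ℝ) (x : MatSpace n m) :
    leftMul R x + leftMul R' x = leftMul (R + R') x := by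
  ext p
  simp [leftMul_apply, add_mul, Finset.sum_add_distrib]

/-- For Gaussian X the parts (1 - R)X and RX are independent, so the second may be resampled from an
independent copy. This replaces conditioning throughout. -/
lemma lintegral_split {R : Matrix (Fin n) (Fin n) ℝ} (h : IsRealProj R)
    {f : MatSpace n m → ENNReal} (hf : Measurable f) :
    ∫⁻ x, f x ∂stdGaussian (MatSpace n m) =
      ∫⁻ y, ∫⁻ x, f (leftMul (1 - R) y + leftMul R x) ∂stdGaussian (MatSpace n m)
        ∂stdGaussian (MatSpace n m) := by
  refine lintegral_stdGaussian_add (C' := leftMul (1 - R)) (S' := leftMul R)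
    (fun x y => by rw [inner_leftMul, h.one_sub.1]) (fun x y => by rw [inner_leftMul, h.1])
    (fun t => ?_) hf
  rw [norm_sq_leftMul h.one_sub, norm_sq_leftMul h, ← inner_add_right, leftMul_add,
    sub_add_cancel, leftMul_one, real_inner_self_eq_norm_sq]

lemma ae_of_split {R : Matrix (Fin n) (Fin n) ℝ} (h : IsRealProj R)
    {p : MatSpace n m → Prop} (hp : MeasurableSet {x | p x})
    (H : ∀ᵐ y ∂stdGaussian (MatSpace n m), ∀ᵐ x ∂stdGaussian (MatSpace n m),
      p (leftMul (1 - R) y + leftMul R x)) : ∀ᵐ x ∂stdGaussian (MatSpace n m), p x := by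
  have hm : Measurable fun x => Set.indicator {x | p x}ᶜ (1 : MatSpace n m → ENNReal) x :=
    measurable_one.indicator hp.compl
  rw [ae_iff]
  change stdGaussian (MatSpace n m) {x | p x}ᶜ = 0
  rw [← lintegral_indicator_one hp.compl, lintegral_split h hm, lintegral_eq_zero_iff']
  · filter_upwards [H] with y hy
    rw [Pi.zero_apply]
    refine (lintegral_congr_ae ?_).trans lintegral_zero
    filter_upwards [hy] with x hx
    exact Set.indicator_of_notMem (Set.notMem_compl_iff.2 hx) _
  · have hc : Continuous fun z : MatSpace n m × MatSpace n m =>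
        leftMul (1 - R) z.1 + leftMul R z.2 :=
      ((LinearMap.continuous_of_finiteDimensional _).comp continuous_fst).add
        ((LinearMap.continuous_of_finiteDimensional _).comp continuous_snd)
    exact (Measurable.lintegral_prod_right' (hm.comp hc.measurable)).aemeasurable

lemma measurePreserving_reflect {R : Matrix (Fin n) (Fin n) ℝ} (h : IsRealProj R) :
    MeasurePreserving (leftMul (1 - (2 : ℝ) • R)) (stdGaussian (MatSpace n m))
      (stdGaussian (MatSpace n m)) := by
  have ht : (1 - (2 : ℝ) • R)ᵀ = 1 - (2 : ℝ) • R := by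
    rw [transpose_sub, transpose_one, transpose_smul, h.1]
  refine measurePreserving_stdGaussian (C' := leftMul (1 - (2 : ℝ) • R))
    (fun x y => by rw [inner_leftMul, ht]) fun t => ?_
  have hh : (1 - (2 : ℝ) • R) * (1 - (2 : ℝ) • R) = 1 := by
    rw [Matrix.mul_sub, Matrix.mul_one, Matrix.mul_smul, Matrix.sub_mul, Matrix.smul_mul, h.2,
      Matrix.one_mul]
    module
  rw [← sq_eq_sq₀ (norm_nonneg _) (norm_nonneg _), ← real_inner_self_eq_norm_sq, inner_leftMul, ht,
    leftMul_leftMul, hh, leftMul_one, real_inner_self_eq_norm_sq]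

lemma measurePreserving_neg_stdGaussian : MeasurePreserving (fun x => -x)
    (stdGaussian (MatSpace n m)) (stdGaussian (MatSpace n m)) :=
  measurePreserving_stdGaussian (C := -LinearMap.id) (C' := -LinearMap.id)
    (fun x y => by simp) (fun t => by simp)

variable {ι κ : Type*} [Fintype ι] [Fintype κ]

/-- The real linear map `X ↦ A X C` on real matrices. -/
noncomputable def sandwich (A : Matrix ι (Fin n) ℂ) (C : Matrix (Fin m) κ ℂ) :
    MatSpace n m →ₗ[ℝ] EuclideanSpace ℂ (ι × κ) where
  toFun x := toVec (A * entryMat x * C)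
  map_add' x y := by rw [map_add, Matrix.mul_add, Matrix.add_mul, map_add]
  map_smul' c x := by rw [map_smul, Matrix.mul_smul, Matrix.smul_mul, map_smul]; rfl

lemma norm_sq_sandwich (A : Matrix ι (Fin n) ℂ) (C : Matrix (Fin m) κ ℂ) (x : MatSpace n m) :
    ‖sandwich A C x‖ ^ 2 = frobSq (A * entryMat x * C) := norm_sq_toVec _

lemma lintegral_frobSq_sandwich (A : Matrix ι (Fin n) ℂ) (C : Matrix (Fin m) κ ℂ) :
    ∫⁻ x, ENNReal.ofReal (frobSq (A * entryMat x * C)) ∂stdGaussian (MatSpace n m) =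
      ENNReal.ofReal (frobSq A * frobSq C) := by
  simp only [← norm_sq_sandwich]
  rw [lintegral_norm_sq_stdGaussian (EuclideanSpace.basisFun (Fin n × Fin m) ℝ),
    ← ENNReal.ofReal_sum_of_nonneg fun _ _ => sq_nonneg _]
  congr 1
  have h : ∀ p : Fin n × Fin m, ‖sandwich A C (EuclideanSpace.basisFun (Fin n × Fin m) ℝ p)‖ ^ 2 =
      (∑ i, ‖A i p.1‖ ^ 2) * ∑ k, ‖C p.2 k‖ ^ 2 := by
    intro p
    rw [norm_sq_sandwich, frobSq, Finset.sum_mul_sum]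
    refine Finset.sum_congr rfl fun i _ => Finset.sum_congr rfl fun k _ => ?_
    rw [← mul_pow, ← norm_mul]
    congr 2
    have he : ∀ a b, entryMat (EuclideanSpace.basisFun (Fin n × Fin m) ℝ p) a b =
        if p.1 = a then (if p.2 = b then 1 else 0) else 0 := by
      intro a b
      simp only [entryMat_apply, EuclideanSpace.basisFun_apply, PiLp.single_apply, Prod.ext_iff]
      by_cases h1 : a = p.1 <;> by_cases h2 : b = p.2 <;>
        simp [h1, h2, eq_comm (a := p.1), eq_comm (a := p.2)]
    simp only [mul_apply, he]
    simp
  simp only [h]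
  rw [Fintype.sum_prod_type]
  simp only [← Finset.mul_sum, ← Finset.sum_mul]
  rw [frobSq, Finset.sum_comm]
  rfl

end GaussianMatrix

/-! ### Real frames: independence of the rows of W X. -/

section Frame

variable {n m r : ℕ}

/-- The rows of `W` are orthonormal, and the `j`-th one lies in the complexification of the range
of the real orthogonal projection `R j`, these ranges being mutually orthogonal. -/
structure IsRealFrame (W : Matrix (Fin r) (Fin n) ℂ) (R : Fin r → Matrix (Fin n) (Fin n) ℝ) :
    Prop where
  mul_conjTranspose : W * Wᴴ = 1
  proj : ∀ j, IsRealProj (R j)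
  orth : ∀ j l, j ≠ l → R j * R l = 0
  row_mul : ∀ j l a, (W * toC (R j)) l a = if l = j then W l a else 0

/-- The rows of `W` with index in `s`. -/
abbrev rows (W : Matrix (Fin r) (Fin n) ℂ) (s : Finset (Fin r)) : Matrix s (Fin n) ℂ :=
  W.submatrix Subtype.val id

/-- The `j`-th row of `W`, as a matrix. -/
abbrev rowMat (W : Matrix (Fin r) (Fin n) ℂ) (j : Fin r) : Matrix (Fin 1) (Fin n) ℂ :=
  W.submatrix (fun _ => j) id

/-- The projection onto the complement of the rows of `W X` with index in `s`. -/
noncomputable def rowProj (W : Matrix (Fin r) (Fin n) ℂ) (s : Finset (Fin r))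
    (x : MatSpace n m) : Matrix (Fin m) (Fin m) ℂ :=
  annProj (rows W s * entryMat x)

/-- The Gram matrix of the rows of `W X` with index in `s` is invertible. -/
def GramUnit (W : Matrix (Fin r) (Fin n) ℂ) (s : Finset (Fin r)) (x : MatSpace n m) : Prop :=
  IsUnit ((rows W s * entryMat x) * (rows W s * entryMat x)ᴴ).det

lemma measurableEntries_rowProj (W : Matrix (Fin r) (Fin n) ℂ) (s : Finset (Fin r)) :
    MeasurableEntries (rowProj W s : MatSpace n m → _) :=
  ((MeasurableEntries.const _).mul measurableEntries_entryMat).annProj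

lemma rowProj_split {W : Matrix (Fin r) (Fin n) ℂ} {s : Finset (Fin r)}
    {P : Matrix (Fin n) (Fin n) ℝ} (h : rows W s * toC P = 0) (x y : MatSpace n m) :
    rowProj W s (leftMul (1 - P) y + leftMul P x) = rowProj W s y := by
  rw [rowProj, rowProj, map_add, entryMat_leftMul, entryMat_leftMul, Matrix.mul_add,
    ← Matrix.mul_assoc, ← Matrix.mul_assoc, h, toC_sub, toC_one, Matrix.mul_sub, h]
  simp

/-- The rows of `W X` with index in `s` are linearly independent. -/
def RowsIndep (W : Matrix (Fin r) (Fin n) ℂ) (s : Finset (Fin r)) (x : MatSpace n m) : Prop :=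
  ∀ c : Fin r → ℂ, (∀ l ∉ s, c l = 0) → c ᵥ* (W * entryMat x) = 0 → c = 0

lemma RowsIndep.gramUnit {W : Matrix (Fin r) (Fin n) ℂ} {s : Finset (Fin r)} {x : MatSpace n m}
    (h : RowsIndep W s x) : GramUnit W s x := by
  have hinj : Function.Injective (rows W s * entryMat x).vecMul := by
    have h0 : ∀ c : s → ℂ, c ᵥ* (rows W s * entryMat x) = 0 → c = 0 := by
      intro c hc
      have h1 := h (fun l => if hl : l ∈ s then c ⟨l, hl⟩ else 0) (fun l hl => by simp [hl]) (by
        rw [← hc]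
        ext k
        simp only [vecMul, dotProduct]
        rw [← Finset.sum_subset (Finset.subset_univ s) (fun l _ hl => by simp [hl]),
          ← Finset.sum_coe_sort]
        refine Finset.sum_congr rfl fun l _ => ?_
        simp [mul_apply])
      ext l
      simpa using congrFun h1 l
    intro c d hcd
    refine sub_eq_zero.1 (h0 _ ?_)
    rw [Matrix.sub_vecMul]
    exact sub_eq_zero.2 hcd
  exact (Matrix.isUnit_iff_isUnit_det _).1 (PosDef.mul_conjTranspose_self _ hinj).isUnit

lemma rowMat_mul_row {W : Matrix (Fin r) (Fin n) ℂ} (A : Matrix (Fin n) (Fin m) ℂ) (j : Fin r)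
    (i : Fin 1) (k : Fin m) : (rowMat W j * A) i k = (W * A) j k := rfl

/-- Projecting a linear relation off the old rows isolates the new row, whose projection is nonzero,
so its coefficient vanishes. -/
lemma RowsIndep.insert {W : Matrix (Fin r) (Fin n) ℂ} {s : Finset (Fin r)} {x : MatSpace n m}
    (h : RowsIndep W s x) {j : Fin r}
    (hj : frobSq (rowMat W j * entryMat x * rowProj W s x) ≠ 0) :
    RowsIndep W (insert j s) x := by
  intro c hc hcz
  have hN : ∀ l ∈ s, ∀ k, (W * entryMat x * rowProj W s x) l k = 0 := by
    intro l hl k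
    exact congrFun (congrFun (mul_annProj h.gramUnit) ⟨l, hl⟩) k
  have hcj : c j = 0 := by
    by_contra hne
    refine hj (frobSq_eq_zero.2 ?_)
    ext i k
    have h1 : (c ᵥ* (W * entryMat x * rowProj W s x)) k = 0 := by
      rw [← Matrix.vecMul_vecMul, hcz, Matrix.zero_vecMul, Pi.zero_apply]
    rw [vecMul, dotProduct, Finset.sum_eq_single j] at h1
    · rw [Matrix.mul_assoc] at h1 ⊢
      exact (mul_eq_zero.1 h1).resolve_left hne
    · intro l _ hlj
      by_cases hl : l ∈ s
      · rw [hN l hl, mul_zero]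
      · rw [hc l (by simp [hlj, hl]), zero_mul]
    · simp
  refine h c (fun l hl => ?_) hcz
  by_cases hlj : l = j
  · rw [hlj, hcj]
  · exact hc l (by simp [hlj, hl])

variable {W : Matrix (Fin r) (Fin n) ℂ} {R : Fin r → Matrix (Fin n) (Fin n) ℝ}

lemma IsRealFrame.rows_mul (hW : IsRealFrame W R) {s : Finset (Fin r)} {j : Fin r} (hj : j ∉ s) :
    rows W s * toC (R j) = 0 := by
  ext l a
  have := hW.row_mul j l a
  rw [if_neg (fun h : (l : Fin r) = j => hj (h ▸ l.2))] at this
  exact this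

lemma IsRealFrame.rowMat_mul (hW : IsRealFrame W R) (j : Fin r) :
    rowMat W j * toC (R j) = rowMat W j := by
  ext i a
  have := hW.row_mul j j a
  rw [if_pos rfl] at this
  exact this

lemma IsRealFrame.frobSq_rowMat (hW : IsRealFrame W R) (j : Fin r) : frobSq (rowMat W j) = 1 := by
  have h : ((frobSq (rowMat W j) : ℝ) : ℂ) = 1 := by
    rw [frobSq_eq_trace, trace_fin_one]
    have := congrFun (congrFun hW.mul_conjTranspose j) j
    rw [one_apply_eq] at this
    exact this
  exact_mod_cast h

lemma rowMat_split (hW : IsRealFrame W R) (j : Fin r) (x y : MatSpace n m) :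
    rowMat W j * entryMat (leftMul (1 - R j) y + leftMul (R j) x) = rowMat W j * entryMat x := by
  rw [map_add, entryMat_leftMul, entryMat_leftMul, Matrix.mul_add, ← Matrix.mul_assoc,
    ← Matrix.mul_assoc, toC_sub, toC_one, Matrix.mul_sub, hW.rowMat_mul]
  simp

/-- With (1 - R j)X frozen, the projection N is fixed and row j is still random. The map X ↦ w_j X N
is nonzero, because its second moment is the rank m - |s| of N and |s| < r ≤ m. -/
lemma ae_frobSq_row_ne_zero (hW : IsRealFrame W R) (hrm : r ≤ m) {s : Finset (Fin r)} {j : Fin r}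
    (hj : j ∉ s) (h : ∀ᵐ x ∂stdGaussian (MatSpace n m), RowsIndep W s x) :
    ∀ᵐ x ∂stdGaussian (MatSpace n m), frobSq (rowMat W j * entryMat x * rowProj W s x) ≠ 0 := by
  have hm : Measurable fun x : MatSpace n m =>
      frobSq (rowMat W j * entryMat x * rowProj W s x) :=
    (((MeasurableEntries.const _).mul measurableEntries_entryMat).mul
      (measurableEntries_rowProj W s)).frobSq
  refine ae_of_split (hW.proj j) (hm (measurableSet_singleton 0).compl) ?_
  filter_upwards [h] with y hy
  simp only [rowMat_split hW, rowProj_split (hW.rows_mul hj), ← norm_sq_sandwich]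
  have hne : sandwich (m := m) (rowMat W j) (rowProj W s y) ≠ 0 := by
    intro h0
    have := lintegral_frobSq_sandwich (m := m) (rowMat W j) (rowProj W s y)
    simp only [← norm_sq_sandwich, h0] at this
    rw [hW.frobSq_rowMat, rowProj, frobSq_annProj hy.gramUnit] at this
    have hc : s.card < r := by
      have := Finset.card_lt_univ_of_notMem hj
      simpa using this
    simp at this
    omega
  filter_upwards [ae_map_ne_zero _ hne] with x hx
  exact pow_ne_zero 2 (norm_ne_zero_iff.2 hx)

lemma ae_rowsIndep (hW : IsRealFrame W R) (hrm : r ≤ m) (s : Finset (Fin r)) :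
    ∀ᵐ x ∂stdGaussian (MatSpace n m), RowsIndep W s x := by
  induction s using Finset.induction_on with
  | empty => exact .of_forall fun x c hc _ => funext fun l => hc l (by simp)
  | insert j s hj ih =>
    filter_upwards [ih, ae_frobSq_row_ne_zero hW hrm hj ih] with x h h'
    exact h.insert h'

lemma ae_gramUnit (hW : IsRealFrame W R) (hrm : r ≤ m) :
    ∀ᵐ x ∂stdGaussian (MatSpace n m), ∀ s, GramUnit W s x := by
  rw [ae_all_iff]
  intro s
  filter_upwards [ae_rowsIndep hW hrm s] with x hx using hx.gramUnit

lemma frobSq_rowProj {s : Finset (Fin r)} {x : MatSpace n m} (h : GramUnit W s x) :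
    frobSq (rowProj W s x) = m - s.card := by
  rw [rowProj, frobSq_annProj h]
  simp

lemma rowProj_mono {s t : Finset (Fin r)} (hst : t ⊆ s) {x : MatSpace n m}
    (hs : GramUnit W s x) : rowProj W t x * rowProj W s x = rowProj W s x :=
  annProj_submatrix_mul hs (fun l : t => (⟨l.1, hst l.2⟩ : s))

/-- The expectation of the squared Frobenius norm of `B X N`, where `N` is the projection onto the
complement of the rows of `W X` with index in `s`. -/
noncomputable def projMoment (W : Matrix (Fin r) (Fin n) ℂ) (m : ℕ) (s : Finset (Fin r))
    (B : Matrix (Fin n) (Fin n) ℂ) : ENNReal :=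
  ∫⁻ x, ENNReal.ofReal (frobSq (B * entryMat x * rowProj W s x)) ∂stdGaussian (MatSpace n m)

lemma measurable_frobSq_mul_rowProj (W : Matrix (Fin r) (Fin n) ℂ) (s : Finset (Fin r))
    {ι : Type*} [Fintype ι] (B : Matrix ι (Fin n) ℂ) :
    Measurable fun x : MatSpace n m => frobSq (B * entryMat x * rowProj W s x) :=
  (((MeasurableEntries.const _).mul measurableEntries_entryMat).mul
    (measurableEntries_rowProj W s)).frobSq

lemma toC_isRealProj {P : Matrix (Fin n) (Fin n) ℝ} (h : IsRealProj P) :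
    (toC P)ᴴ = toC P ∧ toC P * toC P = toC P :=
  ⟨by rw [toC_conjTranspose, h.1], by rw [← toC_mul, h.2]⟩

/-- The part P X is independent of the projection N, and N has squared norm m - |s| almost surely.
-/
lemma projMoment_of_annihilate (hW : IsRealFrame W R) (hrm : r ≤ m) {s : Finset (Fin r)}
    {P : Matrix (Fin n) (Fin n) ℝ} (hP : IsRealProj P) (h : rows W s * toC P = 0)
    (B : Matrix (Fin n) (Fin n) ℂ) :
    projMoment W m s (B * toC P) = ENNReal.ofReal (frobSq (B * toC P) * (m - s.card)) := by
  rw [projMoment, lintegral_split hP (measurable_frobSq_mul_rowProj W s _).ennreal_ofReal]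
  have h1 : ∀ x y : MatSpace n m,
      B * toC P * entryMat (leftMul (1 - P) y + leftMul P x) = B * toC P * entryMat x := by
    intro x y
    rw [map_add, entryMat_leftMul, entryMat_leftMul, Matrix.mul_add, ← Matrix.mul_assoc,
      ← Matrix.mul_assoc, Matrix.mul_assoc B, Matrix.mul_assoc B, toC_sub, toC_one,
      Matrix.mul_sub, (toC_isRealProj hP).2]
    simp [Matrix.mul_assoc B (toC P) (toC P), (toC_isRealProj hP).2]
  simp only [rowProj_split h, h1, lintegral_frobSq_sandwich]
  calc _ = ∫⁻ _, ENNReal.ofReal (frobSq (B * toC P) * (m - s.card)) ∂stdGaussian (MatSpace n m) := by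
        refine lintegral_congr_ae ?_
        filter_upwards [ae_gramUnit hW hrm] with y hy
        rw [frobSq_rowProj (hy s)]
    _ = _ := by simp

/-- Dropping row j only enlarges the projection and makes it independent of R_j X, at the cost of at
most one dimension. -/
lemma projMoment_erase_le (hW : IsRealFrame W R) (hrm : r ≤ m) (s : Finset (Fin r))
    (j : Fin r) (B : Matrix (Fin n) (Fin n) ℂ) :
    projMoment W m s (B * toC (R j)) ≤
      ENNReal.ofReal (frobSq (B * toC (R j)) * (m - s.card + 1)) := by
  calc _ ≤ projMoment W m (s.erase j) (B * toC (R j)) := by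
        refine lintegral_mono_ae ?_
        filter_upwards [ae_gramUnit hW hrm] with x hx
        refine ENNReal.ofReal_le_ofReal ?_
        rw [← rowProj_mono (Finset.erase_subset j s) (hx s), ← Matrix.mul_assoc]
        exact frobSq_mul_proj_le _ (annProj_conjTranspose _) (annProj_mul_self (hx s))
    _ = _ := projMoment_of_annihilate hW hrm (hW.proj j) (hW.rows_mul (by simp)) B
    _ ≤ _ := by
        refine ENNReal.ofReal_le_ofReal (mul_le_mul_of_nonneg_left ?_ (frobSq_nonneg _))
        have h : (s.card : ℝ) ≤ (s.erase j).card + 1 := by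
          have := Finset.pred_card_le_card_erase (s := s) (a := j)
          exact_mod_cast (by omega : s.card ≤ (s.erase j).card + 1)
        linarith

/-- The reflection 1 - 2 R_j merely changes the sign of row j of W X. -/
lemma rowProj_reflect (hW : IsRealFrame W R) (s : Finset (Fin r)) (j : Fin r)
    (x : MatSpace n m) :
    rowProj W s (leftMul (1 - (2 : ℝ) • R j) x) = rowProj W s x := by
  have h : rows W s * entryMat (leftMul (1 - (2 : ℝ) • R j) x) =
      Matrix.diagonal (fun l : s => if (l : Fin r) = j then (-1 : ℂ) else 1) *
        (rows W s * entryMat x) := by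
    rw [entryMat_leftMul, ← Matrix.mul_assoc, ← Matrix.mul_assoc]
    congr 1
    ext l a
    rw [diagonal_mul, toC_sub, toC_one, Matrix.mul_sub, Matrix.mul_one]
    have h1 : toC ((2 : ℝ) • R j) = (2 : ℂ) • toC (R j) := by
      ext; simp
    have h2 := hW.row_mul j l a
    rw [h1, Matrix.mul_smul, Matrix.sub_apply, Matrix.smul_apply,
      show (rows W s * toC (R j)) l a = (W * toC (R j)) l a from rfl, h2]
    by_cases hl : (l : Fin r) = j
    · simp [hl]; ring
    · simp [hl]
  rw [rowProj, rowProj, h, annProj_involution_mul]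
  · rw [diagonal_conjTranspose]
    congr 1
    ext l
    by_cases hl : (l : Fin r) = j <;> simp [hl]
  · rw [diagonal_mul_diagonal, ← diagonal_one]
    congr 1
    ext l
    by_cases hl : (l : Fin r) = j <;> simp [hl]

/-- The cross term is odd under the reflection 1 - 2 R_j, which preserves both the law of X and the
projection. -/
lemma projMoment_split (hW : IsRealFrame W R) (s : Finset (Fin r)) (j : Fin r)
    (B : Matrix (Fin n) (Fin n) ℂ) :
    projMoment W m s B =
      projMoment W m s (B * toC (R j)) + projMoment W m s (B * toC (1 - R j)) := by
  have hm := measurable_frobSq_mul_rowProj (m := m) W s (B := B)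
  have hm1 := measurable_frobSq_mul_rowProj (m := m) W s (B := B * toC (R j))
  have hm2 := measurable_frobSq_mul_rowProj (m := m) W s (B := B * toC (1 - R j))
  rw [projMoment, projMoment, projMoment, ← lintegral_add_left hm1.ennreal_ofReal]
  refine lintegral_eq_of_add_comp_eq (measurePreserving_reflect (hW.proj j)) hm.ennreal_ofReal
    (hm1.ennreal_ofReal.add hm2.ennreal_ofReal) fun x => ?_
  rw [rowProj_reflect hW, ← ENNReal.ofReal_add (frobSq_nonneg _) (frobSq_nonneg _),
    ← ENNReal.ofReal_add (frobSq_nonneg _) (frobSq_nonneg _),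
    ← ENNReal.ofReal_add (add_nonneg (frobSq_nonneg _) (frobSq_nonneg _))
      (add_nonneg (frobSq_nonneg _) (frobSq_nonneg _)), ← two_mul,
    ← frobSq_add_add_frobSq_neg_add]
  have hR := (toC_isRealProj (hW.proj j)).2
  have e1 : B * entryMat x * rowProj W s x = B * toC (R j) * entryMat x * rowProj W s x +
      B * toC (1 - R j) * entryMat x * rowProj W s x := by
    rw [← Matrix.add_mul, ← Matrix.add_mul, ← Matrix.mul_add, toC_sub, toC_one, add_sub_cancel,
      Matrix.mul_one]
  have e2 : B * entryMat (leftMul (1 - (2 : ℝ) • R j) x) * rowProj W s x =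
      -(B * toC (R j) * entryMat x * rowProj W s x) +
        B * toC (1 - R j) * entryMat x * rowProj W s x := by
    rw [entryMat_leftMul, ← Matrix.mul_assoc, ← Matrix.neg_mul, ← Matrix.neg_mul, ← Matrix.mul_neg,
      ← Matrix.add_mul, ← Matrix.add_mul, ← Matrix.mul_add]
    congr 3
    ext a b
    simp
    ring
  rw [e1, e2]

end Frame

/-! ### Real frames: expected size of the dual vectors. -/

section Frame

variable {n m r : ℕ} {W : Matrix (Fin r) (Fin n) ℂ} {R : Fin r → Matrix (Fin n) (Fin n) ℝ}

lemma IsRealFrame.isRealProj_sum (hW : IsRealFrame W R) (t : Finset (Fin r)) :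
    IsRealProj (∑ l ∈ t, R l) := by
  refine ⟨by rw [transpose_sum]; exact Finset.sum_congr rfl fun l _ => (hW.proj l).1, ?_⟩
  rw [Finset.sum_mul]
  refine Finset.sum_congr rfl fun l hl => ?_
  rw [Finset.mul_sum, Finset.sum_eq_single l (fun k _ hk => hW.orth l k hk.symm)
    (fun h => absurd hl h), (hW.proj l).2]

lemma IsRealFrame.sum_mul (hW : IsRealFrame W R) {t : Finset (Fin r)} {j : Fin r} (hj : j ∉ t) :
    (∑ l ∈ t, R l) * R j = 0 := by
  rw [Finset.sum_mul]
  exact Finset.sum_eq_zero fun l hl => hW.orth l j fun h => hj (h ▸ hl)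

lemma frobSq_split {P : Matrix (Fin n) (Fin n) ℝ} (hP : IsRealProj P)
    (B : Matrix (Fin n) (Fin n) ℂ) :
    frobSq (B * toC P) + frobSq (B * toC (1 - P)) = frobSq B := by
  rw [toC_sub, toC_one]
  exact frobSq_mul_add_frobSq_mul_one_sub B (toC_isRealProj hP).1 (toC_isRealProj hP).2

/-- The blocks B R_l with l in s are peeled off one at a time, each with its extra dimension; what
is left is independent of the projection. -/
lemma projMoment_le (hW : IsRealFrame W R) (hrm : r ≤ m) (s : Finset (Fin r))
    (B : Matrix (Fin n) (Fin n) ℂ) :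
    projMoment W m s B ≤ ENNReal.ofReal (frobSq B * (m - s.card + 1)) := by
  have hs : (s.card : ℝ) ≤ m := by
    have : s.card ≤ r := by simpa using Finset.card_le_univ s
    exact_mod_cast this.trans hrm
  have key : ∀ t : Finset (Fin r), projMoment W m s B ≤
      ENNReal.ofReal ((frobSq B - frobSq (B * toC (1 - ∑ l ∈ t, R l))) * (m - s.card + 1)) +
        projMoment W m s (B * toC (1 - ∑ l ∈ t, R l)) := by
    intro t
    induction t using Finset.induction_on with
    | empty => simp
    | insert j t hj ih =>
      set P := 1 - ∑ l ∈ t, R l with hPdef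
      have hP : IsRealProj P := (hW.isRealProj_sum t).one_sub
      have h1 : P * R j = R j := by
        rw [hPdef, Matrix.sub_mul, hW.sum_mul hj, Matrix.one_mul, sub_zero]
      have h2 : P * (1 - R j) = 1 - ∑ l ∈ insert j t, R l := by
        rw [Matrix.mul_sub, h1, Finset.sum_insert hj, Matrix.mul_one, hPdef]
        abel
      have e1 : B * toC P * toC (R j) = B * toC (R j) := by
        rw [Matrix.mul_assoc, ← toC_mul, h1]
      have e2 : B * toC P * toC (1 - R j) = B * toC (1 - ∑ l ∈ insert j t, R l) := by
        rw [Matrix.mul_assoc, ← toC_mul, h2]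
      have h3 := frobSq_split (hW.proj j) (B * toC P)
      rw [e1, e2] at h3
      have hle : frobSq (B * toC P) ≤ frobSq B :=
        frobSq_mul_proj_le _ (toC_isRealProj hP).1 (toC_isRealProj hP).2
      calc _ ≤ _ := ih
        _ ≤ ENNReal.ofReal ((frobSq B - frobSq (B * toC P)) * (m - s.card + 1)) +
            (ENNReal.ofReal (frobSq (B * toC (R j)) * (m - s.card + 1)) +
              projMoment W m s (B * toC (1 - ∑ l ∈ insert j t, R l))) := by
          rw [projMoment_split hW s j (B * toC P), e1, e2]
          gcongr
          exact projMoment_erase_le hW hrm s j B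
        _ = _ := by
          rw [← add_assoc, ← ENNReal.ofReal_add
            (mul_nonneg (by linarith) (by linarith))
            (mul_nonneg (frobSq_nonneg _) (by linarith)), ← add_mul]
          have h4 : frobSq B - frobSq (B * toC P) + frobSq (B * toC (R j)) =
              frobSq B - frobSq (B * toC (1 - ∑ l ∈ insert j t, R l)) := by linarith
          rw [h4]
  have hann : rows W s * toC (1 - ∑ l ∈ s, R l) = 0 := by
    rw [toC_sub, toC_one, Matrix.mul_sub, Matrix.mul_one, sub_eq_zero]
    have hsum : toC (∑ l ∈ s, R l) = ∑ l ∈ s, toC (R l) := by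
      ext a b
      simp [Matrix.sum_apply]
    ext l a
    rw [hsum, Matrix.mul_sum, Matrix.sum_apply, Finset.sum_eq_single (l : Fin r)]
    · have := hW.row_mul l l a
      rw [if_pos rfl] at this
      exact this.symm
    · intro j _ hj
      have := hW.row_mul j l a
      rw [if_neg hj.symm] at this
      exact this
    · exact fun h => absurd l.2 h
  refine (key s).trans ?_
  have hP : IsRealProj (1 - ∑ l ∈ s, R l) := (hW.isRealProj_sum s).one_sub
  rw [projMoment_of_annihilate hW hrm hP hann]
  have hle : frobSq (B * toC (1 - ∑ l ∈ s, R l)) ≤ frobSq B :=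
    frobSq_mul_proj_le _ (toC_isRealProj hP).1 (toC_isRealProj hP).2
  rw [← ENNReal.ofReal_add (mul_nonneg (by linarith) (by linarith))
    (mul_nonneg (frobSq_nonneg _) (by linarith))]
  refine ENNReal.ofReal_le_ofReal ?_
  nlinarith [frobSq_nonneg (B * toC (1 - ∑ l ∈ s, R l))]

/-- The real linear map `X ↦ (A X C)ᴴ` on real matrices. -/
noncomputable def sandwichStar {ι κ : Type*} (A : Matrix ι (Fin n) ℂ) (C : Matrix (Fin m) κ ℂ) :
    MatSpace n m →ₗ[ℝ] EuclideanSpace ℂ (κ × ι) where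
  toFun x := toVec (A * entryMat x * C)ᴴ
  map_add' x y := by
    rw [map_add, Matrix.mul_add, Matrix.add_mul, conjTranspose_add, map_add]
  map_smul' c x := by
    rw [map_smul, Matrix.mul_smul, Matrix.smul_mul, conjTranspose_smul, star_trivial, map_smul]
    rfl

lemma norm_sq_sandwichStar {ι κ : Type*} [Fintype ι] [Fintype κ] (A : Matrix ι (Fin n) ℂ)
    (C : Matrix (Fin m) κ ℂ) (x : MatSpace n m) :
    ‖sandwichStar A C x‖ ^ 2 = frobSq (A * entryMat x * C) :=
  (norm_sq_toVec _).trans (frobSq_conjTranspose _)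

variable {ν : ℝ} {N : Matrix (Fin m) (Fin m) ℂ} {w : Matrix (Fin 1) (Fin n) ℂ}

lemma frobSq_row_proj_le (hN : Nᴴ = N) (hNN : N * N = N) (hw : frobSq w = 1) (x : MatSpace n m) :
    frobSq (w * entryMat x * N) ≤ ‖x‖ ^ 2 := by
  refine (frobSq_mul_proj_le _ hN hNN).trans ((frobSq_mul_le _ _).trans ?_)
  rw [hw, one_mul, frobSq_entryMat]

/-- With z = w X N, Cauchy-Schwarz bounds the quotient by ‖L X N‖²/‖z‖², to which the first inverse
moment applies. -/
lemma lintegral_cross_even_le (hN : Nᴴ = N) (hNN : N * N = N) (hw : frobSq w = 1)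
    (hν : frobSq N = ν) (hν2 : 2 < ν) (L : Matrix (Fin n) (Fin n) ℂ) :
    ∫⁻ x, ENNReal.ofReal (frobSq (L * entryMat x * (w * entryMat x * N)ᴴ) /
        frobSq (w * entryMat x * N) ^ 2) ∂stdGaussian (MatSpace n m) ≤
      ENNReal.ofReal (ν / (ν - 2) * frobSq L) := by
  have hT : ∀ x : MatSpace n m, ‖sandwich w N x‖ ≤ ‖x‖ := fun x => by
    rw [← sq_le_sq₀ (norm_nonneg _) (norm_nonneg _), norm_sq_sandwich]
    exact frobSq_row_proj_le hN hNN hw x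
  have hE := lintegral_frobSq_sandwich (m := m) w N
  have hν' : ENNReal.ofReal ν ≤
      ∫⁻ x, ENNReal.ofReal (‖sandwich w N x‖ ^ 2) ∂stdGaussian (MatSpace n m) := by
    simp only [norm_sq_sandwich]
    rw [hE, hw, hν, one_mul]
  have h := lintegral_norm_sq_div_le hT hν2 hν' (sandwich L N)
  simp only [norm_sq_sandwich] at h
  rw [lintegral_frobSq_sandwich, ← ENNReal.ofReal_mul (one_div_nonneg.2 (by linarith)), hν] at h
  refine le_trans (lintegral_mono fun x => ENNReal.ofReal_le_ofReal ?_)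
    (h.trans (ENNReal.ofReal_le_ofReal (le_of_eq (by ring))))
  have e : L * entryMat x * (w * entryMat x * N)ᴴ =
      L * entryMat x * N * (w * entryMat x * N)ᴴ := by
    rw [conjTranspose_mul, hN, Matrix.mul_assoc (L * entryMat x) N, ← Matrix.mul_assoc N, hNN]
  rw [e]
  rcases (frobSq_nonneg (w * entryMat x * N)).eq_or_lt with h0 | h0
  · simp [← h0]
  · rw [div_le_div_iff₀ (by positivity) h0]
    have := frobSq_mul_le (L * entryMat x * N) (w * entryMat x * N)ᴴ
    rw [frobSq_conjTranspose] at this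
    nlinarith

/-- The second inverse moment applies to z = w X N; the factor 2 is the one of
`sum_norm_sq_mulVecLeft_le`. -/
lemma lintegral_cross_odd_le (hN : Nᴴ = N) (hNN : N * N = N) (hw : frobSq w = 1)
    (hν : frobSq N = ν) (hν2 : 2 < ν) (L : Matrix (Fin n) (Fin m) ℂ) :
    ∫⁻ x, ENNReal.ofReal (frobSq (L * (w * entryMat x * N)ᴴ) /
        frobSq (w * entryMat x * N) ^ 2) ∂stdGaussian (MatSpace n m) ≤
      ENNReal.ofReal (2 / (ν * (ν - 2)) * frobSq (L * N)) := by
  have hT : ∀ x : MatSpace n m, ‖sandwichStar w N x‖ ≤ ‖x‖ := fun x => by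
    rw [← sq_le_sq₀ (norm_nonneg _) (norm_nonneg _), norm_sq_sandwichStar]
    exact frobSq_row_proj_le hN hNN hw x
  have hν' : ENNReal.ofReal ν ≤
      ∫⁻ x, ENNReal.ofReal (‖sandwichStar w N x‖ ^ 2) ∂stdGaussian (MatSpace n m) := by
    simp only [norm_sq_sandwichStar]
    rw [lintegral_frobSq_sandwich (m := m) w N, hw, hν, one_mul]
  have h := lintegral_norm_sq_comp_div_le hT hν2 hν' (mulVecLeft (L * N))
    (fun κ _ f hf => sum_norm_sq_mulVecLeft_le (L * N) hf)
  refine le_trans (le_of_eq (lintegral_congr fun x => ?_))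
    (h.trans (ENNReal.ofReal_le_ofReal (le_of_eq (by ring))))
  have e : L * (w * entryMat x * N)ᴴ = L * N * (w * entryMat x * N)ᴴ := by
    rw [conjTranspose_mul, hN, Matrix.mul_assoc L N, ← Matrix.mul_assoc N, hNN]
  rw [norm_sq_sandwichStar, e, ← norm_sq_toVec (L * N * _)]
  rfl

/-- Under X ↦ -X the contribution of L is odd and that of L' X is even, so the two decouple. -/
lemma lintegral_cross_le (hN : Nᴴ = N) (hNN : N * N = N) (hw : frobSq w = 1)
    (hν : frobSq N = ν) (hν2 : 2 < ν) (L : Matrix (Fin n) (Fin m) ℂ)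
    (L' : Matrix (Fin n) (Fin n) ℂ) :
    ∫⁻ x, ENNReal.ofReal (frobSq ((L + L' * entryMat x) * (w * entryMat x * N)ᴴ) /
        frobSq (w * entryMat x * N) ^ 2) ∂stdGaussian (MatSpace n m) ≤
      ENNReal.ofReal (2 / (ν * (ν - 2)) * frobSq (L * N)) +
        ENNReal.ofReal (ν / (ν - 2) * frobSq L') := by
  have hX : MeasurableEntries (entryMat : MatSpace n m → _) := measurableEntries_entryMat
  have hz : MeasurableEntries fun x : MatSpace n m => w * entryMat x * N :=
    ((MeasurableEntries.const _).mul hX).mul (MeasurableEntries.const _)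
  have hL' : MeasurableEntries fun x : MatSpace n m => L' * entryMat x :=
    (MeasurableEntries.const _).mul hX
  have hq := hz.frobSq.pow_const 2
  have m1 : Measurable fun x : MatSpace n m => ENNReal.ofReal
      (frobSq (L * (w * entryMat x * N)ᴴ) / frobSq (w * entryMat x * N) ^ 2) :=
    (((MeasurableEntries.const L).mul hz.conjTranspose).frobSq.div hq).ennreal_ofReal
  have m2 : Measurable fun x : MatSpace n m => ENNReal.ofReal
      (frobSq (L' * entryMat x * (w * entryMat x * N)ᴴ) / frobSq (w * entryMat x * N) ^ 2) :=
    ((hL'.mul hz.conjTranspose).frobSq.div hq).ennreal_ofReal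
  have m3 : Measurable fun x : MatSpace n m => ENNReal.ofReal
      (frobSq ((L + L' * entryMat x) * (w * entryMat x * N)ᴴ) /
        frobSq (w * entryMat x * N) ^ 2) :=
    (((((MeasurableEntries.const L).add hL').mul hz.conjTranspose).frobSq).div hq).ennreal_ofReal
  refine le_trans (le_of_eq ?_) (add_le_add (lintegral_cross_odd_le hN hNN hw hν hν2 L)
    (lintegral_cross_even_le hN hNN hw hν hν2 L'))
  rw [← lintegral_add_left m1]
  refine lintegral_eq_of_add_comp_eq measurePreserving_neg_stdGaussian m3 (m1.add m2) fun x => ?_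
  have hd : ∀ y : ℝ, 0 ≤ y → 0 ≤ y / frobSq (w * entryMat x * N) ^ 2 := fun y hy =>
    div_nonneg hy (sq_nonneg _)
  have hn : frobSq (w * entryMat (-x) * N) = frobSq (w * entryMat x * N) := by
    rw [map_neg, Matrix.mul_neg, Matrix.neg_mul, frobSq_neg]
  have e : (L + L' * entryMat (-x)) * (w * entryMat (-x) * N)ᴴ =
      -(L * (w * entryMat x * N)ᴴ) + L' * entryMat x * (w * entryMat x * N)ᴴ := by
    rw [map_neg, Matrix.mul_neg, Matrix.mul_neg, Matrix.neg_mul, conjTranspose_neg, Matrix.add_mul,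
      Matrix.mul_neg, Matrix.mul_neg, Matrix.neg_mul, neg_neg]
  simp only [hn, e, Matrix.add_mul L]
  rw [← ENNReal.ofReal_add (hd _ (frobSq_nonneg _)) (hd _ (frobSq_nonneg _)),
    ← ENNReal.ofReal_add (hd _ (frobSq_nonneg _)) (hd _ (frobSq_nonneg _)),
    ← ENNReal.ofReal_add (add_nonneg (hd _ (frobSq_nonneg _)) (hd _ (frobSq_nonneg _)))
      (add_nonneg (hd _ (frobSq_nonneg _)) (hd _ (frobSq_nonneg _))), ← add_div,
    frobSq_add_add_frobSq_neg_add, ← two_mul, ← add_div, mul_div_assoc]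

/-- The squared norm of `B X m`, where `m` is the vector dual to the `j`-th row of `W X`. -/
noncomputable def dualResidual (W : Matrix (Fin r) (Fin n) ℂ) (j : Fin r)
    (B : Matrix (Fin n) (Fin n) ℂ) (x : MatSpace n m) : ℝ :=
  frobSq (B * entryMat x * (rowMat W j * entryMat x * rowProj W (Finset.univ.erase j) x)ᴴ) /
    frobSq (rowMat W j * entryMat x * rowProj W (Finset.univ.erase j) x) ^ 2

lemma measurable_dualResidual (W : Matrix (Fin r) (Fin n) ℂ) (j : Fin r)
    (B : Matrix (Fin n) (Fin n) ℂ) :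
    Measurable (dualResidual W j B : MatSpace n m → ℝ) := by
  have hX : MeasurableEntries (entryMat : MatSpace n m → _) := measurableEntries_entryMat
  have hz := ((MeasurableEntries.const (rowMat W j)).mul hX).mul
    (measurableEntries_rowProj W (Finset.univ.erase j))
  exact (((MeasurableEntries.const B).mul hX).mul hz.conjTranspose).frobSq.div
    (hz.frobSq.pow_const 2)

/-- Only R_j X is resampled. The projection off the other r - 1 rows then stays fixed, with rank ν =
p + 1; the frozen part B (1 - R_j) Y brings the factor p + 2 through `projMoment_le`. -/
lemma lintegral_dualResidual_le (hW : IsRealFrame W R) {p : ℕ} (hp : 2 ≤ p) (hm : m = r + p)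
    (j : Fin r) (B : Matrix (Fin n) (Fin n) ℂ) :
    ∫⁻ x, ENNReal.ofReal (dualResidual W j B x) ∂stdGaussian (MatSpace n m) ≤
      ENNReal.ofReal (2 * (p + 2) / ((p + 1) * (p - 1)) * frobSq (B * toC (1 - R j)) +
        (p + 1) / (p - 1) * frobSq (B * toC (R j))) := by
  have hrm : r ≤ m := by omega
  set s := Finset.univ.erase j with hs
  have hcard : (s.card : ℝ) = r - 1 := by
    have h := Finset.card_erase_add_one (Finset.mem_univ j)
    rw [Finset.card_univ, Fintype.card_fin] at h
    rw [eq_sub_iff_add_eq]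
    exact_mod_cast h
  have hν : (m : ℝ) - s.card = p + 1 := by
    rw [hcard, hm]
    push_cast
    ring
  have hp' : (2 : ℝ) ≤ p := by exact_mod_cast hp
  have hRj := hW.proj j
  rw [lintegral_split hRj (measurable_dualResidual W j B).ennreal_ofReal]
  have hin : ∀ᵐ y ∂stdGaussian (MatSpace n m),
      ∫⁻ x, ENNReal.ofReal (dualResidual W j B (leftMul (1 - R j) y + leftMul (R j) x))
        ∂stdGaussian (MatSpace n m) ≤
      ENNReal.ofReal (2 / ((p + 1) * (p - 1))) *
        ENNReal.ofReal (frobSq (B * toC (1 - R j) * entryMat y * rowProj W s y)) +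
        ENNReal.ofReal ((p + 1) / (p - 1) * frobSq (B * toC (R j))) := by
    filter_upwards [ae_gramUnit hW hrm] with y hy
    have h := lintegral_cross_le (annProj_conjTranspose _) (annProj_mul_self (hy s))
      (hW.frobSq_rowMat j) ((frobSq_rowProj (hy s)).trans hν) (by linarith)
      (B * toC (1 - R j) * entryMat y) (B * toC (R j))
    rw [show (p : ℝ) + 1 - 2 = p - 1 by ring, ENNReal.ofReal_mul (by
      apply div_nonneg zero_le_two; nlinarith)] at h
    refine le_trans (le_of_eq (lintegral_congr fun x => ?_)) h
    rw [dualResidual, ← hs, rowMat_split hW, rowProj_split (hW.rows_mul (by simp [hs])), map_add,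
      entryMat_leftMul, entryMat_leftMul, Matrix.mul_add, ← Matrix.mul_assoc, ← Matrix.mul_assoc]
    rfl
  refine (lintegral_mono_ae hin).trans ?_
  rw [lintegral_add_right _ measurable_const, lintegral_const, measure_univ, mul_one,
    lintegral_const_mul _ (measurable_frobSq_mul_rowProj W s _).ennreal_ofReal,
    ENNReal.ofReal_add (by
      refine mul_nonneg (div_nonneg (by linarith) ?_) (frobSq_nonneg _)
      nlinarith) (mul_nonneg (div_nonneg (by linarith) (by linarith)) (frobSq_nonneg _))]
  refine add_le_add_left ?_ _
  refine (mul_le_mul_right (projMoment_le hW hrm s _) _).trans ?_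
  rw [← ENNReal.ofReal_mul (by apply div_nonneg zero_le_two; nlinarith), hν]
  refine ENNReal.ofReal_le_ofReal (le_of_eq ?_)
  ring

end Frame

/-! ### The error of the randomised range finder. -/

section Residual

variable {n m r : ℕ} {W : Matrix (Fin r) (Fin n) ℂ} {R : Fin r → Matrix (Fin n) (Fin n) ℝ}

lemma IsRealFrame.sum_frobSq_le (hW : IsRealFrame W R) (B : Matrix (Fin n) (Fin n) ℂ) :
    ∑ j, frobSq (B * toC (R j)) ≤ frobSq B := by
  have key : ∀ t : Finset (Fin r),
      ∑ j ∈ t, frobSq (B * toC (R j)) = frobSq (B * toC (∑ j ∈ t, R j)) := by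
    intro t
    induction t using Finset.induction_on with
    | empty => simp [frobSq]
    | insert j t hj ih =>
      have h0 : R j * ∑ l ∈ t, R l = 0 := by
        rw [← transpose_transpose (R j * _), transpose_mul, (hW.isRealProj_sum t).1,
          (hW.proj j).1, hW.sum_mul hj, transpose_zero]
      have hadd : toC (R j + ∑ l ∈ t, R l) = toC (R j) + toC (∑ l ∈ t, R l) := by
        ext a b
        simp
      rw [Finset.sum_insert hj, ih, Finset.sum_insert hj, hadd, Matrix.mul_add,
        frobSq_add_of_mul_conjTranspose_eq_zero]
      rw [conjTranspose_mul, (toC_isRealProj (hW.isRealProj_sum t)).1, Matrix.mul_assoc,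
        ← Matrix.mul_assoc (toC (R j)), ← toC_mul, h0]
      simp
  rw [key]
  have h := toC_isRealProj (hW.isRealProj_sum Finset.univ)
  exact frobSq_mul_proj_le B h.1 h.2

lemma dualResidual_nonneg (W : Matrix (Fin r) (Fin n) ℂ) (j : Fin r)
    (B : Matrix (Fin n) (Fin n) ℂ) (x : MatSpace n m) : 0 ≤ dualResidual W j B x :=
  div_nonneg (frobSq_nonneg _) (sq_nonneg _)

/-- The constant 8/3 is the value at p = 2, the largest for p ≥ 2, of 2(p + 2)/(p + 1). The
coefficient of b has the sign of p² - 3 > 0, so b may be replaced by β. -/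
lemma residual_constant_le {r p : ℕ} (hr : 1 ≤ r) (hp : 2 ≤ p) {b β : ℝ} (hb : b ≤ β) (hβ : 0 ≤ β) :
    β + (2 * (p + 2) / ((p + 1) * (p - 1)) * (r * β - b) + (p + 1) / (p - 1) * b) ≤
      8 / 3 * (1 + r / ((p : ℝ) - 1)) * β := by
  have hp' : (2 : ℝ) ≤ p := by exact_mod_cast hp
  have hr' : (1 : ℝ) ≤ r := by exact_mod_cast hr
  have h1 : (0 : ℝ) < p - 1 := by linarith
  have h2 : (0 : ℝ) < p + 1 := by linarith
  have e1 : β + (2 * (p + 2) / ((p + 1) * (p - 1)) * (r * β - b) + (p + 1) / (p - 1) * b) =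
      (((p + 1) * (p - 1) + 2 * (p + 2) * r) * β + (p ^ 2 - 3) * b) / ((p + 1) * (p - 1)) := by
    field_simp
    ring
  have e2 : 8 / 3 * (1 + r / ((p : ℝ) - 1)) * β =
      (8 / 3 * (p + 1) * (p - 1 + r) * β) / ((p + 1) * (p - 1)) := by
    field_simp
  rw [e1, e2]
  refine div_le_div_of_nonneg_right ?_ (by positivity)
  have h3 : ((p : ℝ) ^ 2 - 3) * b ≤ (p ^ 2 - 3) * β := by
    refine mul_le_mul_of_nonneg_left hb ?_
    nlinarith
  have h4 : (p + 1) * (p - 1) + 2 * (p + 2) * r + (p ^ 2 - 3) ≤ 8 / 3 * (p + 1) * ((p : ℝ) - 1 + r) := by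
    nlinarith [mul_nonneg (sub_nonneg.2 hr') (sub_nonneg.2 hp')]
  nlinarith [mul_le_mul_of_nonneg_right h4 hβ]

lemma lintegral_residual_le (hW : IsRealFrame W R) {p : ℕ} (hp : 2 ≤ p) (hm : m = r + p)
    (B : Matrix (Fin n) (Fin n) ℂ) :
    ∫⁻ x, ENNReal.ofReal (frobSq B + ∑ j, dualResidual W j B x) ∂stdGaussian (MatSpace n m) ≤
      ENNReal.ofReal (8 / 3 * (1 + r / ((p : ℝ) - 1)) * frobSq B) := by
  have hp' : (2 : ℝ) ≤ p := by exact_mod_cast hp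
  have hβ := frobSq_nonneg B
  have h1 : (0 : ℝ) < p - 1 := by linarith
  have hsplit : ∀ x : MatSpace n m, ENNReal.ofReal (frobSq B + ∑ j, dualResidual W j B x) =
      ENNReal.ofReal (frobSq B) + ∑ j, ENNReal.ofReal (dualResidual W j B x) := fun x => by
    rw [ENNReal.ofReal_add hβ (Finset.sum_nonneg fun j _ => dualResidual_nonneg _ _ _ _),
      ENNReal.ofReal_sum_of_nonneg fun j _ => dualResidual_nonneg _ _ _ _]
  simp only [hsplit]
  rw [lintegral_add_left measurable_const, lintegral_const, measure_univ, mul_one,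
    lintegral_finsetSum _ fun j _ => (measurable_dualResidual W j B).ennreal_ofReal]
  have hnn : ∀ j, 0 ≤ 2 * (p + 2) / ((p + 1) * (p - 1)) * frobSq (B * toC (1 - R j)) +
        (p + 1) / ((p : ℝ) - 1) * frobSq (B * toC (R j)) := fun j => by
    have := frobSq_nonneg (B * toC (1 - R j))
    have := frobSq_nonneg (B * toC (R j))
    positivity
  refine (add_le_add_right (Finset.sum_le_sum fun j _ => lintegral_dualResidual_le hW hp hm j B)
    _).trans ?_
  rw [← ENNReal.ofReal_sum_of_nonneg fun j _ => hnn j, ← ENNReal.ofReal_add hβ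
    (Finset.sum_nonneg fun j _ => hnn j)]
  refine ENNReal.ofReal_le_ofReal ?_
  rcases Nat.eq_zero_or_pos r with rfl | hr
  · simp
    linarith
  have hsub : ∀ j, frobSq (B * toC (1 - R j)) = frobSq B - frobSq (B * toC (R j)) := fun j => by
    linarith [frobSq_split (hW.proj j) B]
  refine le_trans (le_of_eq ?_) (residual_constant_le hr hp (hW.sum_frobSq_le B) hβ)
  simp only [hsub]
  rw [Finset.sum_add_distrib, ← Finset.mul_sum, ← Finset.mul_sum, Finset.sum_sub_distrib]
  simp

lemma IsRealFrame.ae_row_ne_zero (hW : IsRealFrame W R) (hrm : r ≤ m) :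
    ∀ᵐ x ∂stdGaussian (MatSpace n m), ∀ j,
      frobSq (rowMat W j * entryMat x * rowProj W (Finset.univ.erase j) x) ≠ 0 := by
  rw [ae_all_iff]
  exact fun j => ae_frobSq_row_ne_zero hW hrm (by simp) (ae_rowsIndep hW hrm _)

/-- The columns of this matrix are dual to the rows of `W X`. -/
noncomputable def dualMat (W : Matrix (Fin r) (Fin n) ℂ) (x : MatSpace n m) :
    Matrix (Fin m) (Fin r) ℂ := of fun k j =>
  ((frobSq (rowMat W j * entryMat x * rowProj W (Finset.univ.erase j) x))⁻¹ : ℝ) *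
    (rowMat W j * entryMat x * rowProj W (Finset.univ.erase j) x)ᴴ k 0

lemma mul_dualMat_apply {ι : Type*} (A : Matrix ι (Fin m) ℂ) (x : MatSpace n m) (i : ι)
    (j : Fin r) : (A * dualMat W x) i j =
      ((frobSq (rowMat W j * entryMat x * rowProj W (Finset.univ.erase j) x))⁻¹ : ℝ) *
        (A * (rowMat W j * entryMat x * rowProj W (Finset.univ.erase j) x)ᴴ) i 0 := by
  rw [mul_apply, mul_apply, Finset.mul_sum]
  refine Finset.sum_congr rfl fun k _ => ?_
  rw [dualMat, of_apply]
  ring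

/-- The projected row z_j is orthogonal to all other rows, and its product with row j itself is
‖z_j‖². -/
lemma mul_dualMat {x : MatSpace n m} (hg : ∀ s, GramUnit W s x) (hq : ∀ j,
      frobSq (rowMat W j * entryMat x * rowProj W (Finset.univ.erase j) x) ≠ 0) :
    W * entryMat x * dualMat W x = 1 := by
  ext l j
  rw [mul_dualMat_apply]
  have hN := annProj_conjTranspose (rows W (Finset.univ.erase j) * entryMat x)
  by_cases h : l = j
  · subst h
    have h1 : ((frobSq (rowMat W l * entryMat x * rowProj W (Finset.univ.erase l) x) : ℝ) : ℂ) =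
        (W * entryMat x * (rowMat W l * entryMat x *
          rowProj W (Finset.univ.erase l) x)ᴴ) l 0 := by
      rw [frobSq_eq_trace, trace_fin_one]
      have e : rowMat W l * entryMat x * rowProj W (Finset.univ.erase l) x *
          (rowMat W l * entryMat x * rowProj W (Finset.univ.erase l) x)ᴴ =
          rowMat W l * (entryMat x *
          (rowMat W l * entryMat x * rowProj W (Finset.univ.erase l) x)ᴴ) := by
        rw [conjTranspose_mul, rowProj, hN, Matrix.mul_assoc _ (annProj _), ← Matrix.mul_assoc
          (annProj _) (annProj _), annProj_mul_self (hg _), Matrix.mul_assoc]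
      rw [e, rowMat_mul_row, ← Matrix.mul_assoc]
    rw [← h1, ← Complex.ofReal_mul, inv_mul_cancel₀ (hq l), Matrix.one_apply_eq,
      Complex.ofReal_one]
  · have h1 : (W * entryMat x * (rowMat W j * entryMat x *
        rowProj W (Finset.univ.erase j) x)ᴴ) l 0 = 0 := by
      have e : rows W (Finset.univ.erase j) * entryMat x * (rowMat W j * entryMat x *
          rowProj W (Finset.univ.erase j) x)ᴴ = 0 := by
        rw [conjTranspose_mul, rowProj, hN, ← Matrix.mul_assoc, mul_annProj (hg _),
          Matrix.zero_mul]
      exact congrFun (congrFun e ⟨l, by simp [h]⟩) 0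
    rw [h1, mul_zero, Matrix.one_apply_ne h]

lemma frobSq_mul_dualMat (B : Matrix (Fin n) (Fin n) ℂ) (x : MatSpace n m) :
    frobSq (B * entryMat x * dualMat W x) = ∑ j, dualResidual W j B x := by
  rw [frobSq, Finset.sum_comm]
  refine Finset.sum_congr rfl fun j _ => ?_
  simp only [mul_dualMat_apply]
  have e : ∀ M : Matrix (Fin n) (Fin 1) ℂ, frobSq M = ∑ i, ‖M i 0‖ ^ 2 := fun M => by
    simp [frobSq]
  rw [dualResidual, e (B * entryMat x * _), Finset.sum_div]
  refine Finset.sum_congr rfl fun i _ => ?_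
  rw [norm_mul, mul_pow, Complex.norm_real, Real.norm_eq_abs, sq_abs, inv_pow,
    inv_mul_eq_div]

/-- Let M be the dual matrix. Since 1 - P kills G X M W, it acts on G as on G - G X M W, which
equals B - B X M W because W X M = 1. The two pieces have orthogonal row spaces because B W* = 0. -/
lemma frobSq_one_sub_mul_le (hWW : W * Wᴴ = 1) {x : MatSpace n m} (hg : ∀ s, GramUnit W s x)
    (hq : ∀ j, frobSq (rowMat W j * entryMat x * rowProj W (Finset.univ.erase j) x) ≠ 0)
    {G P : Matrix (Fin n) (Fin n) ℂ} (hP : Pᴴ = P) (hPP : P * P = P)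
    (hPG : P * (G * entryMat x) = G * entryMat x) :
    frobSq ((1 - P) * G) ≤ frobSq (G * (1 - Wᴴ * W)) +
      ∑ j, dualResidual W j (G * (1 - Wᴴ * W)) x := by
  set B := G * (1 - Wᴴ * W) with hB
  have hBW : B * Wᴴ = 0 := by
    rw [hB, Matrix.mul_assoc, Matrix.sub_mul, Matrix.mul_assoc, hWW]
    simp
  have h0 : (1 - P) * (G * entryMat x) = 0 := by
    rw [Matrix.sub_mul, hPG, Matrix.one_mul, sub_self]
  have hG : G = B + G * Wᴴ * W := by
    rw [hB, Matrix.mul_sub, Matrix.mul_one, Matrix.mul_assoc]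
    abel
  have h1 : G * entryMat x * dualMat W x * W = B * entryMat x * dualMat W x * W + G * Wᴴ * W := by
    conv_lhs => rw [hG]
    rw [Matrix.add_mul, Matrix.add_mul, Matrix.add_mul, Matrix.mul_assoc (G * Wᴴ),
      Matrix.mul_assoc (G * Wᴴ), mul_dualMat hg hq, Matrix.mul_one]
  have h2 : (1 - P) * G = (1 - P) * (B + -(B * entryMat x * dualMat W x * W)) := by
    have h3 : (1 - P) * (G * entryMat x * dualMat W x * W) = 0 := by
      rw [← Matrix.mul_assoc, ← Matrix.mul_assoc, h0, Matrix.zero_mul, Matrix.zero_mul]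
    have h4 : B + -(B * entryMat x * dualMat W x * W) = G - G * entryMat x * dualMat W x * W := by
      rw [h1, sub_add_eq_sub_sub_swap, sub_eq_of_eq_add hG, sub_eq_add_neg]
    rw [h4, Matrix.mul_sub, h3, sub_zero]
  rw [h2]
  refine (frobSq_proj_mul_le _ (by simp [hP]) (by
    rw [Matrix.sub_mul, Matrix.mul_sub, Matrix.mul_sub, hPP]; simp)).trans (le_of_eq ?_)
  rw [frobSq_add_of_mul_conjTranspose_eq_zero, frobSq_neg, ← frobSq_mul_dualMat]
  · congr 1
    have := frobSq_mul_isometry (B * entryMat x * dualMat W x) (U := Wᴴ) (by simpa using hWW)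
    rwa [conjTranspose_conjTranspose] at this
  · rw [conjTranspose_neg, conjTranspose_mul, Matrix.mul_neg, ← Matrix.mul_assoc, hBW]
    simp

end Residual

/-! ### Takagi factorisation. -/

section Takagi

variable {E : Type*} [NormedAddCommGroup E] [InnerProductSpace ℂ E] [FiniteDimensional ℂ E]

/-- A real-linear map that is symmetric for the bilinear form `(x, y) ↦ ⟪x, J y⟫` has an
orthonormal family of eigenvectors of any size up to the dimension. -/
lemma exists_orthonormal_eigenvectors (J : E →ₗ[ℝ] E)
    (hJ : ∀ x y, inner ℂ x (J y) = inner ℂ y (J x)) {k : ℕ} (hk : k ≤ Module.finrank ℂ E) :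
    ∃ (v : Fin k → E) (t : Fin k → ℝ), Orthonormal ℂ v ∧ ∀ i, J (v i) = t i • v i := by
  induction k with
  | zero => exact ⟨Fin.elim0, Fin.elim0, ⟨fun i => i.elim0, fun i => i.elim0⟩, fun i => i.elim0⟩
  | succ k ih =>
    obtain ⟨v, t, hv, hvt⟩ := ih (by omega)
    let : InnerProductSpace ℝ E := InnerProductSpace.rclikeToReal ℂ E
    have : FiniteDimensional ℝ E := FiniteDimensional.complexToReal E
    have hre : ∀ x y : E, inner ℝ x y = (inner ℂ x y).re := fun x y => rfl
    set F : Submodule ℂ E := (Submodule.span ℂ (Set.range v))ᗮ with hF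
    have hmem : ∀ x, x ∈ F ↔ ∀ i, inner ℂ (v i) x = 0 := fun x => by
      rw [hF, Submodule.mem_orthogonal]
      refine ⟨fun h i => h _ (Submodule.subset_span ⟨i, rfl⟩), fun h u hu => ?_⟩
      induction hu using Submodule.span_induction with
      | mem u hu => obtain ⟨i, rfl⟩ := hu; exact h i
      | zero => exact inner_zero_left _
      | add u w _ _ h1 h2 => rw [inner_add_left, h1, h2, add_zero]
      | smul c u _ h1 => rw [inner_smul_left, h1, mul_zero]
    have hFne : Nontrivial F := by
      rw [Submodule.nontrivial_iff_ne_bot]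
      intro hbot
      rw [hF, Submodule.orthogonal_eq_bot_iff] at hbot
      have h1 := finrank_span_eq_card hv.linearIndependent
      rw [hbot, finrank_top, Fintype.card_fin] at h1
      omega
    -- The symmetry of the bilinear form keeps the complex orthogonal complement of the earlier
    -- eigenvectors invariant.
    have hinv : ∀ x ∈ F.restrictScalars ℝ, J x ∈ F.restrictScalars ℝ := by
      intro x hx
      have hx' := (hmem x).1 hx
      refine (hmem _).2 fun i => ?_
      rw [hJ, hvt, ← Complex.coe_smul, inner_smul_right, ← inner_conj_symm, hx' i]
      simp
    have hsymm : (J.restrict hinv).IsSymmetric := by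
      intro x y
      rw [Submodule.coe_inner, Submodule.coe_inner, LinearMap.restrict_apply,
        LinearMap.restrict_apply, real_inner_comm, hre, hre, hJ]
    have : Nontrivial (F.restrictScalars ℝ) := hFne
    -- For the real inner product Re⟪x, y⟫ the restriction is an ordinary symmetric operator.
    obtain ⟨θ, hθ⟩ : ∃ θ : ℝ, Module.End.HasEigenvalue (J.restrict hinv) θ :=
      ⟨_, hsymm.hasEigenvalue_iSup_of_finiteDimensional⟩
    obtain ⟨x, hx⟩ := hθ.exists_hasEigenvector
    have hxne : (x : E) ≠ 0 := fun h => hx.2 (Subtype.ext h)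
    have hJx : J x = θ • (x : E) := congrArg Subtype.val hx.apply_eq_smul
    refine ⟨vecCons ((‖(x : E)‖⁻¹ : ℝ) • (x : E)) v, vecCons θ t, ?_, ?_⟩
    · rw [orthonormal_vecCons_iff]
      refine ⟨?_, fun i => ?_, hv⟩
      · rw [norm_smul, norm_inv, norm_norm, inv_mul_cancel₀ (norm_ne_zero_iff.2 hxne)]
      · rw [← Complex.coe_smul, inner_smul_left, ← inner_conj_symm, (hmem x).1 x.2 i]
        simp
    · intro i
      refine Fin.cases ?_ (fun i => ?_) i
      · simp only [cons_val_zero]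
        rw [map_smul, hJx, smul_comm]
      · simp only [cons_val_succ]
        exact hvt i

end Takagi

/-! ### Real frames from orthonormal complex rows. -/

section LineProj

variable {n : ℕ}

/-- The orthogonal projection onto the line spanned by a real vector. -/
noncomputable def lineProj (a : Fin n → ℝ) : Matrix (Fin n) (Fin n) ℝ :=
  (a ⬝ᵥ a)⁻¹ • vecMulVec a a

lemma vecMul_lineProj (u a : Fin n → ℝ) : u ᵥ* lineProj a = ((a ⬝ᵥ a)⁻¹ * (u ⬝ᵥ a)) • a := by
  rw [lineProj, vecMul_smul, vecMul_vecMulVec, smul_smul]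

/-- The zero vector is included thanks to 0⁻¹ = 0; it occurs when a row of W is real or purely
imaginary. -/
lemma vecMul_lineProj_self (a : Fin n → ℝ) : a ᵥ* lineProj a = a := by
  rw [vecMul_lineProj]
  by_cases h : a = 0
  · simp [h]
  · rw [inv_mul_cancel₀ (fun h' => h (dotProduct_self_eq_zero.1 h')), one_smul]

lemma vecMul_lineProj_of_orthogonal {u a : Fin n → ℝ} (h : u ⬝ᵥ a = 0) : u ᵥ* lineProj a = 0 := by
  rw [vecMul_lineProj, h, mul_zero, zero_smul]

lemma lineProj_transpose (a : Fin n → ℝ) : (lineProj a)ᵀ = lineProj a := by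
  rw [lineProj, transpose_smul, transpose_vecMulVec]

lemma lineProj_mul (a : Fin n → ℝ) (M : Matrix (Fin n) (Fin n) ℝ) :
    lineProj a * M = (a ⬝ᵥ a)⁻¹ • vecMulVec a (a ᵥ* M) := by
  rw [lineProj, Matrix.smul_mul, vecMulVec_mul]

lemma lineProj_mul_self (a : Fin n → ℝ) : lineProj a * lineProj a = lineProj a := by
  rw [lineProj_mul, vecMul_lineProj_self, ← lineProj]

lemma lineProj_mul_of_orthogonal {a b : Fin n → ℝ} (h : a ⬝ᵥ b = 0) :
    lineProj a * lineProj b = 0 := by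
  rw [lineProj_mul, vecMul_lineProj_of_orthogonal h, vecMulVec_zero, smul_zero]

end LineProj

section RealFrame

variable {n r : ℕ}

/-- The products W W* and W Wᵀ together determine all inner products of real and imaginary parts:
these vanish between different rows, and within a row Re ⊥ Im because t is real. -/
lemma isRealFrame_of_isReal {W : Matrix (Fin r) (Fin n) ℂ} (h1 : W * Wᴴ = 1) {t : Fin r → ℝ}
    (h2 : ∀ l j, (W * Wᵀ) l j = if l = j then (t j : ℂ) else 0) :
    IsRealFrame W (fun j => lineProj (fun a => (W j a).re) + lineProj fun a => (W j a).im) := by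
  set u : Fin r → Fin n → ℝ := fun j a => (W j a).re
  set v : Fin r → Fin n → ℝ := fun j a => (W j a).im
  have hT : ∀ l j, (W * Wᵀ) l j = ((u l ⬝ᵥ u j - v l ⬝ᵥ v j : ℝ) : ℂ) +
      ((u l ⬝ᵥ v j + v l ⬝ᵥ u j : ℝ) : ℂ) * Complex.I := fun l j => by
    apply Complex.ext <;> simp [mul_apply, dotProduct, u, v, Finset.sum_sub_distrib,
      Finset.sum_add_distrib]
  have hH : ∀ l j, (W * Wᴴ) l j = ((u l ⬝ᵥ u j + v l ⬝ᵥ v j : ℝ) : ℂ) +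
      ((v l ⬝ᵥ u j - u l ⬝ᵥ v j : ℝ) : ℂ) * Complex.I := fun l j => by
    apply Complex.ext <;> simp [mul_apply, dotProduct, u, v, Finset.sum_add_distrib,
      sub_eq_neg_add, add_comm]
  have huv : ∀ j, u j ⬝ᵥ v j = 0 := fun j => by
    have h := congrArg Complex.im ((hT j j).symm.trans (h2 j j))
    rw [if_pos rfl] at h
    simp only [Complex.add_im, Complex.ofReal_im, Complex.mul_im, Complex.ofReal_re, Complex.I_re,
      Complex.I_im] at h
    rw [dotProduct_comm (v j)] at h
    linarith
  have hne : ∀ l j, l ≠ j → u l ⬝ᵥ u j = 0 ∧ v l ⬝ᵥ v j = 0 ∧ u l ⬝ᵥ v j = 0 ∧ v l ⬝ᵥ u j = 0 := by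
    intro l j hlj
    have h3 := (hT l j).symm.trans ((h2 l j).trans (if_neg hlj))
    have h4 := (hH l j).symm.trans (congrFun (congrFun h1 l) j)
    rw [Matrix.one_apply_ne hlj] at h4
    have r3 := congrArg Complex.re h3
    have i3 := congrArg Complex.im h3
    have r4 := congrArg Complex.re h4
    have i4 := congrArg Complex.im h4
    simp only [Complex.add_im, Complex.ofReal_im, Complex.mul_im, Complex.ofReal_re, Complex.I_re,
      Complex.I_im, Complex.add_re, Complex.mul_re, Complex.zero_re, Complex.zero_im] at r3 i3 r4 i4
    refine ⟨?_, ?_, ?_, ?_⟩ <;> linarith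
  have hvu : ∀ j, v j ⬝ᵥ u j = 0 := fun j => by rw [dotProduct_comm, huv]
  refine ⟨h1, fun j => ⟨?_, ?_⟩, fun j l hjl => ?_, fun j l a => ?_⟩
  · rw [transpose_add, lineProj_transpose, lineProj_transpose]
  · rw [Matrix.add_mul, Matrix.mul_add, Matrix.mul_add, lineProj_mul_self, lineProj_mul_self,
      lineProj_mul_of_orthogonal (huv j), lineProj_mul_of_orthogonal (hvu j), add_zero, zero_add]
  · obtain ⟨a1, a2, a3, a4⟩ := hne j l hjl
    rw [Matrix.add_mul, Matrix.mul_add, Matrix.mul_add, lineProj_mul_of_orthogonal a1,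
      lineProj_mul_of_orthogonal a2, lineProj_mul_of_orthogonal a3, lineProj_mul_of_orthogonal a4]
    simp
  · have hrow : (W * toC (lineProj (u j) + lineProj (v j))) l a =
        ((u l ᵥ* (lineProj (u j) + lineProj (v j))) a : ℝ) +
          ((v l ᵥ* (lineProj (u j) + lineProj (v j))) a : ℝ) * Complex.I := by
      apply Complex.ext <;> simp [mul_apply, vecMul, dotProduct, u, v]
    rw [hrow, vecMul_add, vecMul_add]
    by_cases hlj : l = j
    · subst hlj
      rw [if_pos rfl, vecMul_lineProj_self, vecMul_lineProj_self,
        vecMul_lineProj_of_orthogonal (huv l), vecMul_lineProj_of_orthogonal (hvu l), add_zero,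
        zero_add]
      exact Complex.re_add_im _
    · obtain ⟨a1, a2, a3, a4⟩ := hne l j hlj
      rw [if_neg hlj, vecMul_lineProj_of_orthogonal a1, vecMul_lineProj_of_orthogonal a2,
        vecMul_lineProj_of_orthogonal a3, vecMul_lineProj_of_orthogonal a4]
      simp

/-- A unitary T that diagonalises the symmetric matrix A = W Wᵀ as T A Tᵀ leaves the row space alone
and makes T W satisfy `isRealFrame_of_isReal`. -/
lemma exists_isRealFrame {W : Matrix (Fin r) (Fin n) ℂ} (hW : W * Wᴴ = 1) :
    ∃ (W' : Matrix (Fin r) (Fin n) ℂ) (R : Fin r → Matrix (Fin n) (Fin n) ℝ),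
      IsRealFrame W' R ∧ W'ᴴ * W' = Wᴴ * W := by
  set A := W * Wᵀ with hA
  have hAt : Aᵀ = A := by rw [hA, transpose_mul, transpose_transpose]
  -- The map x ↦ A x̄ is only real-linear; its eigenvectors are the Takagi vectors of A.
  let J : EuclideanSpace ℂ (Fin r) →ₗ[ℝ] EuclideanSpace ℂ (Fin r) :=
    { toFun := fun x => WithLp.toLp 2 (A *ᵥ star x.ofLp)
      map_add' := fun x y => by
        rw [WithLp.ofLp_add, star_add, mulVec_add]
        rfl
      map_smul' := fun c x => by
        ext i
        simp [mulVec, dotProduct, Finset.mul_sum, mul_left_comm] }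
  have hin : ∀ x y, inner ℂ x (J y) = star x.ofLp ⬝ᵥ (A *ᵥ star y.ofLp) := fun x y => by
    simp [PiLp.inner_apply, J, dotProduct, mul_comm]
  have hJ : ∀ x y, inner ℂ x (J y) = inner ℂ y (J x) := fun x y => by
    rw [hin, hin, dotProduct_mulVec, ← mulVec_transpose, hAt, dotProduct_comm]
  obtain ⟨v, t, hv, hvt⟩ := exists_orthonormal_eigenvectors J hJ (k := r) (by simp)
  have hvi := orthonormal_iff_ite.1 hv
  set T : Matrix (Fin r) (Fin r) ℂ := of fun l a => star (v l a) with hT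
  have hTT : T * Tᴴ = 1 := by
    ext l j
    rw [Matrix.one_apply, ← hvi l j]
    simp [mul_apply, hT, PiLp.inner_apply, mul_comm]
  have hTA : ∀ l j, (T * A * Tᵀ) l j = if l = j then (t j : ℂ) else 0 := fun l j => by
    have h1 : (T * A * Tᵀ) l j = inner ℂ (v l) (J (v j)) := by
      rw [hin, Matrix.mul_assoc]
      simp [mul_apply, mulVec, dotProduct, hT]
    rw [h1, hvt, ← Complex.coe_smul, inner_smul_right, hvi]
    split_ifs <;> simp
  refine ⟨T * W, _, isRealFrame_of_isReal (t := t) ?_ ?_, ?_⟩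
  · rw [conjTranspose_mul, Matrix.mul_assoc, ← Matrix.mul_assoc W, hW, Matrix.one_mul, hTT]
  · intro l j
    rw [← hTA, transpose_mul, hA]
    simp only [Matrix.mul_assoc]
  · rw [conjTranspose_mul, Matrix.mul_assoc, ← Matrix.mul_assoc Tᴴ, mul_eq_one_comm.1 hTT,
      Matrix.one_mul]

end RealFrame

lemma lintegral_frobSq_one_sub_mul_le {n m r p : ℕ} (hp : 2 ≤ p) (hm : m = r + p)
    {W : Matrix (Fin r) (Fin n) ℂ} (hW : W * Wᴴ = 1) (G : Matrix (Fin n) (Fin n) ℂ)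
    {P : MatSpace n m → Matrix (Fin n) (Fin n) ℂ}
    (hP : ∀ᵐ x ∂stdGaussian (MatSpace n m),
      (P x)ᴴ = P x ∧ P x * P x = P x ∧ P x * (G * entryMat x) = G * entryMat x) :
    ∫⁻ x, ENNReal.ofReal (frobSq ((1 - P x) * G)) ∂stdGaussian (MatSpace n m) ≤
      ENNReal.ofReal (8 / 3 * (1 + r / ((p : ℝ) - 1)) * frobSq (G * (1 - Wᴴ * W))) := by
  obtain ⟨V, R, hV, hVW⟩ := exists_isRealFrame hW
  rw [← hVW]
  refine le_trans (lintegral_mono_ae ?_) (lintegral_residual_le hV hp hm _)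
  have hrm : r ≤ m := by omega
  filter_upwards [hP, ae_gramUnit hV hrm, hV.ae_row_ne_zero hrm] with x ⟨h1, h2, h3⟩ hg hq
  exact ENNReal.ofReal_le_ofReal (frobSq_one_sub_mul_le hV.mul_conjTranspose hg hq h1 h2 h3)

/-! ### Diagonalisation with ordered eigenvalues. -/

section Diagonalization

variable {n : ℕ}

/-- `X = V diag(μ) V*` with `V` unitary and `μ` real. -/
structure Diagonalizes (X V : Matrix (Fin n) (Fin n) ℂ) (μ : Fin n → ℝ) : Prop where
  left : Vᴴ * V = 1
  right : V * Vᴴ = 1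
  eq : X = V * diagonal (fun j => (μ j : ℂ)) * Vᴴ

/-- Here and below the shift `j + 1` reconciles `Fin n`, which starts at 0, with `eig`, which counts
from 1. -/
lemma antitone_eig (X : Matrix (Fin n) (Fin n) ℂ) : Antitone fun j : Fin n => eig X (j + 1) := by
  intro i j hij
  by_cases hX : X.IsHermitian
  · have h : ∀ j : Fin n, X.IsHermitian ∧ 1 ≤ (j : ℕ) + 1 ∧ (j : ℕ) + 1 ≤ n := fun j =>
      ⟨hX, by omega, j.2⟩
    simp only [eig, dif_pos (h _)]
    exact hX.eigenvalues₀_antitone (by simpa using hij)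
  · simp [eig, hX]

lemma exists_diagonalizes {X : Matrix (Fin n) (Fin n) ℂ} (hX : X.IsHermitian) :
    ∃ V, Diagonalizes X V fun j => eig X (j + 1) := by
  set e : Fin (Fintype.card (Fin n)) ≃ Fin n := Fintype.equivOfCardEq (Fintype.card_fin _)
  -- This permutation undoes the reindexing inside `eigenvalues`, restoring decreasing order.
  set σ : Fin n ≃ Fin n := (finCongr (Fintype.card_fin n).symm).trans e
  set U : Matrix (Fin n) (Fin n) ℂ := (hX.eigenvectorUnitary).1
  have hU1 : Uᴴ * U = 1 := Unitary.coe_star_mul_self hX.eigenvectorUnitary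
  have hU2 : U * Uᴴ = 1 := Unitary.coe_mul_star_self hX.eigenvectorUnitary
  have hXU : X = U * diagonal (fun j => (hX.eigenvalues j : ℂ)) * Uᴴ := hX.spectral_theorem
  have hσ : ∀ j : Fin n, eig X (j + 1) = hX.eigenvalues (σ j) := fun j => by
    have h : X.IsHermitian ∧ 1 ≤ (j : ℕ) + 1 ∧ (j : ℕ) + 1 ≤ n := ⟨hX, by omega, j.2⟩
    rw [eig, dif_pos h, IsHermitian.eigenvalues]
    congr 1
    simp only [σ, e, Equiv.trans_apply, Equiv.symm_apply_apply]
    rfl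
  refine ⟨U.submatrix id σ, ?_, ?_, ?_⟩
  · rw [conjTranspose_submatrix, ← submatrix_mul Uᴴ U σ id σ Function.bijective_id, hU1,
      submatrix_one_equiv]
  · rw [conjTranspose_submatrix, ← submatrix_mul U Uᴴ id σ id σ.bijective, hU2, submatrix_id_id]
  · have hd : diagonal (fun j : Fin n => (eig X (j + 1) : ℂ)) =
        (diagonal fun j => (hX.eigenvalues j : ℂ)).submatrix σ σ := by
      rw [submatrix_diagonal_equiv]
      simp only [hσ]
      rfl
    rw [hd, conjTranspose_submatrix, ← submatrix_mul _ _ id σ σ σ.bijective,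
      ← submatrix_mul _ _ id σ id σ.bijective, submatrix_id_id]
    exact hXU

variable {X V : Matrix (Fin n) (Fin n) ℂ} {μ : Fin n → ℝ}

namespace Diagonalizes

lemma conj_eq (h : Diagonalizes X V μ) : Vᴴ * X * V = diagonal fun j => (μ j : ℂ) := by
  rw [h.eq, Matrix.mul_assoc, Matrix.mul_assoc, h.left, Matrix.mul_one, ← Matrix.mul_assoc, h.left,
    Matrix.one_mul]

lemma nonneg (h : Diagonalizes X V μ) (hX : X.PosSemidef) (j : Fin n) : 0 ≤ μ j := by
  have h1 := (hX.conjTranspose_mul_mul_same V).diag_nonneg (i := j)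
  rw [h.conj_eq, diagonal_apply_eq] at h1
  exact_mod_cast h1

lemma rank_eq (h : Diagonalizes X V μ) :
    X.rank = (Finset.univ.filter fun j => μ j ≠ 0).card := by
  have hV : IsUnit V.det := (isUnit_iff_isUnit_det V).1 (IsUnit.of_mul_eq_one _ h.right)
  have hV' : IsUnit Vᴴ.det := (isUnit_iff_isUnit_det _).1 (IsUnit.of_mul_eq_one _ h.left)
  rw [h.eq, rank_mul_eq_left_of_isUnit_det _ _ hV', rank_mul_eq_right_of_isUnit_det _ _ hV,
    rank_diagonal, Fintype.card_subtype]
  simp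

lemma det_one_add (h : Diagonalizes X V μ) : (1 + X).det = ((∏ j, (1 + μ j) : ℝ) : ℂ) := by
  have h1 : 1 + X = V * (1 + diagonal fun j => (μ j : ℂ)) * Vᴴ := by
    rw [Matrix.mul_add, Matrix.add_mul, Matrix.mul_one, h.right, ← h.eq]
  have h2 : V.det * Vᴴ.det = 1 := by rw [← det_mul, h.right, det_one]
  rw [h1, det_mul, det_mul, mul_right_comm, h2, one_mul, ← diagonal_one, diagonal_add, det_diagonal]
  push_cast
  rfl

lemma trace_mul (h : Diagonalizes X V μ) (M : Matrix (Fin n) (Fin n) ℂ) :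
    (X * M).trace = ∑ j, (μ j : ℂ) * (Vᴴ * M * V) j j := by
  rw [h.eq, Matrix.mul_assoc, Matrix.mul_assoc, trace_mul_comm, Matrix.mul_assoc, trace]
  simp only [diag_apply, diagonal_mul]

lemma frobSq_eq (h : Diagonalizes X V μ) : frobSq X = ∑ j, μ j ^ 2 := by
  have h1 := frobSq_mul_isometry (V * diagonal fun j => (μ j : ℂ)) (U := V) h.left
  rw [← h.eq, frobSq_isometry_mul _ h.left] at h1
  rw [h1, frobSq]
  refine Finset.sum_congr rfl fun i _ => ?_
  rw [Finset.sum_eq_single i]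
  · simp
  · intro j _ hj
    simp [diagonal_apply_ne _ hj.symm]
  · simp

lemma log_det_one_add (h : Diagonalizes X V μ) (hμ : ∀ j, 0 ≤ μ j) :
    Real.log (1 + X).det.re = ∑ j, Real.log (1 + μ j) := by
  rw [h.det_one_add, Complex.ofReal_re, Real.log_prod]
  intro j _
  linarith [hμ j]

end Diagonalizes

lemma diagonalizes_diagonal (μ : Fin n → ℝ) :
    Diagonalizes (diagonal fun j => (μ j : ℂ)) 1 μ := ⟨by simp, by simp, by simp⟩

end Diagonalization

/-! ### The scalar divergence. -/

section LogGap

/-- The divergence `1 / (1 + x) - log (1 / (1 + x)) - 1`, in the form `log (1 + x) - x / (1 + x)`. -/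
noncomputable def logGap (x : ℝ) : ℝ := Real.log (1 + x) - x * (1 + x)⁻¹

lemma logGap_eq {x : ℝ} (hx : 0 ≤ x) : logGap x = 1 / (1 + x) - Real.log (1 / (1 + x)) - 1 := by
  rw [logGap, one_div, Real.log_inv]
  field_simp
  ring

lemma logGap_pos {x : ℝ} (hx : 0 < x) : 0 < logGap x := by
  have h := Real.log_lt_sub_one_of_pos (x := (1 + x)⁻¹) (by positivity)
    (inv_ne_one.2 (by linarith))
  have h1 : 1 - (1 + x)⁻¹ = x * (1 + x)⁻¹ := by
    field_simp
    ring
  rw [Real.log_inv] at h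
  rw [logGap]
  linarith

lemma logGap_nonneg {x : ℝ} (hx : 0 ≤ x) : 0 ≤ logGap x := by
  rcases hx.eq_or_lt with rfl | h
  · simp [logGap]
  · exact (logGap_pos h).le

/-- The tangent of `log (1 + ·)` at `x` bounds its value at `y`. -/
lemma log_one_add_le_logGap_add {x y : ℝ} (hx : 0 ≤ x) (hy : 0 ≤ y) :
    Real.log (1 + y) ≤ logGap x + (1 + x)⁻¹ * y := by
  have h1 : 0 < 1 + x := by linarith
  have h2 : 0 < 1 + y := by linarith
  have h := Real.log_le_sub_one_of_pos (div_pos h2 h1)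
  rw [Real.log_div h2.ne' h1.ne', div_eq_mul_inv] at h
  have h3 : (1 + y) * (1 + x)⁻¹ - 1 = (1 + x)⁻¹ * y - x * (1 + x)⁻¹ := by
    field_simp
    ring
  rw [logGap]
  linarith

/-- The tangent at y, evaluated at x, gives log(1 + x) ≤ g(y) + x/(1 + y), and 1/(1 + y) ≤ 1/(1 +
x). -/
lemma logGap_mono {x y : ℝ} (hx : 0 ≤ x) (hxy : x ≤ y) : logGap x ≤ logGap y := by
  have hy := hx.trans hxy
  have h1 := log_one_add_le_logGap_add hy hx
  have h2 : logGap x = Real.log (1 + x) - x * (1 + x)⁻¹ := rfl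
  have h3 : (1 + y)⁻¹ ≤ (1 + x)⁻¹ := inv_anti₀ (by linarith) (by linarith)
  nlinarith [mul_le_mul_of_nonneg_left h3 hx]

end LogGap

/-- The indices `j` with `r ≤ j`. -/
abbrev tailIdx (n r : ℕ) : Finset (Fin n) := Finset.univ.filter fun j => r ≤ (j : ℕ)

/-- Bathtub principle: each term is compared with the threshold value f(r), and the total excess (∑
c - r) f(r) is nonpositive. -/
lemma sum_mul_le_sum_of_antitone {n r : ℕ} (hr : r < n) {f c : Fin n → ℝ} (hf : Antitone f)
    (hf0 : ∀ j, 0 ≤ f j) (hc0 : ∀ j, 0 ≤ c j) (hc1 : ∀ j, c j ≤ 1) (hc : ∑ j, c j ≤ r) :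
    ∑ j, c j * f j ≤ ∑ j ∈ Finset.univ.filter fun j : Fin n => (j : ℕ) < r, f j := by
  have h1 : ∀ j : Fin n, c j * f j ≤
      (if (j : ℕ) < r then f j else 0) + (c j - if (j : ℕ) < r then 1 else 0) * f ⟨r, hr⟩ := by
    intro j
    split_ifs with h
    · have : f ⟨r, hr⟩ ≤ f j := hf h.le
      nlinarith [hc1 j]
    · have : f j ≤ f ⟨r, hr⟩ := hf (not_lt.1 h)
      nlinarith [hc0 j]
  have hcard : ∑ j : Fin n, (if (j : ℕ) < r then (1 : ℝ) else 0) = r := by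
    rw [Finset.sum_boole, Fin.card_filter_val_lt]
    simp [hr.le]
  calc ∑ j, c j * f j ≤ _ := Finset.sum_le_sum fun j _ => h1 j
    _ = (∑ j ∈ Finset.univ.filter fun j : Fin n => (j : ℕ) < r, f j) + (∑ j, c j - r) * f ⟨r, hr⟩ := by
      rw [Finset.sum_add_distrib, ← Finset.sum_mul, Finset.sum_sub_distrib, hcard,
        Finset.sum_filter]
    _ ≤ _ := by nlinarith [hf0 ⟨r, hr⟩]

/-! ### The lower bound at rank at most r. -/

section LowerBound

variable {n : ℕ}

lemma logDetDiv_conj {C : Matrix (Fin n) (Fin n) ℂ} (hC : IsUnit C.det)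
    (M N : Matrix (Fin n) (Fin n) ℂ) :
    logDetDiv (C * M * Cᴴ) (C * N * Cᴴ) = logDetDiv M N := by
  have hC' : IsUnit Cᴴ.det := by
    rw [det_conjTranspose]
    exact hC.star
  have h : C * M * Cᴴ * (C * N * Cᴴ)⁻¹ = C * (M * N⁻¹) * C⁻¹ := by
    rw [Matrix.mul_inv_rev, Matrix.mul_inv_rev]
    calc _ = C * M * (Cᴴ * Cᴴ⁻¹) * N⁻¹ * C⁻¹ := by simp only [Matrix.mul_assoc]
      _ = _ := by rw [Matrix.mul_nonsing_inv _ hC', Matrix.mul_one, Matrix.mul_assoc C]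
  rw [logDetDiv, logDetDiv, h, trace_mul_cycle, Matrix.nonsing_inv_mul _ hC, Matrix.one_mul,
    det_conj ((isUnit_iff_isUnit_det C).2 hC)]

variable {lam : Fin n → ℝ}

lemma inv_one_add_diagonal (hlam : ∀ j, 0 ≤ lam j) :
    (1 + diagonal fun j => (lam j : ℂ))⁻¹ = diagonal fun j => (((1 + lam j)⁻¹ : ℝ) : ℂ) := by
  refine inv_eq_right_inv ?_
  rw [← diagonal_one, diagonal_add, diagonal_mul_diagonal]
  congr 1
  ext j
  have : 1 + lam j ≠ 0 := by linarith [hlam j]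
  rw [← Complex.ofReal_one, ← Complex.ofReal_add, ← Complex.ofReal_mul, mul_inv_cancel₀ this]

lemma logDetDiv_one_add_diagonal (hlam : ∀ j, 0 ≤ lam j) {X : Matrix (Fin n) (Fin n) ℂ}
    (hX : X.PosSemidef) :
    logDetDiv (1 + X) (1 + diagonal fun j => (lam j : ℂ)) =
      (X * diagonal fun j => (((1 + lam j)⁻¹ : ℝ) : ℂ)).trace.re - Real.log (1 + X).det.re +
        ∑ j, logGap (lam j) := by
  obtain ⟨V, hV⟩ := exists_diagonalizes hX.1
  have hμ := hV.nonneg hX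
  have h1 : ∀ j, 0 < 1 + lam j := fun j => by linarith [hlam j]
  have hs : ∑ j : Fin n, (1 + lam j)⁻¹ = n - ∑ j, lam j * (1 + lam j)⁻¹ := by
    rw [eq_sub_iff_add_eq, ← Finset.sum_add_distrib]
    have : ∀ j : Fin n, (1 + lam j)⁻¹ + lam j * (1 + lam j)⁻¹ = 1 := fun j => by
      have := (h1 j).ne'
      field_simp
    simp [this]
  have hprod : (0 : ℝ) < ∏ j : Fin n, (1 + eig X (j + 1)) :=
    Finset.prod_pos fun j _ => by linarith [hμ j]
  have hlog : Real.log ((∏ j : Fin n, (1 + eig X (j + 1))) * ∏ j, (1 + lam j)⁻¹) =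
      Real.log (∏ j : Fin n, (1 + eig X (j + 1))) - ∑ j, Real.log (1 + lam j) := by
    rw [Real.log_mul hprod.ne' (Finset.prod_pos fun j _ => inv_pos.2 (h1 j)).ne',
      Real.log_prod (f := fun j => (1 + lam j)⁻¹) (fun j _ => (inv_pos.2 (h1 j)).ne'),
      sub_eq_add_neg, ← Finset.sum_neg_distrib]
    simp only [Real.log_inv]
  have hdet : ((1 + X) * diagonal fun j => (((1 + lam j)⁻¹ : ℝ) : ℂ)).det.re =
      (∏ j : Fin n, (1 + eig X (j + 1))) * ∏ j, (1 + lam j)⁻¹ := by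
    rw [det_mul, hV.det_one_add, det_diagonal, ← Complex.ofReal_prod, ← Complex.ofReal_mul,
      Complex.ofReal_re]
  have htr : ((1 + X) * diagonal fun j => (((1 + lam j)⁻¹ : ℝ) : ℂ)).trace.re =
      ∑ j, (1 + lam j)⁻¹ + (X * diagonal fun j => (((1 + lam j)⁻¹ : ℝ) : ℂ)).trace.re := by
    rw [Matrix.add_mul, Matrix.one_mul, trace_add, trace_diagonal, ← Complex.ofReal_sum,
      Complex.add_re, Complex.ofReal_re]
  rw [logDetDiv, inv_one_add_diagonal hlam, hdet, htr, hlog, hV.det_one_add, Complex.ofReal_re, hs]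
  simp only [logGap, Finset.sum_sub_distrib]
  ring

/-- The divergence of `1 + X` from `1 + diag(lam)` leaves out at most `rank X` of the gaps. -/
lemma exists_weights_le_logDetDiv (hlam : ∀ j, 0 ≤ lam j) {X : Matrix (Fin n) (Fin n) ℂ}
    (hX : X.PosSemidef) :
    ∃ c : Fin n → ℝ, (∀ j, 0 ≤ c j) ∧ (∀ j, c j ≤ 1) ∧ ∑ j, c j ≤ X.rank ∧
      ∑ j, logGap (lam j) - ∑ j, c j * logGap (lam j) ≤
        logDetDiv (1 + X) (1 + diagonal fun j => (lam j : ℂ)) := by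
  obtain ⟨V, hV⟩ := exists_diagonalizes hX.1
  have hμ := hV.nonneg hX
  set μ : Fin n → ℝ := fun j => eig X (j + 1) with hμdef
  set S := Finset.univ.filter fun j => μ j ≠ 0 with hS
  -- The squared moduli of a unitary matrix are doubly stochastic, so trace and log-determinant
  -- become averages with the same weights.
  have hcol : ∀ i, ∑ j, ‖V j i‖ ^ 2 = 1 := fun i => by
    have h := congrFun (congrFun hV.left i) i
    rw [Matrix.one_apply_eq, mul_apply] at h
    have h' : ∀ j, Vᴴ i j * V j i = ((‖V j i‖ ^ 2 : ℝ) : ℂ) := fun j => by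
      rw [conjTranspose_apply, ← Complex.normSq_eq_norm_sq, Complex.normSq_eq_conj_mul_self]
      rfl
    simp only [h', ← Complex.ofReal_sum] at h
    exact_mod_cast h
  have hrow : ∀ j, ∑ i, ‖V j i‖ ^ 2 = 1 := fun j => by
    have h := congrFun (congrFun hV.right j) j
    rw [Matrix.one_apply_eq, mul_apply] at h
    have h' : ∀ i, V j i * Vᴴ i j = ((‖V j i‖ ^ 2 : ℝ) : ℂ) := fun i => by
      rw [conjTranspose_apply, ← Complex.normSq_eq_norm_sq, ← Complex.mul_conj]
      rfl
    simp only [h', ← Complex.ofReal_sum] at h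
    exact_mod_cast h
  have htr : (X * diagonal fun j => (((1 + lam j)⁻¹ : ℝ) : ℂ)).trace.re =
      ∑ i, ∑ j, ‖V j i‖ ^ 2 * (μ i * (1 + lam j)⁻¹) := by
    have h : ∀ i, (Vᴴ * (diagonal fun j => (((1 + lam j)⁻¹ : ℝ) : ℂ)) * V) i i =
        ((∑ j, ‖V j i‖ ^ 2 * (1 + lam j)⁻¹ : ℝ) : ℂ) := fun i => by
      rw [mul_apply, Complex.ofReal_sum]
      refine Finset.sum_congr rfl fun j _ => ?_
      rw [mul_diagonal, conjTranspose_apply, Complex.ofReal_mul, ← Complex.normSq_eq_norm_sq,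
        Complex.normSq_eq_conj_mul_self, mul_right_comm]
      rfl
    rw [hV.trace_mul]
    simp only [h, ← Complex.ofReal_mul, ← Complex.ofReal_sum, Complex.ofReal_re, Finset.mul_sum]
    refine Finset.sum_congr rfl fun i _ => Finset.sum_congr rfl fun j _ => ?_
    ring
  have hlogdet : Real.log (1 + X).det.re = ∑ i, ∑ j, ‖V j i‖ ^ 2 * Real.log (1 + μ i) := by
    rw [hV.log_det_one_add hμ]
    refine Finset.sum_congr rfl fun i _ => ?_
    rw [← Finset.sum_mul, hcol, one_mul]
  -- A nonzero μ i loses a weighted gap by the tangent inequality at lam j; a zero μ i loses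
  -- nothing, which is where the rank enters.
  have hterm : ∀ i j, -(if μ i ≠ 0 then ‖V j i‖ ^ 2 * logGap (lam j) else 0) ≤
      ‖V j i‖ ^ 2 * (μ i * (1 + lam j)⁻¹) - ‖V j i‖ ^ 2 * Real.log (1 + μ i) := by
    intro i j
    split_ifs with h
    · have := log_one_add_le_logGap_add (hlam j) (hμ i)
      nlinarith [sq_nonneg ‖V j i‖]
    · have h0 : μ i = 0 := not_not.1 h
      simp [h0]
  set c : Fin n → ℝ := fun j => ∑ i ∈ S, ‖V j i‖ ^ 2 with hc
  refine ⟨c, fun j => Finset.sum_nonneg fun i _ => sq_nonneg _,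
    fun j => (Finset.sum_le_sum_of_subset_of_nonneg (Finset.subset_univ _)
      fun _ _ _ => sq_nonneg _).trans (hrow j).le, ?_, ?_⟩
  · rw [hV.rank_eq, hc, Finset.sum_comm]
    simp only [hcol, Finset.sum_const, nsmul_eq_mul, mul_one]
    rfl
  · have h2 : -∑ j, c j * logGap (lam j) ≤
        ∑ i, ∑ j, (‖V j i‖ ^ 2 * (μ i * (1 + lam j)⁻¹) - ‖V j i‖ ^ 2 * Real.log (1 + μ i)) := by
      refine le_trans (le_of_eq ?_) (Finset.sum_le_sum fun i _ => Finset.sum_le_sum fun j _ =>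
        hterm i j)
      simp only [Finset.sum_neg_distrib, neg_inj, hc, Finset.sum_mul, hS, Finset.sum_filter, ite_mul, zero_mul]
      rw [Finset.sum_comm]
    simp only [Finset.sum_sub_distrib] at h2
    rw [logDetDiv_one_add_diagonal hlam hX, htr, hlogdet]
    linarith

/-- Among the positive semidefinite `X` of rank at most `r`, the divergence of `1 + X` is at least
the sum of the tail of the gaps of the eigenvalues. -/
lemma sum_logGap_le_logDetDiv {r : ℕ} (hr : r < n) (hlam : ∀ j, 0 ≤ lam j) (hanti : Antitone lam)
    {X : Matrix (Fin n) (Fin n) ℂ} (hX : X.PosSemidef) (hXr : X.rank ≤ r) :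
    ∑ j ∈ tailIdx n r, logGap (lam j) ≤
      logDetDiv (1 + X) (1 + diagonal fun j => (lam j : ℂ)) := by
  obtain ⟨c, hc0, hc1, hcr, hc⟩ := exists_weights_le_logDetDiv hlam hX
  have h1 := sum_mul_le_sum_of_antitone hr (f := fun j => logGap (lam j)) (c := c)
    (fun i j hij => logGap_mono (hlam j) (hanti hij)) (fun j => logGap_nonneg (hlam j)) hc0 hc1
    (hcr.trans (by exact_mod_cast hXr))
  have h3 := Finset.sum_filter_add_sum_filter_not Finset.univ (fun j : Fin n => (j : ℕ) < r)
    fun j => logGap (lam j)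
  simp only [not_lt] at h3
  linarith

/-- In an eigenbasis of Y the weights of `exists_weights_le_logDetDiv` are at most 1, so no more
than the whole sum of gaps is removed. -/
lemma logDetDiv_one_add_nonneg {X Y : Matrix (Fin n) (Fin n) ℂ} (hX : X.PosSemidef)
    (hY : Y.PosSemidef) : 0 ≤ logDetDiv (1 + X) (1 + Y) := by
  obtain ⟨V, hV⟩ := exists_diagonalizes hY.1
  have hVu : IsUnit V.det := (isUnit_iff_isUnit_det V).1 (IsUnit.of_mul_eq_one _ hV.right)
  have hV' : V * (Vᴴ * X * V) * Vᴴ = X := by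
    rw [Matrix.mul_assoc, Matrix.mul_assoc, hV.right, Matrix.mul_one, ← Matrix.mul_assoc, hV.right,
      Matrix.one_mul]
  have hX' : 1 + X = V * (1 + Vᴴ * X * V) * Vᴴ := by
    rw [Matrix.mul_add, Matrix.add_mul, Matrix.mul_one, hV.right, hV']
  have hY' : 1 + Y = V * (1 + diagonal fun j : Fin n => (eig Y (j + 1) : ℂ)) * Vᴴ := by
    rw [Matrix.mul_add, Matrix.add_mul, Matrix.mul_one, hV.right, ← hV.eq]
  obtain ⟨c, hc0, hc1, -, hc⟩ := exists_weights_le_logDetDiv (hV.nonneg hY)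
    (hX.conjTranspose_mul_mul_same V)
  rw [hX', hY', logDetDiv_conj hVu]
  refine le_trans ?_ hc
  rw [← Finset.sum_sub_distrib]
  refine Finset.sum_nonneg fun j _ => ?_
  have := logGap_nonneg (hV.nonneg hY j)
  nlinarith [hc1 j]

end LowerBound

/-! ### The deterministic upper bound for a pinched approximation. -/

section UpperBound

variable {n : ℕ}

lemma frobSq_mul_diagonal_le (M : Matrix (Fin n) (Fin n) ℂ) {d : Fin n → ℝ} {c : ℝ}
    (hd : ∀ j, d j ^ 2 ≤ c) :
    frobSq (M * diagonal fun j => (d j : ℂ)) ≤ frobSq M * c := by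
  rw [frobSq, frobSq, Finset.sum_mul]
  refine Finset.sum_le_sum fun i _ => ?_
  rw [Finset.sum_mul]
  refine Finset.sum_le_sum fun j _ => ?_
  rw [mul_diagonal, norm_mul, mul_pow, Complex.norm_real, Real.norm_eq_abs, sq_abs]
  exact mul_le_mul_of_nonneg_left (hd j) (sq_nonneg _)

lemma rank_of_proj {P : Matrix (Fin n) (Fin n) ℂ} (hP : Pᴴ = P) (hPP : P * P = P) :
    (P.rank : ℝ) = frobSq P := by
  obtain ⟨V, hV⟩ := exists_diagonalizes (X := P) hP
  have hμ : ∀ j : Fin n, eig P (j + 1) ^ 2 = if eig P (j + 1) ≠ 0 then 1 else 0 := fun j => by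
    have h : Vᴴ * P * V * (Vᴴ * P * V) = Vᴴ * P * V := by
      rw [Matrix.mul_assoc, Matrix.mul_assoc Vᴴ P V, ← Matrix.mul_assoc V, hV.right,
        Matrix.one_mul, Matrix.mul_assoc, ← Matrix.mul_assoc P, hPP]
    rw [hV.conj_eq, diagonal_mul_diagonal] at h
    have h1 := congrFun (congrFun h j) j
    rw [diagonal_apply_eq, diagonal_apply_eq, ← Complex.ofReal_mul, Complex.ofReal_inj] at h1
    split_ifs with h0
    · rw [sq, h1]
      exact mul_left_cancel₀ h0 (by rw [h1, mul_one])
    · rw [not_not.1 h0]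
      norm_num
  rw [hV.rank_eq, hV.frobSq_eq]
  simp only [hμ, Finset.sum_boole]

/-- The nonzero eigenvalues of Z are matched with distinct indices of J. Each is bounded by the
tangent at its partner, and Cauchy-Schwarz collects the linear terms. -/
lemma Diagonalizes.log_det_one_add_le {Z V : Matrix (Fin n) (Fin n) ℂ} {γ lam : Fin n → ℝ}
    (hV : Diagonalizes Z V γ) (hγ : ∀ j, 0 ≤ γ j) (hlam : ∀ j, 0 ≤ lam j) {J : Finset (Fin n)}
    (hJ : Z.rank ≤ J.card) :
    Real.log (1 + Z).det.re ≤ ∑ j ∈ J, logGap (lam j) +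
      √(∑ j ∈ J, ((1 + lam j)⁻¹) ^ 2) * √(frobSq Z) := by
  rw [hV.rank_eq] at hJ
  set S := Finset.univ.filter fun j => γ j ≠ 0 with hS
  obtain ⟨T, hTJ, hT⟩ := Finset.exists_subset_card_eq hJ
  -- Any matching will do, since the tangent inequality holds for every pair.
  let e : S ≃ T := Fintype.equivOfCardEq (by simp [hT])
  have h1 : Real.log (1 + Z).det.re ≤
      ∑ i : S, (logGap (lam (e i)) + (1 + lam (e i))⁻¹ * γ i) := by
    rw [hV.log_det_one_add hγ, ← Finset.sum_subset (Finset.subset_univ S)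
      (fun j _ hj => by simp [hS] at hj; simp [hj]), ← Finset.sum_coe_sort]
    exact Finset.sum_le_sum fun i _ => log_one_add_le_logGap_add (hlam _) (hγ _)
  have hsub : ∀ f : Fin n → ℝ, (∀ j, 0 ≤ f j) → ∑ i : S, f (e i) ≤ ∑ j ∈ J, f j := fun f hf => by
    rw [e.sum_comp fun j => f j, Finset.sum_coe_sort]
    exact Finset.sum_le_sum_of_subset_of_nonneg hTJ fun j _ _ => hf j
  refine h1.trans ?_
  rw [Finset.sum_add_distrib]
  refine add_le_add (hsub (fun j => logGap (lam j)) fun j => logGap_nonneg (hlam j)) ?_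
  refine (Real.sum_mul_le_sqrt_mul_sqrt _ _ _).trans (mul_le_mul (Real.sqrt_le_sqrt ?_)
    (Real.sqrt_le_sqrt ?_) (Real.sqrt_nonneg _) (Real.sqrt_nonneg _))
  · exact hsub (fun j => ((1 + lam j)⁻¹) ^ 2) fun j => sq_nonneg _
  · rw [hV.frobSq_eq, Finset.sum_coe_sort S fun j => γ j ^ 2]
    exact Finset.sum_le_sum_of_subset_of_nonneg (Finset.subset_univ _) fun j _ _ => sq_nonneg _

lemma det_one_add_pos {X : Matrix (Fin n) (Fin n) ℂ} (hX : X.PosSemidef) :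
    ∃ d : ℝ, 0 < d ∧ (1 + X).det = d := by
  obtain ⟨V, hV⟩ := exists_diagonalizes hX.1
  exact ⟨_, Finset.prod_pos fun j _ => by linarith [hV.nonneg hX j], hV.det_one_add⟩

/-- Fischer's inequality for the pinching by an orthogonal projection. -/
lemma log_det_one_add_le_pinching {L P : Matrix (Fin n) (Fin n) ℂ} (hL : L.PosSemidef)
    (hP : Pᴴ = P) (hPP : P * P = P) :
    Real.log (1 + L).det.re ≤ Real.log (1 + P * L * P).det.re +
      Real.log (1 + (1 - P) * L * (1 - P)).det.re := by
  have hP' : (1 - P)ᴴ = 1 - P := by simp [hP]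
  have hQP : (1 - P) * P = 0 := by rw [Matrix.sub_mul, hPP, Matrix.one_mul, sub_self]
  have hPQ : P * (1 - P) = 0 := by rw [Matrix.mul_sub, hPP, Matrix.mul_one, sub_self]
  have hX : (P * L * P).PosSemidef := by
    have := hL.conjTranspose_mul_mul_same P
    rwa [hP] at this
  have hZ : ((1 - P) * L * (1 - P)).PosSemidef := by
    have := hL.conjTranspose_mul_mul_same (1 - P)
    rwa [hP'] at this
  set X := P * L * P with hXdef
  set Z := (1 - P) * L * (1 - P) with hZdef
  set N := 1 + (X + Z) with hN
  have hXZ : X * Z = 0 := by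
    calc X * Z = P * L * (P * (1 - P)) * L * (1 - P) := by simp only [hXdef, hZdef, Matrix.mul_assoc]
      _ = 0 := by rw [hPQ]; simp
  have hNdet : N = (1 + X) * (1 + Z) := by
    rw [Matrix.add_mul, Matrix.mul_add, Matrix.mul_add, hXZ, hN]
    simp only [Matrix.one_mul, Matrix.mul_one, add_zero]
    abel
  clear_value N
  obtain ⟨dL, hdL, eL⟩ := det_one_add_pos hL
  obtain ⟨dX, hdX, eX⟩ := det_one_add_pos hX
  obtain ⟨dZ, hdZ, eZ⟩ := det_one_add_pos hZ
  have eN : N.det = ((dX * dZ : ℝ) : ℂ) := by rw [hNdet, det_mul, eX, eZ, Complex.ofReal_mul]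
  have hNu : IsUnit N.det := by
    rw [eN, isUnit_iff_ne_zero]
    exact Complex.ofReal_ne_zero.2 (mul_pos hdX hdZ).ne'
  have hPN : P * N = N * P := by
    have h1 : P * X = X := by rw [hXdef, ← Matrix.mul_assoc, ← Matrix.mul_assoc, hPP]
    have h2 : X * P = X := by rw [hXdef, Matrix.mul_assoc, hPP]
    have h3 : P * Z = 0 := by rw [hZdef, ← Matrix.mul_assoc, ← Matrix.mul_assoc, hPQ]; simp
    have h4 : Z * P = 0 := by rw [hZdef, Matrix.mul_assoc, hQP]; simp
    rw [hN, Matrix.mul_add, Matrix.mul_add, Matrix.add_mul, Matrix.add_mul, h1, h2, h3, h4]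
    simp
  have hPN' : P * N⁻¹ = N⁻¹ * P := by
    calc P * N⁻¹ = N⁻¹ * N * P * N⁻¹ := by rw [Matrix.nonsing_inv_mul _ hNu, Matrix.one_mul]
      _ = N⁻¹ * (P * N) * N⁻¹ := by rw [hPN, Matrix.mul_assoc N⁻¹]
      _ = N⁻¹ * P * (N * N⁻¹) := by simp only [Matrix.mul_assoc]
      _ = _ := by rw [Matrix.mul_nonsing_inv _ hNu, Matrix.mul_one]
  have hdiff : 1 + L = N + (P * L * (1 - P) + (1 - P) * L * P) := by
    rw [hN, hXdef, hZdef]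
    noncomm_ring
  have ht1 : (P * L * (1 - P) * N⁻¹).trace = 0 := by
    have : (1 - P) * N⁻¹ = N⁻¹ * (1 - P) := by
      rw [Matrix.sub_mul, Matrix.mul_sub, hPN', Matrix.one_mul, Matrix.mul_one]
    rw [Matrix.mul_assoc, this, ← Matrix.mul_assoc, trace_mul_comm, ← Matrix.mul_assoc,
      ← Matrix.mul_assoc, hQP]
    simp
  have ht2 : ((1 - P) * L * P * N⁻¹).trace = 0 := by
    rw [Matrix.mul_assoc, hPN', ← Matrix.mul_assoc, trace_mul_comm, ← Matrix.mul_assoc,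
      ← Matrix.mul_assoc, hPQ]
    simp
  have htr : ((1 + L) * N⁻¹).trace = n := by
    rw [hdiff, Matrix.add_mul N, Matrix.add_mul, trace_add, trace_add, ht1, ht2,
      Matrix.mul_nonsing_inv _ hNu, trace_one]
    simp
  have hdet : ((1 + L) * N⁻¹).det.re = dL / (dX * dZ) := by
    rw [det_mul, det_nonsing_inv, Ring.inverse_eq_inv', eL, eN, ← Complex.ofReal_inv,
      ← Complex.ofReal_mul, Complex.ofReal_re, div_eq_mul_inv]
  -- The off-diagonal blocks have zero trace against N⁻¹, so the divergence of 1 + L from N is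
  -- purely a difference of log-determinants.
  have h := logDetDiv_one_add_nonneg hL (hX.add hZ)
  rw [← hN, logDetDiv, htr, hdet, Real.log_div hdL.ne' (mul_pos hdX hdZ).ne',
    Real.log_mul hdX.ne' hdZ.ne', Complex.natCast_re] at h
  rw [eL, eX, eZ]
  simp only [Complex.ofReal_re]
  linarith

/-- Cauchy-Schwarz with weights H/2 + H, the source of the 3/2. -/
lemma sqrt_mul_sqrt_add_le {f g H : ℝ} (hf : 0 ≤ f) (hg : 0 ≤ g) (hH : 0 ≤ H) :
    √f * √(H / 2) + √H * √g ≤ √(3 / 2 * H) * √(f + g) := by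
  rw [← Real.sqrt_mul hf, ← Real.sqrt_mul hH, ← Real.sqrt_mul (by positivity)]
  refine Real.le_sqrt_of_sq_le ?_
  have h1 := Real.sq_sqrt (show 0 ≤ f * (H / 2) by positivity)
  have h2 := Real.sq_sqrt (show 0 ≤ H * g by positivity)
  set u := √(f * (H / 2))
  set v := √(H * g)
  nlinarith [sq_nonneg (2 * u - v)]

/-- The size of the indices `j` with `r ≤ j < k`. -/
lemma card_filter_sdiff {r k : ℕ} (hrk : r ≤ k) (hkn : k ≤ n) :
    ((Finset.univ.filter fun j : Fin n => (j : ℕ) < k) \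
      Finset.univ.filter fun j : Fin n => (j : ℕ) < r).card = k - r := by
  rw [Finset.card_sdiff_of_subset (Finset.monotone_filter_right _ fun j _ hj => by
    exact lt_of_lt_of_le hj hrk), Fin.card_filter_val_lt, Fin.card_filter_val_lt]
  omega

variable {lam : Fin n → ℝ} {r k : ℕ} {P : Matrix (Fin n) (Fin n) ℂ}

/-- The projection onto the coordinates `j < k`. -/
noncomputable def coordProj (n k : ℕ) : Matrix (Fin n) (Fin n) ℂ :=
  diagonal fun j => (((if (j : ℕ) < k then 1 else 0) : ℝ) : ℂ)

lemma coordProj_conjTranspose : (coordProj n k)ᴴ = coordProj n k := by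
  rw [coordProj, diagonal_conjTranspose]
  congr 1
  ext j
  simp

lemma coordProj_mul_self : coordProj n k * coordProj n k = coordProj n k := by
  rw [coordProj, diagonal_mul_diagonal]
  congr 1
  ext j
  split_ifs <;> simp

lemma coordProj_mul_diagonal (hk : ∀ j : Fin n, lam j ≠ 0 ↔ (j : ℕ) < k) :
    coordProj n k * diagonal (fun j => (lam j : ℂ)) = diagonal fun j => (lam j : ℂ) := by
  rw [coordProj, diagonal_mul_diagonal]
  congr 1
  ext j
  split_ifs with h
  · simp
  · rw [not_not.1 fun h' => h ((hk j).1 h')]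
    simp

lemma frobSq_coordProj (hkn : k ≤ n) : frobSq (coordProj n k) = k := by
  rw [coordProj, (diagonalizes_diagonal _).frobSq_eq]
  simp only [ite_pow, one_pow, ne_eq, OfNat.ofNat_ne_zero, not_false_eq_true, zero_pow,
    Finset.sum_boole]
  rw [Fin.card_filter_val_lt, min_eq_right hkn]

lemma frobSq_coordProj_sub (hkn : k ≤ n) (hP : Pᴴ = P) (hPP : P * P = P)
    (hC : coordProj n k * P = P) :
    (coordProj n k - P)ᴴ = coordProj n k - P ∧
      (coordProj n k - P) * (coordProj n k - P) = coordProj n k - P ∧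
      frobSq (coordProj n k - P) = k - frobSq P := by
  have hC' : P * coordProj n k = P := by
    rw [← conjTranspose_conjTranspose (P * _), conjTranspose_mul, coordProj_conjTranspose, hP, hC,
      hP]
  have h1 : (coordProj n k - P)ᴴ = coordProj n k - P := by
    rw [conjTranspose_sub, coordProj_conjTranspose, hP]
  refine ⟨h1, ?_, ?_⟩
  · rw [Matrix.sub_mul, Matrix.mul_sub, Matrix.mul_sub, coordProj_mul_self, hC, hC', hPP]
    abel
  · rw [eq_sub_iff_add_eq, add_comm, ← frobSq_coordProj (n := n) hkn,
      ← frobSq_add_of_mul_conjTranspose_eq_zero]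
    · rw [add_sub_cancel]
    · rw [h1, Matrix.mul_sub, hC', hPP, sub_self]

/-- The off-diagonal part of the resolvent, relative to the projection `P`. -/
lemma frobSq_resolvent_le (hlam : ∀ j, 0 ≤ lam j) (hkn : k ≤ n) (hP : Pᴴ = P) (hPP : P * P = P)
    (hC : coordProj n k * P = P) (hPr : (r : ℝ) ≤ frobSq P) :
    frobSq ((1 - P) * (diagonal fun j => (((1 + lam j)⁻¹ : ℝ) : ℂ)) * P) ≤
      min (∑ j ∈ Finset.univ.filter fun j : Fin n => (j : ℕ) < k, ((1 + lam j)⁻¹) ^ 2) (k - r) /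
        2 := by
  have hC' : P * coordProj n k = P := by
    rw [← conjTranspose_conjTranspose (P * _), conjTranspose_mul, coordProj_conjTranspose, hP, hC,
      hP]
  have hP' : (1 - P)ᴴ = 1 - P := by simp [hP]
  have hPP' : (1 - P) * (1 - P) = 1 - P := by
    rw [Matrix.sub_mul, Matrix.mul_sub, Matrix.mul_sub, hPP]
    simp
  obtain ⟨hE, hEE, hEf⟩ := frobSq_coordProj_sub hkn hP hPP hC
  have hs0 : ∀ j, 0 ≤ (1 + lam j)⁻¹ := fun j => inv_nonneg.2 (by linarith [hlam j])
  have hs1 : ∀ j, (1 + lam j)⁻¹ ≤ 1 := fun j => inv_le_one_of_one_le₀ (by linarith [hlam j])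
  set D := diagonal fun j => (((1 + lam j)⁻¹ : ℝ) : ℂ) with hD
  have hDP : D * P = D * coordProj n k * P := by rw [Matrix.mul_assoc, hC]
  have hD' : D * coordProj n k = diagonal fun j : Fin n =>
      (((if (j : ℕ) < k then (1 + lam j)⁻¹ else 0) : ℝ) : ℂ) := by
    rw [hD, coordProj, diagonal_mul_diagonal]
    congr 1
    ext j
    split_ifs <;> simp
  have hDc : (D * coordProj n k)ᴴ = D * coordProj n k := by
    rw [hD', diagonal_conjTranspose]
    congr 1
    ext j
    simp
  have hDf : frobSq (D * coordProj n k) =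
      ∑ j ∈ Finset.univ.filter fun j : Fin n => (j : ℕ) < k, ((1 + lam j)⁻¹) ^ 2 := by
    rw [hD', (diagonalizes_diagonal _).frobSq_eq, Finset.sum_filter]
    refine Finset.sum_congr rfl fun j _ => ?_
    split_ifs <;> simp
  have e1 : (1 - P) * D * P = (1 - P) * (D * coordProj n k * P) := by
    rw [Matrix.mul_assoc, hDP]
  -- The two off-diagonal blocks of a self-adjoint matrix have equal norm, so one of them takes at
  -- most half of the total.
  have b1 : 2 * frobSq ((1 - P) * D * P) ≤ frobSq (D * coordProj n k) := by
    rw [e1]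
    have h1 := frobSq_proj_mul_le (D * coordProj n k * P) hP' hPP'
    have h2 := frobSq_proj_mul_le (D * coordProj n k * (1 - P)) hP hPP
    have h3 : frobSq (P * (D * coordProj n k * (1 - P))) =
        frobSq ((1 - P) * (D * coordProj n k * P)) := by
      rw [← frobSq_conjTranspose, conjTranspose_mul, conjTranspose_mul, hDc, hP', hP,
        Matrix.mul_assoc]
    have h4 := frobSq_mul_add_frobSq_mul_one_sub (D * coordProj n k) hP hPP
    linarith
  -- On the range of `coordProj n k`, subtracting 1/2 leaves the off-diagonal block unchanged and
  -- centres the resolvent in [-1/2, 1/2]. The block then costs at most a quarter of the rank of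
  -- `coordProj n k - P`.
  have e2 : (1 - P) * D * P = (coordProj n k - P) * (diagonal fun j : Fin n =>
      (((if (j : ℕ) < k then (1 + lam j)⁻¹ - 1 / 2 else 0) : ℝ) : ℂ)) * P := by
    have h1 : (diagonal fun j : Fin n =>
        (((if (j : ℕ) < k then (1 + lam j)⁻¹ - 1 / 2 else 0) : ℝ) : ℂ)) =
        D * coordProj n k - (1 / 2 : ℂ) • coordProj n k := by
      rw [hD', coordProj, ← diagonal_smul]
      ext a b
      by_cases hab : a = b
      · subst hab
        simp only [diagonal_apply_eq, Matrix.sub_apply, Pi.smul_apply]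
        split_ifs <;> simp
      · simp [diagonal_apply_ne _ hab]
    have h2 : coordProj n k * (D * coordProj n k) = D * coordProj n k := by
      rw [hD', coordProj, diagonal_mul_diagonal]
      congr 1
      ext j
      split_ifs <;> simp
    have h3 : (coordProj n k - P) * coordProj n k * P = 0 := by
      rw [Matrix.mul_assoc, hC, Matrix.sub_mul, hC, hPP, sub_self]
    have h4 : (coordProj n k - P) * (D * coordProj n k - (1 / 2 : ℂ) • coordProj n k) * P =
        (coordProj n k - P) * (D * coordProj n k) * P -
          (1 / 2 : ℂ) • ((coordProj n k - P) * coordProj n k * P) := by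
      rw [Matrix.mul_sub, Matrix.sub_mul _ _ P, Matrix.mul_smul, Matrix.smul_mul]
    rw [h1, h4, h3, smul_zero, sub_zero, Matrix.sub_mul (coordProj n k), h2, e1, ← Matrix.mul_assoc,
      Matrix.sub_mul 1 P, Matrix.one_mul]
  have b2 : 4 * frobSq ((1 - P) * D * P) ≤ k - r := by
    rw [e2]
    have h1 := frobSq_mul_proj_le ((coordProj n k - P) * (diagonal fun j : Fin n =>
      (((if (j : ℕ) < k then (1 + lam j)⁻¹ - 1 / 2 else 0) : ℝ) : ℂ))) hP hPP
    have h2 := frobSq_mul_diagonal_le (coordProj n k - P) (d := fun j : Fin n =>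
      if (j : ℕ) < k then (1 + lam j)⁻¹ - 1 / 2 else 0) (c := 1 / 4) (fun j => by
        split_ifs
        · nlinarith [hs0 j, hs1 j]
        · norm_num)
    rw [hEf] at h2
    linarith
  have h0 := frobSq_nonneg ((1 - P) * D * P)
  rw [le_div_iff₀ two_pos]
  exact le_min (by linarith) (by linarith)

/-- With L = diag(lam), D = (1 + L)⁻¹ and Z = (1 - P)L(1 - P), Fischer's inequality bounds the
divergence by log det(1 + Z) - tr(LD - PLPD). In the trace, (1 - P)LD contributes a nonnegative
amount and PL(1 - P)D is small by the resolvent estimate. The rank of Z is at most k - r, so its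
log-determinant costs the gaps with r ≤ j < k and an error. The two errors combine because ‖PL(1 -
P)‖² + ‖Z‖² = ‖(1 - P)L‖². -/
lemma logDetDiv_pinching_le (hlam : ∀ j, 0 ≤ lam j) (hk : ∀ j : Fin n, lam j ≠ 0 ↔ (j : ℕ) < k)
    (hrk : r ≤ k) (hkn : k ≤ n) (hP : Pᴴ = P) (hPP : P * P = P) (hC : coordProj n k * P = P)
    (hPr : (r : ℝ) ≤ frobSq P) :
    logDetDiv (1 + P * (diagonal fun j => (lam j : ℂ)) * P) (1 + diagonal fun j => (lam j : ℂ)) ≤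
      ∑ j ∈ tailIdx n r, logGap (lam j) +
        √(3 / 2 * min (∑ j ∈ Finset.univ.filter fun j : Fin n => (j : ℕ) < k,
          ((1 + lam j)⁻¹) ^ 2) (k - r)) *
          √(frobSq ((1 - P) * diagonal fun j => (lam j : ℂ))) := by
  set H := min (∑ j ∈ Finset.univ.filter fun j : Fin n => (j : ℕ) < k,
          ((1 + lam j)⁻¹) ^ 2) ((k : ℝ) - r) with hH
  have hP' : (1 - P)ᴴ = 1 - P := by simp [hP]
  have hPP' : (1 - P) * (1 - P) = 1 - P := by
    rw [Matrix.sub_mul, Matrix.mul_sub, Matrix.mul_sub, hPP]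
    simp
  have hL : (diagonal fun j => (lam j : ℂ)).PosSemidef :=
    PosSemidef.diagonal fun j => by simpa using hlam j
  have hres := frobSq_resolvent_le hlam hkn hP hPP hC hPr
  rw [← hH] at hres
  have hH0 : 0 ≤ H := by
    have := (frobSq_nonneg _).trans hres
    linarith
  obtain ⟨hE, hEE, hEf⟩ := frobSq_coordProj_sub hkn hP hPP hC
  have hC' : P * coordProj n k = P := by
    rw [← conjTranspose_conjTranspose (P * _), conjTranspose_mul, coordProj_conjTranspose, hP, hC,
      hP]
  have hCL := coordProj_mul_diagonal hk
  set L := diagonal fun j => (lam j : ℂ) with hLdef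
  set D := diagonal fun j => (((1 + lam j)⁻¹ : ℝ) : ℂ) with hD
  have hX : (P * L * P).PosSemidef := by
    have := hL.conjTranspose_mul_mul_same P
    rwa [hP] at this
  have hZ : ((1 - P) * L * (1 - P)).PosSemidef := by
    have := hL.conjTranspose_mul_mul_same (1 - P)
    rwa [hP'] at this
  set J := (Finset.univ.filter fun j : Fin n => (j : ℕ) < k) \
    Finset.univ.filter fun j : Fin n => (j : ℕ) < r with hJ
  have hJc : (J.card : ℝ) = k - r := by
    rw [hJ, card_filter_sdiff hrk hkn, Nat.cast_sub hrk]
  have hJs : ∑ j ∈ J, ((1 + lam j)⁻¹) ^ 2 ≤ H := by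
    refine le_min (Finset.sum_le_sum_of_subset_of_nonneg Finset.sdiff_subset
      fun j _ _ => sq_nonneg _) ?_
    rw [← hJc, Finset.cast_card]
    refine Finset.sum_le_sum fun j _ => ?_
    exact pow_le_one₀ (inv_nonneg.2 (by linarith [hlam j]))
      (inv_le_one_of_one_le₀ (by linarith [hlam j]))
  -- On the range of L, 1 - P acts as `coordProj n k - P`, a projection of rank k - ‖P‖_F² ≤ k - r.
  have hrank : ((1 - P) * L * (1 - P)).rank ≤ J.card := by
    have h1 : (1 - P) * L = (coordProj n k - P) * L := by
      rw [Matrix.sub_mul, Matrix.sub_mul, hCL, Matrix.one_mul]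
    rw [Matrix.mul_assoc, ← Matrix.mul_assoc, h1, Matrix.mul_assoc]
    refine (rank_mul_le_left _ _).trans ?_
    have h2 := rank_of_proj hE hEE
    have h3 : ((coordProj n k - P).rank : ℝ) ≤ J.card := by
      rw [h2, hEf, hJc]
      linarith
    exact_mod_cast h3
  have hlogZ : Real.log (1 + (1 - P) * L * (1 - P)).det.re ≤
      ∑ j ∈ tailIdx n r, logGap (lam j) + √H * √(frobSq ((1 - P) * L * (1 - P))) := by
    obtain ⟨V, hV⟩ := exists_diagonalizes hZ.1
    refine (hV.log_det_one_add_le (hV.nonneg hZ) hlam hrank).trans (add_le_add ?_ ?_)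
    · refine Finset.sum_le_sum_of_subset_of_nonneg (fun j hj => ?_)
        fun j _ _ => logGap_nonneg (hlam j)
      simp only [hJ, Finset.mem_sdiff, Finset.mem_filter, Finset.mem_univ, true_and, not_lt] at hj
      simpa using hj.2
    · exact mul_le_mul_of_nonneg_right (Real.sqrt_le_sqrt hJs) (Real.sqrt_nonneg _)
  have hfis := log_det_one_add_le_pinching hL hP hPP
  have hlogL : Real.log (1 + L).det.re = ∑ j, Real.log (1 + lam j) :=
    (diagonalizes_diagonal lam).log_det_one_add hlam
  have hLD : L * D = diagonal fun j => ((lam j * (1 + lam j)⁻¹ : ℝ) : ℂ) := by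
    rw [hLdef, hD, diagonal_mul_diagonal]
    simp only [Complex.ofReal_mul]
  have htrL : (L * D).trace.re = ∑ j, lam j * (1 + lam j)⁻¹ := by
    rw [hLD, trace_diagonal, ← Complex.ofReal_sum, Complex.ofReal_re]
  have hdec : L * D = P * L * P * D + (1 - P) * (L * D) + P * L * (1 - P) * D := by
    noncomm_ring
  have ht1 : 0 ≤ ((1 - P) * (L * D)).trace.re := by
    have hpsd : (L * D).PosSemidef := by
      rw [hLD]
      refine PosSemidef.diagonal fun j => ?_
      have : 0 ≤ lam j * (1 + lam j)⁻¹ :=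
        mul_nonneg (hlam j) (inv_nonneg.2 (by linarith [hlam j]))
      exact Complex.zero_le_real.2 this
    have h1 := (hpsd.conjTranspose_mul_mul_same (1 - P)).trace_nonneg
    rw [hP', trace_mul_cycle, hPP'] at h1
    exact (Complex.le_def.1 h1).1
  have ht2 : -(P * L * (1 - P) * D).trace.re ≤ √(frobSq (P * L * (1 - P))) * √(H / 2) := by
    have h1 : (P * L * (1 - P) * D).trace =
        (P * L * (1 - P) * ((1 - P) * D * P)).trace := by
      have e : P * L * (1 - P) * ((1 - P) * D * P) = P * (L * (1 - P) * D) * P := by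
        calc _ = P * L * ((1 - P) * (1 - P)) * D * P := by simp only [Matrix.mul_assoc]
          _ = _ := by rw [hPP']; simp only [Matrix.mul_assoc]
      rw [e, trace_mul_cycle P, hPP]
      simp only [Matrix.mul_assoc]
    rw [h1]
    refine (neg_le_abs _).trans ((abs_re_trace_mul_le _ _).trans ?_)
    exact mul_le_mul_of_nonneg_left (Real.sqrt_le_sqrt hres) (Real.sqrt_nonneg _)
  have hsplit : frobSq (P * L * (1 - P)) + frobSq ((1 - P) * L * (1 - P)) =
      frobSq ((1 - P) * L) := by
    have hLc : Lᴴ = L := hL.1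
    have h1 := frobSq_mul_add_frobSq_mul_one_sub ((1 - P) * L) hP hPP
    have h2 : frobSq (P * L * (1 - P)) = frobSq ((1 - P) * L * P) := by
      rw [← frobSq_conjTranspose, conjTranspose_mul, conjTranspose_mul, hP, hP', hLc,
        Matrix.mul_assoc]
    rw [h2, h1]
  have hcs := sqrt_mul_sqrt_add_le (frobSq_nonneg (P * L * (1 - P)))
    (frobSq_nonneg ((1 - P) * L * (1 - P))) hH0
  rw [hsplit] at hcs
  have htr := congrArg (fun M => M.trace.re) hdec
  simp only [trace_add, Complex.add_re] at htr
  rw [htrL] at htr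
  have hgap : ∑ j, logGap (lam j) =
      ∑ j, Real.log (1 + lam j) - ∑ j, lam j * (1 + lam j)⁻¹ := by
    rw [← Finset.sum_sub_distrib]
    rfl
  rw [logDetDiv_one_add_diagonal hlam hX, hgap]
  linarith

end UpperBound

/-! ### Transfer to G through its eigenvectors. -/

section Spectral

variable {n r : ℕ} {G V : Matrix (Fin n) (Fin n) ℂ}

lemma ne_zero_iff_lt_of_antitone {f : Fin n → ℝ} (hf : Antitone f) (hf0 : ∀ j, 0 ≤ f j)
    (j : Fin n) : f j ≠ 0 ↔ (j : ℕ) < (Finset.univ.filter fun j => f j ≠ 0).card := by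
  refine ⟨fun h => ?_, fun h h0 => ?_⟩
  · have hsub : Finset.univ.filter (fun i : Fin n => (i : ℕ) < j + 1) ⊆
        Finset.univ.filter fun j => f j ≠ 0 := fun i hi => by
      simp only [Finset.mem_filter, Finset.mem_univ, true_and] at hi ⊢
      have h1 : f j ≤ f i := hf (Nat.lt_succ_iff.1 hi)
      exact ne_of_gt (lt_of_lt_of_le (lt_of_le_of_ne (hf0 j) h.symm) h1)
    have := Finset.card_le_card hsub
    rw [Fin.card_filter_val_lt] at this
    omega
  · have hsub : (Finset.univ.filter fun j => f j ≠ 0) ⊆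
        Finset.univ.filter fun i : Fin n => (i : ℕ) < j := fun i hi => by
      simp only [Finset.mem_filter, Finset.mem_univ, true_and] at hi ⊢
      by_contra hij
      exact hi (le_antisymm (h0 ▸ hf (not_lt.1 hij)) (hf0 i))
    have := Finset.card_le_card hsub
    rw [Fin.card_filter_val_lt] at this
    omega

lemma eig_ne_zero_iff (hG : G.PosSemidef) (j : Fin n) : eig G (j + 1) ≠ 0 ↔ (j : ℕ) < G.rank := by
  obtain ⟨V, hV⟩ := exists_diagonalizes hG.1
  rw [hV.rank_eq]
  exact ne_zero_iff_lt_of_antitone (antitone_eig G) (hV.nonneg hG) j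

lemma eig_nonneg (hG : G.PosSemidef) (j : Fin n) : 0 ≤ eig G (j + 1) := by
  obtain ⟨V, hV⟩ := exists_diagonalizes hG.1
  exact hV.nonneg hG j

lemma Diagonalizes.isUnit_det {μ : Fin n → ℝ} (h : Diagonalizes G V μ) : IsUnit V.det :=
  (isUnit_iff_isUnit_det V).1 (IsUnit.of_mul_eq_one _ h.right)

lemma Diagonalizes.conj_conj {μ : Fin n → ℝ} (h : Diagonalizes G V μ)
    (X : Matrix (Fin n) (Fin n) ℂ) : V * (Vᴴ * X * V) * Vᴴ = X := by
  rw [Matrix.mul_assoc, Matrix.mul_assoc, h.right, Matrix.mul_one, ← Matrix.mul_assoc, h.right,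
    Matrix.one_mul]

lemma Diagonalizes.conj_mul_conj {μ : Fin n → ℝ} (h : Diagonalizes G V μ)
    (X Y : Matrix (Fin n) (Fin n) ℂ) : Vᴴ * X * V * (Vᴴ * Y * V) = Vᴴ * (X * Y) * V := by
  calc _ = Vᴴ * X * (V * Vᴴ) * Y * V := by simp only [Matrix.mul_assoc]
    _ = _ := by rw [h.right, Matrix.mul_one]; simp only [Matrix.mul_assoc]

lemma Diagonalizes.frobSq_conj {μ : Fin n → ℝ} (h : Diagonalizes G V μ)
    (X : Matrix (Fin n) (Fin n) ℂ) : frobSq (Vᴴ * X * V) = frobSq X := by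
  have h1 := frobSq_mul_isometry (V * (Vᴴ * X * V)) h.left
  rw [h.conj_conj, frobSq_isometry_mul _ h.left] at h1
  exact h1.symm

lemma Diagonalizes.logDetDiv_eq {μ : Fin n → ℝ} (h : Diagonalizes G V μ)
    (X : Matrix (Fin n) (Fin n) ℂ) : logDetDiv (1 + X) (1 + G) =
      logDetDiv (1 + Vᴴ * X * V) (1 + diagonal fun j => (μ j : ℂ)) := by
  have hone : ∀ M : Matrix (Fin n) (Fin n) ℂ, V * (1 + M) * Vᴴ = 1 + V * M * Vᴴ := fun M => by
    rw [Matrix.mul_add, Matrix.add_mul, Matrix.mul_one, h.right]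
  rw [← logDetDiv_conj h.isUnit_det (1 + Vᴴ * X * V), hone, hone, h.conj_conj, ← h.eq]

/-- The sum of the gaps of the eigenvalues from the `r + 1`-st on. -/
noncomputable def gapTail (G : Matrix (Fin n) (Fin n) ℂ) (r : ℕ) : ℝ :=
  ∑ j ∈ tailIdx n r, logGap (eig G (j + 1))

/-- The smaller of the squared norm of the nontrivial part of the resolvent and of the number of
nonzero eigenvalues beyond the `r`-th. -/
noncomputable def resolventSize (G : Matrix (Fin n) (Fin n) ℂ) (r : ℕ) : ℝ :=
  min (∑ j ∈ Finset.univ.filter fun j : Fin n => (j : ℕ) < G.rank, ((1 + eig G (j + 1))⁻¹) ^ 2)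
    (G.rank - r)

lemma gapTail_le_logDetDiv (hr : r < n) (hG : G.PosSemidef) {X : Matrix (Fin n) (Fin n) ℂ}
    (hX : X.PosSemidef) (hXr : X.rank ≤ r) : gapTail G r ≤ logDetDiv (1 + X) (1 + G) := by
  obtain ⟨V, hV⟩ := exists_diagonalizes hG.1
  rw [hV.logDetDiv_eq]
  refine sum_logGap_le_logDetDiv hr (hV.nonneg hG) (antitone_eig G)
    (hX.conjTranspose_mul_mul_same V) (le_trans ?_ hXr)
  exact (rank_mul_le_left _ _).trans (rank_mul_le_right _ _)

/-- The factorisation P = G M puts the range of P inside that of G; in an eigenbasis P then lives on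
the first `G.rank` coordinates. -/
lemma logDetDiv_one_add_pinching_le (hG : G.PosSemidef) (hr : r ≤ G.rank)
    {P M : Matrix (Fin n) (Fin n) ℂ} (hP : Pᴴ = P) (hPP : P * P = P) (hPG : P = G * M)
    (hPr : (r : ℝ) ≤ frobSq P) :
    logDetDiv (1 + P * G * P) (1 + G) ≤
      gapTail G r + √(3 / 2 * resolventSize G r) * √(frobSq ((1 - P) * G)) := by
  obtain ⟨V, hV⟩ := exists_diagonalizes hG.1
  have hk := eig_ne_zero_iff hG
  have hkn : G.rank ≤ n := by simpa using G.rank_le_width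
  have hC : coordProj n G.rank * (Vᴴ * P * V) = Vᴴ * P * V := by
    have h1 : Vᴴ * P * V = Vᴴ * G * V * (Vᴴ * M * V) := by rw [hV.conj_mul_conj, ← hPG]
    rw [h1, hV.conj_eq, ← Matrix.mul_assoc, coordProj_mul_diagonal hk]
  have hPc : (Vᴴ * P * V)ᴴ = Vᴴ * P * V := by
    rw [conjTranspose_mul, conjTranspose_mul, hP, conjTranspose_conjTranspose, Matrix.mul_assoc]
  have h := logDetDiv_pinching_le (hV.nonneg hG) hk hr hkn hPc (by rw [hV.conj_mul_conj, hPP]) hC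
    (by rwa [hV.frobSq_conj])
  have h1 : (1 - Vᴴ * P * V) = Vᴴ * (1 - P) * V := by
    rw [Matrix.mul_sub, Matrix.sub_mul, Matrix.mul_one, hV.left]
  rw [← hV.conj_eq, h1, hV.conj_mul_conj, hV.conj_mul_conj, hV.conj_mul_conj, hV.conj_eq,
    hV.frobSq_conj, ← hV.logDetDiv_eq] at h
  exact h

/-- Orthonormal rows spanning the dominant eigenspace of dimension `r`. -/
lemma exists_dominant_rows (hr : r ≤ n) (hG : G.IsHermitian) :
    ∃ W : Matrix (Fin r) (Fin n) ℂ, W * Wᴴ = 1 ∧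
      frobSq (G * (1 - Wᴴ * W)) = ∑ j ∈ tailIdx n r, eig G (j + 1) ^ 2 := by
  obtain ⟨V, hV⟩ := exists_diagonalizes hG
  refine ⟨Vᴴ.submatrix (Fin.castLE hr) id, ?_, ?_⟩
  · rw [conjTranspose_submatrix, ← submatrix_mul _ _ _ id _ Function.bijective_id,
      conjTranspose_conjTranspose, hV.left]
    exact submatrix_one _ (Fin.castLE_injective hr)
  · have hW : (Vᴴ.submatrix (Fin.castLE hr) id)ᴴ * Vᴴ.submatrix (Fin.castLE hr) id =
        V * coordProj n r * Vᴴ := by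
      ext a b
      rw [mul_apply, mul_apply]
      simp only [coordProj, mul_diagonal, conjTranspose_apply, submatrix_apply, id]
      have h1 : ∀ j : Fin n, V a j * (((if (j : ℕ) < r then 1 else 0) : ℝ) : ℂ) * star (V b j) =
          if (j : ℕ) < r then V a j * star (V b j) else 0 := fun j => by
        split_ifs <;> simp
      simp only [h1, star_star]
      rw [← Finset.sum_filter]
      refine Finset.sum_bij (fun j _ => Fin.castLE hr j) (fun j _ => by simp)
        (fun i _ j _ h => Fin.castLE_injective hr h) (fun j hj => ?_) fun j _ => rfl
      simp only [Finset.mem_filter, Finset.mem_univ, true_and] at hj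
      exact ⟨⟨j, hj⟩, Finset.mem_univ _, rfl⟩
    have hD : Diagonalizes (G * (1 - V * coordProj n r * Vᴴ)) V
        fun j => if r ≤ (j : ℕ) then eig G (j + 1) else 0 := by
      refine ⟨hV.left, hV.right, ?_⟩
      have h1 : (diagonal fun j : Fin n =>
          (((if r ≤ (j : ℕ) then eig G (j + 1) else 0) : ℝ) : ℂ)) =
          Vᴴ * G * V * (1 - coordProj n r) := by
        rw [hV.conj_eq, coordProj, ← diagonal_one]
        ext a b
        by_cases hab : a = b
        · subst hab
          rw [diagonal_mul, Matrix.sub_apply]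
          simp only [diagonal_apply_eq]
          by_cases h : r ≤ (a : ℕ)
          · simp [h, not_lt.2 h]
          · simp [h, not_le.1 h]
        · rw [diagonal_mul, Matrix.sub_apply]
          simp [diagonal_apply_ne _ hab]
      rw [h1]
      have h2 : V * (Vᴴ * G * V * (1 - coordProj n r)) * Vᴴ =
          (V * Vᴴ) * G * (V * Vᴴ - V * coordProj n r * Vᴴ) := by noncomm_ring
      rw [h2, hV.right, Matrix.one_mul]
    rw [hW, hD.frobSq_eq, Finset.sum_filter]
    refine Finset.sum_congr rfl fun j _ => ?_
    split_ifs <;> simp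

lemma frobSq_resolvent (hG : G.PosSemidef) :
    frobSq (1 + G)⁻¹ = ∑ j : Fin n, ((1 + eig G (j + 1))⁻¹) ^ 2 := by
  obtain ⟨V, hV⟩ := exists_diagonalizes hG.1
  have h0 := hV.nonneg hG
  have h : Diagonalizes (1 + G)⁻¹ V fun j => (1 + eig G (j + 1))⁻¹ := by
    refine ⟨hV.left, hV.right, ?_⟩
    have h1 : 1 + G = V * (1 + diagonal fun j : Fin n => (eig G (j + 1) : ℂ)) * Vᴴ := by
      rw [Matrix.mul_add, Matrix.add_mul, Matrix.mul_one, hV.right, ← hV.eq]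
    rw [h1, Matrix.mul_inv_rev, Matrix.mul_inv_rev, inv_one_add_diagonal h0,
      inv_eq_right_inv hV.left, inv_eq_right_inv hV.right, Matrix.mul_assoc]
  exact h.frobSq_eq

end Spectral

/-! ### Orthogonal projections onto column ranges. -/

section RangeProj

variable {n m : ℕ} {Y Θ : Matrix (Fin n) (Fin m) ℂ}

/-- The orthogonal projection onto the range of `Y`, when its columns are independent. -/
noncomputable def rangeProj (Y : Matrix (Fin n) (Fin m) ℂ) : Matrix (Fin n) (Fin n) ℂ :=
  Y * (Yᴴ * Y)⁻¹ * Yᴴ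

lemma annProj_conjTranspose_eq (Y : Matrix (Fin n) (Fin m) ℂ) : annProj Yᴴ = 1 - rangeProj Y := by
  rw [annProj, rangeProj, conjTranspose_conjTranspose]

lemma rangeProj_conjTranspose (Y : Matrix (Fin n) (Fin m) ℂ) :
    (rangeProj Y)ᴴ = rangeProj Y := by
  have h := annProj_conjTranspose Yᴴ
  rw [annProj_conjTranspose_eq, conjTranspose_sub, conjTranspose_one] at h
  exact sub_right_injective h

lemma rangeProj_mul (hY : IsUnit (Yᴴ * Y).det) : rangeProj Y * Y = Y := by
  rw [rangeProj, Matrix.mul_assoc, Matrix.mul_assoc, Matrix.nonsing_inv_mul _ hY, Matrix.mul_one]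

lemma rangeProj_mul_self (hY : IsUnit (Yᴴ * Y).det) :
    rangeProj Y * rangeProj Y = rangeProj Y := by
  calc rangeProj Y * rangeProj Y = rangeProj Y * Y * (Yᴴ * Y)⁻¹ * Yᴴ := by
        rw [Matrix.mul_assoc, Matrix.mul_assoc, ← Matrix.mul_assoc Y, ← rangeProj]
    _ = rangeProj Y := by rw [rangeProj_mul hY, rangeProj]

lemma frobSq_rangeProj (hY : IsUnit (Yᴴ * Y).det) : frobSq (rangeProj Y) = m := by
  have h := frobSq_of_proj (rangeProj_conjTranspose Y) (rangeProj_mul_self hY)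
  have ht : (rangeProj Y).trace = m := by
    rw [rangeProj, Matrix.mul_assoc, trace_mul_comm, Matrix.mul_assoc,
      Matrix.nonsing_inv_mul _ hY, trace_one, Fintype.card_fin]
  rw [ht] at h
  exact_mod_cast h

lemma MeasurableEntries.rangeProj {α : Type*} [MeasurableSpace α] {f : α → Matrix (Fin n) (Fin m) ℂ}
    (hf : MeasurableEntries f) : MeasurableEntries fun x => rangeProj (f x) :=
  (hf.mul (hf.conjTranspose.mul hf).inv).mul hf.conjTranspose

lemma exists_eq_mul_of_range_le {l : ℕ} {A : Matrix (Fin n) (Fin m) ℂ}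
    {B : Matrix (Fin n) (Fin l) ℂ}
    (h : LinearMap.range A.mulVecLin ≤ LinearMap.range B.mulVecLin) : ∃ C : Matrix (Fin l) (Fin m) ℂ, A = B * C := by
  have h1 : ∀ j, ∃ c, B *ᵥ c = A *ᵥ Pi.single j 1 := fun j => h ⟨Pi.single j 1, rfl⟩
  choose c hc using h1
  refine ⟨of fun i j => c j i, ?_⟩
  ext i j
  have h2 := congrFun (hc j) i
  rw [mulVec_single_one] at h2
  exact h2.symm

/-- As Θ has as many columns as Y, Y = Θ D with D invertible, so Y has full column rank. Hence Θ Θ*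
is a fixed measurable function of Y, whatever basis was chosen. -/
lemma IsOrthonormalRangeBasis.rangeProj_eq (h : IsOrthonormalRangeBasis Y Θ) :
    IsUnit (Yᴴ * Y).det ∧ Θ * Θᴴ = rangeProj Y := by
  obtain ⟨C, hC⟩ := exists_eq_mul_of_range_le h.2.le
  obtain ⟨D, hD⟩ := exists_eq_mul_of_range_le h.2.ge
  have hDC : D * C = 1 := by
    have h1 : Θᴴ * Θ = Θᴴ * Θ * (D * C) := by
      rw [Matrix.mul_assoc Θᴴ, ← Matrix.mul_assoc Θ, ← hD, ← hC]
    rw [h.1, Matrix.one_mul] at h1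
    exact h1.symm
  have hDu : IsUnit D.det := (isUnit_iff_isUnit_det D).1 (IsUnit.of_mul_eq_one _ hDC)
  have hDu' : IsUnit Dᴴ.det := by
    rw [det_conjTranspose]
    exact hDu.star
  have hYY : Yᴴ * Y = Dᴴ * D := by
    rw [hD, conjTranspose_mul, Matrix.mul_assoc, ← Matrix.mul_assoc Θᴴ, h.1, Matrix.one_mul]
  refine ⟨by rw [hYY, det_mul]; exact hDu'.mul hDu, ?_⟩
  rw [rangeProj, hYY, Matrix.mul_inv_rev, hD, conjTranspose_mul]
  calc Θ * Θᴴ = Θ * (D * D⁻¹) * (Dᴴ⁻¹ * Dᴴ) * Θᴴ := by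
        rw [Matrix.mul_nonsing_inv _ hDu, Matrix.nonsing_inv_mul _ hDu', Matrix.mul_one,
          Matrix.mul_one]
    _ = _ := by simp only [Matrix.mul_assoc]

end RangeProj

/-! ### The law of the test matrix. -/

section Law

variable {𝓦 : Type*} [MeasurableSpace 𝓦] {μ : Measure 𝓦} {n m : ℕ}

/-- A real matrix as a vector of its entries. -/
noncomputable def vecOfMat (M : Matrix (Fin n) (Fin m) ℝ) : MatSpace n m :=
  WithLp.toLp 2 fun ij => M ij.1 ij.2

lemma IsGaussianTestMatrix.hasLaw {Ω : 𝓦 → Matrix (Fin n) (Fin m) ℝ}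
    (hΩ : IsGaussianTestMatrix μ Ω) :
    HasLaw (fun ω => vecOfMat (Ω ω)) (stdGaussian (MatSpace n m)) μ := by
  have hm : ∀ ij : Fin n × Fin m, AEMeasurable (fun ω => Ω ω ij.1 ij.2) μ := fun ij =>
    (hΩ.1 ij.1 ij.2).aemeasurable
  have : IsProbabilityMeasure μ := hΩ.2.isProbabilityMeasure
  have hpi := (iIndepFun_iff_map_fun_eq_pi_map hm).1 hΩ.2
  have hlaw : ∀ ij : Fin n × Fin m, μ.map (fun ω => Ω ω ij.1 ij.2) = gaussianReal 0 1 := fun ij =>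
    (hΩ.1 ij.1 ij.2).map_eq
  simp only [hlaw] at hpi
  have hm' : AEMeasurable (fun ω (ij : Fin n × Fin m) => Ω ω ij.1 ij.2) μ := aemeasurable_pi_lambda _ hm
  have hL : Measurable (WithLp.toLp 2 : (Fin n × Fin m → ℝ) → MatSpace n m) := by fun_prop
  refine ⟨hL.comp_aemeasurable hm', ?_⟩
  rw [← map_pi_eq_stdGaussian, ← hpi, AEMeasurable.map_map_of_aemeasurable hL.aemeasurable hm']
  rfl

end Law

/-! ### Expected divergence of the randomised approximation. -/

section Expectation

variable {n m r p : ℕ} {G : Matrix (Fin n) (Fin n) ℂ}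

/-- The divergence of the randomised approximation, as a function of the test matrix. -/
noncomputable def randDiv (G : Matrix (Fin n) (Fin n) ℂ) (x : MatSpace n m) : ℝ :=
  logDetDiv (1 + rangeProj (G * entryMat x) * G * rangeProj (G * entryMat x)) (1 + G)

lemma measurable_randDiv : Measurable (randDiv G : MatSpace n m → ℝ) := by
  have hP : MeasurableEntries fun x : MatSpace n m => rangeProj (G * entryMat x) :=
    ((MeasurableEntries.const G).mul measurableEntries_entryMat).rangeProj
  have hM := ((MeasurableEntries.const (1 : Matrix (Fin n) (Fin n) ℂ)).add
    ((hP.mul (MeasurableEntries.const G)).mul hP)).mul (MeasurableEntries.const (1 + G)⁻¹)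
  exact ((Complex.measurable_re.comp hM.trace).sub
    (Real.measurable_log.comp (Complex.measurable_re.comp hM.det))).sub measurable_const

/-- The squared error of the randomised range finder, as a function of the test matrix. -/
noncomputable def rangeErr (G : Matrix (Fin n) (Fin n) ℂ) (x : MatSpace n m) : ℝ :=
  frobSq ((1 - rangeProj (G * entryMat x)) * G)

lemma measurable_rangeErr : Measurable (rangeErr G : MatSpace n m → ℝ) :=
  (((MeasurableEntries.const 1).sub ((MeasurableEntries.const G).mul
    measurableEntries_entryMat).rangeProj).mul (MeasurableEntries.const G)).frobSq

lemma rangeErr_nonneg (x : MatSpace n m) : 0 ≤ rangeErr G x := frobSq_nonneg _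

lemma rangeErr_le {x : MatSpace n m}
    (hx : IsUnit ((G * entryMat x)ᴴ * (G * entryMat x)).det) : rangeErr G x ≤ frobSq G := by
  have h := rangeProj_mul_self hx
  refine frobSq_proj_mul_le _ (by rw [conjTranspose_sub, rangeProj_conjTranspose,
    conjTranspose_one]) ?_
  rw [Matrix.sub_mul, Matrix.mul_sub, Matrix.mul_sub, h]
  simp

lemma randDiv_nonneg (hG : G.PosSemidef) (x : MatSpace n m) : 0 ≤ randDiv G x := by
  refine logDetDiv_one_add_nonneg ?_ hG
  have := hG.conjTranspose_mul_mul_same (rangeProj (G * entryMat x))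
  rwa [rangeProj_conjTranspose] at this

lemma randDiv_le (hG : G.PosSemidef) (hr : r ≤ G.rank) (hrm : r ≤ m) {x : MatSpace n m}
    (hx : IsUnit ((G * entryMat x)ᴴ * (G * entryMat x)).det) :
    randDiv G x ≤ gapTail G r + √(3 / 2 * resolventSize G r) * √(rangeErr G x) := by
  refine logDetDiv_one_add_pinching_le (M := entryMat x * ((G * entryMat x)ᴴ * (G * entryMat x))⁻¹ *
    (G * entryMat x)ᴴ) hG hr (rangeProj_conjTranspose _) (rangeProj_mul_self hx) ?_ ?_
  · simp only [rangeProj, Matrix.mul_assoc]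
  · rw [frobSq_rangeProj hx]
    exact_mod_cast hrm

/-- The squared error bound `(1 + r / (p - 1)) ∑_{j > r} λ_j²`. -/
noncomputable def errBound (G : Matrix (Fin n) (Fin n) ℂ) (r p : ℕ) : ℝ :=
  (1 + r / ((p : ℝ) - 1)) * ∑ j ∈ tailIdx n r, eig G (j + 1) ^ 2

lemma integrable_rangeErr (hx : ∀ᵐ x ∂stdGaussian (MatSpace n m),
      IsUnit ((G * entryMat x)ᴴ * (G * entryMat x)).det) :
    Integrable (rangeErr G) (stdGaussian (MatSpace n m)) := by
  refine Integrable.of_bound measurable_rangeErr.aestronglyMeasurable (frobSq G) ?_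
  filter_upwards [hx] with x hx
  rw [Real.norm_of_nonneg (rangeErr_nonneg x)]
  exact rangeErr_le hx

lemma integral_rangeErr_le (hG : G.PosSemidef) (hr : r ≤ n) (hp : 2 ≤ p) (hm : m = r + p)
    (hx : ∀ᵐ x ∂stdGaussian (MatSpace n m),
      IsUnit ((G * entryMat x)ᴴ * (G * entryMat x)).det) :
    ∫ x, rangeErr G x ∂stdGaussian (MatSpace n m) ≤ 8 / 3 * errBound G r p := by
  obtain ⟨W, hW, hWG⟩ := exists_dominant_rows hr hG.1
  have h := lintegral_frobSq_one_sub_mul_le hp hm hW G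
    (P := fun x => rangeProj (G * entryMat x)) (by
      filter_upwards [hx] with x hx
      exact ⟨rangeProj_conjTranspose _, rangeProj_mul_self hx, rangeProj_mul hx⟩)
  have hp1 : (0 : ℝ) < (p : ℝ) - 1 := by
    have : (2 : ℝ) ≤ p := by exact_mod_cast hp
    linarith
  rw [integral_eq_lintegral_of_nonneg_ae (f := rangeErr G) (.of_forall rangeErr_nonneg)
    measurable_rangeErr.aestronglyMeasurable]
  refine ENNReal.toReal_le_of_le_ofReal ?_ (h.trans (ENNReal.ofReal_le_ofReal (le_of_eq ?_)))
  · have : 0 ≤ ∑ j ∈ tailIdx n r, eig G (j + 1) ^ 2 := Finset.sum_nonneg fun _ _ => sq_nonneg _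
    rw [errBound]
    positivity
  · rw [hWG, errBound]
    ring

lemma integrable_randDiv (hG : G.PosSemidef) (hr : r ≤ G.rank) (hrm : r ≤ m)
    (hx : ∀ᵐ x ∂stdGaussian (MatSpace n m),
      IsUnit ((G * entryMat x)ᴴ * (G * entryMat x)).det) :
    Integrable (randDiv G) (stdGaussian (MatSpace n m)) := by
  refine Integrable.of_bound measurable_randDiv.aestronglyMeasurable
    (gapTail G r + √(3 / 2 * resolventSize G r) * √(frobSq G)) ?_
  filter_upwards [hx] with x hx
  rw [Real.norm_of_nonneg (randDiv_nonneg hG x)]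
  refine (randDiv_le hG hr hrm hx).trans (add_le_add_right ?_ _)
  exact mul_le_mul_of_nonneg_left (Real.sqrt_le_sqrt (rangeErr_le hx)) (Real.sqrt_nonneg _)

lemma integral_randDiv_le (hG : G.PosSemidef) (hr : r ≤ G.rank) (hp : 2 ≤ p) (hm : m = r + p)
    (hx : ∀ᵐ x ∂stdGaussian (MatSpace n m),
      IsUnit ((G * entryMat x)ᴴ * (G * entryMat x)).det) (hη : 0 < errBound G r p) :
    ∫ x, randDiv G x ∂stdGaussian (MatSpace n m) ≤
      gapTail G r + 2 * √(resolventSize G r) * √(errBound G r p) := by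
  have hrn : r ≤ n := hr.trans (by simpa using G.rank_le_width)
  -- The inequality √e ≤ η/2 + e/(2η) plays the part of Jensen's; taking η² equal to the bound on
  -- the mean of e balances its two halves.
  set η := √(8 / 3 * errBound G r p) with hηdef
  have hηpos : 0 < η := Real.sqrt_pos.2 (by positivity)
  have hηsq : η * η = 8 / 3 * errBound G r p := Real.mul_self_sqrt (by positivity)
  set c := √(3 / 2 * resolventSize G r) with hc
  have hint := integrable_rangeErr hx
  have hle : ∀ᵐ x ∂stdGaussian (MatSpace n m),
      randDiv G x ≤ gapTail G r + c / 2 * η + c / (2 * η) * rangeErr G x := by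
    filter_upwards [hx] with x hx
    refine (randDiv_le hG hr (by omega) hx).trans ?_
    have h1 : √(rangeErr G x) ≤ η / 2 + rangeErr G x / (2 * η) := by
      have h2 := Real.mul_self_sqrt (rangeErr_nonneg (G := G) x)
      have h3 : η / 2 + rangeErr G x / (2 * η) - √(rangeErr G x) =
          (η - √(rangeErr G x)) ^ 2 / (2 * η) := by
        field_simp
        nlinarith
      have h4 : 0 ≤ (η - √(rangeErr G x)) ^ 2 / (2 * η) := by positivity
      linarith
    have h5 := mul_le_mul_of_nonneg_left h1 (Real.sqrt_nonneg (3 / 2 * resolventSize G r))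
    rw [← hc] at h5 ⊢
    have h6 : c * (η / 2 + rangeErr G x / (2 * η)) =
        c / 2 * η + c / (2 * η) * rangeErr G x := by
      field_simp
    linarith
  have hI := integral_mono_ae (integrable_randDiv hG hr (by omega) hx)
    ((integrable_const (gapTail G r + c / 2 * η)).add (hint.const_mul (c / (2 * η)))) hle
  simp only [Pi.add_apply] at hI
  rw [integral_add (integrable_const _) (hint.const_mul _), integral_const, integral_const_mul] at hI
  simp only [probReal_univ, one_smul] at hI
  have h7 := mul_le_mul_of_nonneg_left (integral_rangeErr_le hG hrn hp hm hx)
    (show 0 ≤ c / (2 * η) by positivity)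
  have h8 : c / (2 * η) * (8 / 3 * errBound G r p) = c / 2 * η := by
    rw [← hηsq]
    field_simp
  have h9 : c * η = 2 * √(resolventSize G r) * √(errBound G r p) := by
    rw [hc, hηdef, Real.sqrt_mul (by norm_num), Real.sqrt_mul (by norm_num)]
    -- The constants of the deterministic and of the probabilistic estimate meet here.
    have h10 : √(3 / 2) * √(8 / 3) = 2 := by
      rw [← Real.sqrt_mul (by norm_num), show (3 / 2 : ℝ) * (8 / 3) = 2 ^ 2 by norm_num,
        Real.sqrt_sq (by norm_num)]
    linear_combination √(resolventSize G r) * √(errBound G r p) * h10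
  linarith

end Expectation

/-! ### Elimination of Q. -/

section Preconditioner

variable {n : ℕ} {A B Q S G : Matrix (Fin n) (Fin n) ℂ}

lemma isUnit_det_of_posDef_mul (hA : A.PosDef) (hAQ : A = Q * Qᴴ) : IsUnit Q.det := by
  have h := (isUnit_iff_isUnit_det A).1 hA.isUnit
  rw [hAQ, det_mul] at h
  exact isUnit_of_mul_isUnit_left h

lemma scaledMatrix_posSemidef (hB : B.PosSemidef) : (scaledMatrix Q B).PosSemidef :=
  hB.mul_mul_conjTranspose_same Q⁻¹

lemma rank_scaledMatrix (hQ : IsUnit Q.det) : (scaledMatrix Q B).rank = B.rank := by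
  have h1 : IsUnit (Q⁻¹).det := isUnit_nonsing_inv_det Q hQ
  have h2 : IsUnit ((Q⁻¹)ᴴ).det := by
    rw [det_conjTranspose]
    exact h1.star
  rw [scaledMatrix, rank_mul_eq_left_of_isUnit_det _ _ h2, rank_mul_eq_right_of_isUnit_det _ _ h1]

/-- Since Q Q* + B = Q (1 + G) Q*, both arguments are congruent by the same Q. -/
lemma logDetDiv_precond (hQ : IsUnit Q.det) (X : Matrix (Fin n) (Fin n) ℂ) :
    logDetDiv (precond Q X) (Q * Qᴴ + B) = logDetDiv (1 + X) (1 + scaledMatrix Q B) := by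
  have hQ' : IsUnit Qᴴ.det := by
    rw [det_conjTranspose]
    exact hQ.star
  have h : Q * Qᴴ + B = Q * (1 + scaledMatrix Q B) * Qᴴ := by
    rw [scaledMatrix, conjTranspose_nonsing_inv, Matrix.mul_add, Matrix.add_mul, Matrix.mul_one]
    congr 1
    calc B = Q * Q⁻¹ * B * (Qᴴ⁻¹ * Qᴴ) := by
          rw [Matrix.mul_nonsing_inv _ hQ, Matrix.nonsing_inv_mul _ hQ', Matrix.one_mul,
            Matrix.mul_one]
      _ = _ := by simp only [Matrix.mul_assoc]
  rw [h, precond, logDetDiv_conj hQ]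

end Preconditioner

/-! ### Comparison with the constants of the theorem. -/

section Constants

variable {n r p : ℕ} {G : Matrix (Fin n) (Fin n) ℂ}

lemma sqrt_errBound_eq (G : Matrix (Fin n) (Fin n) ℂ) (r p : ℕ) :
    √(errBound G r p) = epsBound G r p := by
  rw [errBound, epsBound]
  congr 2
  refine Finset.sum_bij (fun j _ => (j : ℕ) + 1) (fun j hj => ?_) (fun i _ j _ h => ?_)
    (fun b hb => ?_) fun j _ => rfl
  · simp only [Finset.mem_filter, Finset.mem_univ, true_and] at hj
    rw [Finset.mem_Icc]
    exact ⟨by omega, j.2⟩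
  · exact Fin.ext (Nat.succ_injective h)
  · rw [Finset.mem_Icc] at hb
    exact ⟨⟨b - 1, by omega⟩, by simp only [Finset.mem_filter, Finset.mem_univ, true_and]; omega,
      by simp only; omega⟩

lemma frobNorm_eq_sqrt (M : Matrix (Fin n) (Fin n) ℂ) : frobNorm M = √(frobSq M) := by
  rw [frobNorm, Matrix.frobenius_norm_def, Real.sqrt_eq_rpow, frobSq]
  simp only [Real.rpow_two]

lemma eig_pos (hG : G.PosSemidef) {j : Fin n} (hj : (j : ℕ) < G.rank) : 0 < eig G (j + 1) :=
  lt_of_le_of_ne (eig_nonneg hG j) ((eig_ne_zero_iff hG j).2 hj).symm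

lemma sqrt_frobSq_resolvent_le_cBound (hG : G.PosSemidef) (hk : 1 ≤ G.rank) :
    √(frobSq (1 + G)⁻¹) ≤ cBound G r G.rank := by
  have hkn : G.rank ≤ n := by simpa using G.rank_le_width
  have h := eig_nonneg hG ⟨G.rank - 1, by omega⟩
  simp only [Nat.sub_add_cancel hk] at h
  rw [cBound, frobNorm_eq_sqrt]
  have : 0 ≤ (r : ℝ) * (1 + eig G G.rank)⁻¹ := by positivity
  linarith

lemma resolventSize_le (G : Matrix (Fin n) (Fin n) ℂ) (hG : G.PosSemidef) (r : ℕ) :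
    resolventSize G r ≤ frobSq (1 + G)⁻¹ := by
  rw [frobSq_resolvent hG]
  exact (min_le_left _ _).trans (Finset.sum_le_sum_of_subset_of_nonneg (Finset.filter_subset _ _)
    fun _ _ _ => sq_nonneg _)

/-- Zero eigenvalues contribute 1 each, so ‖(1 + G)⁻¹‖² = a + (n - k) with k the rank. Then H (n -
r) = H (n - k) + H (k - r), where H ≤ k - r serves the first term and H ≤ a the second; this is what
the minimum in `resolventSize` is for. -/
lemma resolventSize_mul_le (hG : G.PosSemidef) (hr : r ≤ G.rank) :
    resolventSize G r * (n - r) ≤ frobSq (1 + G)⁻¹ * (G.rank - r) := by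
  have hkn : G.rank ≤ n := by simpa using G.rank_le_width
  have hkn' : (G.rank : ℝ) ≤ n := by exact_mod_cast hkn
  have hr' : (r : ℝ) ≤ G.rank := by exact_mod_cast hr
  set a := ∑ j ∈ Finset.univ.filter fun j : Fin n => (j : ℕ) < G.rank, ((1 + eig G (j + 1))⁻¹) ^ 2
    with ha
  have hsum : frobSq (1 + G)⁻¹ = a + (n - G.rank) := by
    rw [frobSq_resolvent hG, ← Finset.sum_filter_add_sum_filter_not Finset.univ
      fun j : Fin n => (j : ℕ) < G.rank, ← ha]
    congr 1
    have h1 : ∀ j ∈ Finset.univ.filter (fun j : Fin n => ¬ (j : ℕ) < G.rank),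
        ((1 + eig G (j + 1))⁻¹) ^ 2 = 1 := fun j hj => by
      have h2 : eig G (j + 1) = 0 := by
        by_contra h
        exact (Finset.mem_filter.1 hj).2 ((eig_ne_zero_iff hG j).1 h)
      rw [h2]
      norm_num
    rw [Finset.sum_congr rfl h1, Finset.sum_const, nsmul_eq_mul, mul_one]
    have h3 := Finset.card_filter_add_card_filter_not (s := (Finset.univ : Finset (Fin n)))
      fun j : Fin n => (j : ℕ) < G.rank
    rw [Fin.card_filter_val_lt, min_eq_right hkn, Finset.card_univ, Fintype.card_fin] at h3
    rw [eq_sub_iff_add_eq, add_comm]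
    exact_mod_cast h3
  have h1 : resolventSize G r ≤ a := min_le_left _ _
  have h2 : resolventSize G r ≤ G.rank - r := min_le_right _ _
  rw [hsum]
  nlinarith

/-- The tail contains `G.rank - r` nonzero eigenvalues, none below the last one, and g is
increasing. -/
lemma gapTail_ge (hG : G.PosSemidef) (hk : 1 ≤ G.rank) (hr : r ≤ G.rank) :
    (G.rank - r : ℝ) * logGap (eig G G.rank) ≤ gapTail G r := by
  have hkn : G.rank ≤ n := by simpa using G.rank_le_width
  have hc := card_filter_sdiff hr hkn
  set J := (Finset.univ.filter fun j : Fin n => (j : ℕ) < G.rank) \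
    Finset.univ.filter fun j : Fin n => (j : ℕ) < r with hJ
  have hkn' : G.rank - 1 < n := by omega
  have hk' : G.rank - 1 + 1 = G.rank := Nat.sub_add_cancel hk
  have hmem : ∀ j ∈ J, (j : ℕ) < G.rank ∧ r ≤ (j : ℕ) := fun j hj => by
    simpa [hJ] using hj
  have h1 : (G.rank - r : ℝ) * logGap (eig G G.rank) = ∑ j ∈ J, logGap (eig G G.rank) := by
    rw [Finset.sum_const, hc, nsmul_eq_mul, Nat.cast_sub hr]
  rw [h1]
  refine (Finset.sum_le_sum fun j hj => ?_).trans
    (Finset.sum_le_sum_of_subset_of_nonneg (fun j hj => ?_)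
      fun j _ _ => logGap_nonneg (eig_nonneg hG j))
  · have h2 := eig_nonneg hG ⟨G.rank - 1, hkn'⟩
    have h3 := antitone_eig G (show j ≤ ⟨G.rank - 1, hkn'⟩ from by
      have := (hmem j hj).1
      rw [Fin.le_def]
      simp only
      omega)
    simp only [hk'] at h2 h3
    exact logGap_mono h2 h3
  · simpa using (hmem j hj).2

lemma errBound_le (hG : G.PosSemidef) (hp : 2 ≤ p) (hr : r < G.rank) :
    errBound G r p ≤ (1 + r / ((p : ℝ) - 1)) * ((G.rank - r) * eig G (r + 1) ^ 2) := by
  have hkn : G.rank ≤ n := by simpa using G.rank_le_width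
  have hp1 : (0 : ℝ) < (p : ℝ) - 1 := by
    have : (2 : ℝ) ≤ p := by exact_mod_cast hp
    linarith
  have hc := card_filter_sdiff hr.le hkn
  set J := (Finset.univ.filter fun j : Fin n => (j : ℕ) < G.rank) \
    Finset.univ.filter fun j : Fin n => (j : ℕ) < r with hJ
  refine mul_le_mul_of_nonneg_left ?_ (by positivity)
  have h1 : ((G.rank : ℝ) - r) * eig G (r + 1) ^ 2 = ∑ j ∈ J, eig G (r + 1) ^ 2 := by
    rw [Finset.sum_const, hc, nsmul_eq_mul, Nat.cast_sub hr.le]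
  rw [h1, ← Finset.sum_subset (s₁ := J) (s₂ := tailIdx n r)]
  · refine Finset.sum_le_sum fun j hj => pow_le_pow_left₀ (eig_nonneg hG j) ?_ 2
    have hj' : r ≤ (j : ℕ) := by
      simp only [hJ, Finset.mem_sdiff, Finset.mem_filter, Finset.mem_univ, true_and, not_lt] at hj
      exact hj.2
    exact antitone_eig G (show (⟨r, by omega⟩ : Fin n) ≤ j from hj')
  · intro j hj
    simp only [hJ, Finset.mem_sdiff, Finset.mem_filter, Finset.mem_univ, true_and, not_lt] at hj ⊢
    exact hj.2
  · intro j hj hjJ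
    simp only [hJ, Finset.mem_sdiff, Finset.mem_filter, Finset.mem_univ, true_and, not_lt,
      not_and] at hj hjJ
    have : eig G (j + 1) = 0 := by
      by_contra h
      exact hjJ ((eig_ne_zero_iff hG j).1 h) hj
    rw [this]
    norm_num

lemma errBound_pos (hG : G.PosSemidef) (hp : 2 ≤ p) (hr : r < G.rank) : 0 < errBound G r p := by
  have hkn : G.rank ≤ n := by simpa using G.rank_le_width
  have hp1 : (0 : ℝ) < (p : ℝ) - 1 := by
    have : (2 : ℝ) ≤ p := by exact_mod_cast hp
    linarith
  refine mul_pos (by positivity) (Finset.sum_pos' (fun _ _ => sq_nonneg _)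
    ⟨⟨r, by omega⟩, by simp, ?_⟩)
  exact pow_pos (eig_pos (j := ⟨r, by omega⟩) hG hr) 2

/-- The relative form of the bound. -/
lemma two_mul_sqrt_div_le (hG : G.PosSemidef) (hp : 2 ≤ p) (hr : r < G.rank) {d : ℝ}
    (hd : gapTail G r ≤ d) :
    2 * √(resolventSize G r) * √(errBound G r p) / d ≤
      2 * cBound G r G.rank * √((1 + (r : ℝ) / ((p : ℝ) - 1)) / ((n : ℝ) - r)) *
        (eig G (r + 1) / logGap (eig G G.rank)) := by
  have hkn : G.rank ≤ n := by simpa using G.rank_le_width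
  have hk1 : 1 ≤ G.rank := by omega
  have hp1 : (0 : ℝ) < (p : ℝ) - 1 := by
    have : (2 : ℝ) ≤ p := by exact_mod_cast hp
    linarith
  have hK : (0 : ℝ) < (G.rank : ℝ) - r := sub_pos.2 (by exact_mod_cast hr)
  have hnr : (0 : ℝ) < (n : ℝ) - r := sub_pos.2 (by exact_mod_cast hr.trans_le hkn)
  have hq : 0 ≤ 1 + (r : ℝ) / ((p : ℝ) - 1) := by positivity
  have hlam : 0 ≤ eig G (r + 1) := eig_nonneg hG ⟨r, by omega⟩
  have hgap : 0 < logGap (eig G G.rank) := by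
    have h := eig_pos (j := ⟨G.rank - 1, by omega⟩) hG (by simp only; omega)
    simp only [Nat.sub_add_cancel hk1] at h
    exact logGap_pos h
  have hge := gapTail_ge hG hk1 hr.le
  have hden : 0 < ((G.rank : ℝ) - r) * logGap (eig G G.rank) := mul_pos hK hgap
  set q := 1 + (r : ℝ) / ((p : ℝ) - 1) with hqdef
  set K := (G.rank : ℝ) - r with hKdef
  have h1 : √(errBound G r p) ≤ √q * (√K * eig G (r + 1)) := by
    refine (Real.sqrt_le_sqrt (errBound_le hG hp hr)).trans (le_of_eq ?_)
    rw [Real.sqrt_mul hq, Real.sqrt_mul hK.le, Real.sqrt_sq hlam]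
  have h2 : √(resolventSize G r) * √((n : ℝ) - r) ≤ cBound G r G.rank * √K := by
    rw [← Real.sqrt_mul' _ hnr.le]
    refine (Real.sqrt_le_sqrt (resolventSize_mul_le hG hr.le)).trans ?_
    rw [Real.sqrt_mul (frobSq_nonneg _)]
    exact mul_le_mul_of_nonneg_right (sqrt_frobSq_resolvent_le_cBound hG hk1) (Real.sqrt_nonneg _)
  have hsK := Real.mul_self_sqrt hK.le
  have hsKpos := Real.sqrt_pos.2 hK
  have hsn := Real.sqrt_pos.2 hnr
  -- One √K comes from the error bound and one from `resolventSize_mul_le`; together they cancel the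
  -- K supplied by `gapTail_ge`.
  calc 2 * √(resolventSize G r) * √(errBound G r p) / d
      ≤ 2 * √(resolventSize G r) * (√q * (√K * eig G (r + 1))) / (K * logGap (eig G G.rank)) :=
        div_le_div₀ (by positivity) (mul_le_mul_of_nonneg_left h1 (by positivity)) hden
          (hge.trans hd)
    _ = 2 * (√(resolventSize G r) * √((n : ℝ) - r)) / (√K * √((n : ℝ) - r)) * √q *
        (eig G (r + 1) / logGap (eig G G.rank)) := by
      rw [← hsK]
      field_simp
      rw [Real.sqrt_sq hsKpos.le]
    _ ≤ 2 * (cBound G r G.rank * √K) / (√K * √((n : ℝ) - r)) * √q *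
        (eig G (r + 1) / logGap (eig G G.rank)) := by
      gcongr
    _ = _ := by
      rw [Real.sqrt_div hq]
      field_simp

end Constants

/-! ### The theorem. -/

theorem mainTheorem3 {n r p : ℕ} (A B Q S G Shat : Matrix (Fin n) (Fin n) ℂ)
    (hA : A.PosDef) (hAQ : A = Q * Qᴴ) (hB : B.PosSemidef)
    (hS : S = A + B) (hG : G = scaledMatrix Q B)
    (hp : 2 ≤ p) (hrp : r + p ≤ B.rank)
    (hShat : IsOptimalPrecond Q S r Shat)
    {𝓦 : Type*} [MeasurableSpace 𝓦] (μ : Measure 𝓦) [IsProbabilityMeasure μ]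
    (Ω : 𝓦 → Matrix (Fin n) (Fin (r + p)) ℝ) (hΩ : IsGaussianTestMatrix μ Ω)
    (Θ : 𝓦 → Matrix (Fin n) (Fin (r + p)) ℂ)
    (hΘ : ∀ᵐ ω ∂μ, IsOrthonormalRangeBasis (G * (Ω ω).map Complex.ofReal) (Θ ω))
    (Srand : 𝓦 → Matrix (Fin n) (Fin n) ℂ)
    (hSrand : ∀ ω, Srand ω = precond Q (randSVD G (Θ ω))) :
    Integrable (fun ω => logDetDiv (Srand ω) S) μ ∧
    (∫ ω, logDetDiv (Srand ω) S ∂μ) - logDetDiv Shat S ≤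
      2 * epsBound G r p * cBound G r B.rank ∧
    0 < logDetDiv Shat S ∧
    ((∫ ω, logDetDiv (Srand ω) S ∂μ) - logDetDiv Shat S) / logDetDiv Shat S ≤
      2 * cBound G r B.rank * Real.sqrt ((1 + (r : ℝ) / ((p : ℝ) - 1)) / ((n : ℝ) - r)) *
        (eig G (r + 1) /
          (1 / (1 + eig G B.rank) - Real.log (1 / (1 + eig G B.rank)) - 1)) := by
  have hQ := isUnit_det_of_posDef_mul hA hAQ
  have hGpsd : G.PosSemidef := hG ▸ scaledMatrix_posSemidef hB
  have hrank : B.rank = G.rank := by rw [hG, rank_scaledMatrix hQ]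
  have hkn : G.rank ≤ n := by simpa using G.rank_le_width
  rw [hrank] at hrp ⊢
  have hr : r < G.rank := by omega
  have hk1 : 1 ≤ G.rank := by omega
  have hdiv : ∀ X, logDetDiv (precond Q X) S = logDetDiv (1 + X) (1 + G) := fun X => by
    rw [hS, hAQ, hG, logDetDiv_precond hQ]
  have hlaw := hΩ.hasLaw
  have hxω : ∀ᵐ ω ∂μ, IsUnit ((G * entryMat (vecOfMat (Ω ω)))ᴴ *
      (G * entryMat (vecOfMat (Ω ω)))).det := by
    filter_upwards [hΘ] with ω hω using hω.rangeProj_eq.1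
  -- Full column rank of G Ω is a measurable condition on Ω alone, so it passes to the Gaussian law.
  have hx : ∀ᵐ x ∂stdGaussian (MatSpace n (r + p)),
      IsUnit ((G * entryMat x)ᴴ * (G * entryMat x)).det := by
    have hY : MeasurableEntries fun x : MatSpace n (r + p) => G * entryMat x :=
      (MeasurableEntries.const G).mul measurableEntries_entryMat
    rw [← hlaw.map_eq, ae_map_iff hlaw.aemeasurable]
    · exact hxω
    · simp only [isUnit_iff_ne_zero]
      exact (hY.conjTranspose.mul hY).det (measurableSet_singleton 0).compl
  -- Almost surely Θ Θ* is the range projection of G Ω, so the divergence depends measurably on Ω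
  -- alone.
  have hae : (fun ω => randDiv G (vecOfMat (Ω ω))) =ᵐ[μ] fun ω => logDetDiv (Srand ω) S := by
    filter_upwards [hΘ] with ω hω
    rw [hSrand, hdiv, randSVD, hω.rangeProj_eq.2]
    rfl
  have hint := integrable_randDiv hGpsd hr.le (Nat.le_add_right r p) hx
  have hintμ : Integrable (fun ω => randDiv G (vecOfMat (Ω ω))) μ := by
    rw [← hlaw.map_eq] at hint
    exact hint.comp_aemeasurable hlaw.aemeasurable
  have hE : ∫ ω, logDetDiv (Srand ω) S ∂μ = ∫ x, randDiv G x ∂stdGaussian (MatSpace n (r + p)) := by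
    rw [← integral_congr_ae hae, ← hlaw.map_eq, integral_map hlaw.aemeasurable
      measurable_randDiv.aestronglyMeasurable]
  have hle := integral_randDiv_le hGpsd hr.le hp rfl hx (errBound_pos hGpsd hp hr)
  rw [← hE] at hle
  have hlow : gapTail G r ≤ logDetDiv Shat S := by
    obtain ⟨⟨X, hX, hXr, rfl⟩, -⟩ := hShat
    rw [hdiv]
    exact gapTail_le_logDetDiv (hr.trans_le hkn) hGpsd hX hXr
  have heigk : 0 < eig G G.rank := by
    have h := eig_pos (j := ⟨G.rank - 1, by omega⟩) hGpsd (by simp only; omega)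
    simpa only [Nat.sub_add_cancel hk1] using h
  have hpos : 0 < logDetDiv Shat S := by
    refine lt_of_lt_of_le (lt_of_lt_of_le ?_ (gapTail_ge hGpsd hk1 hr.le)) hlow
    exact mul_pos (sub_pos.2 (by exact_mod_cast hr)) (logGap_pos heigk)
  have hdiff : (∫ ω, logDetDiv (Srand ω) S ∂μ) - logDetDiv Shat S ≤
      2 * √(resolventSize G r) * √(errBound G r p) := by linarith
  refine ⟨hintμ.congr hae, hdiff.trans ?_, hpos, ?_⟩
  · have h1 : √(resolventSize G r) ≤ cBound G r G.rank :=
      (Real.sqrt_le_sqrt (resolventSize_le G hGpsd r)).trans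
        (sqrt_frobSq_resolvent_le_cBound hGpsd hk1)
    have h2 := mul_le_mul_of_nonneg_right h1 (Real.sqrt_nonneg (errBound G r p))
    rw [← sqrt_errBound_eq]
    linarith
  · rw [← logGap_eq heigk.le]
    exact (div_le_div_of_nonneg_right hdiff hpos.le).trans (two_mul_sqrt_div_le hGpsd hp hr hlow)
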